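/- Fix $b_1,b_2\in(0,1)$ and let $\mathcal S=\{0,1\}^{\mathbb Z}$ with its product $\sigma$-algebra; $\eta(x)=1$ means that the site $x$ is occupied by a particle. The stochastic six vertex model is the time-homogeneous Markov process $(\eta_t)_{t\in\mathbb Z_{\ge 0}}$ on $\mathcal S$ whose step from $\eta_t$ to $\eta_{t+1}$ is as follows. Sample independent random variables $\chi(x), j(x)$, $x\in\mathbb Z$ (independent also of the past), with $\mathbb P(\chi(x)=1)=b_1$, $\mathbb P(\chi(x)=0)=1-b_1$ and $\mathbb P(j(x)=n)=(1-b_2)b_2^{\,n-1}$ for $n\ge 1$. Particles are updated from left to right. A particle at $x$ stays at $x$ if $\chi(x)=1$ and the preceding particle does not land on $x$; if $\chi(x)=0$ or the preceding particle lands on $x$, it moves to $\min(x+j(x),x')$, where $x'$ is the position, before the step, of the next particle to the right ($x'=+\infty$ if there is none). If there are infinitely many particles to the left of a site, then almost surely infinitely many of them have $\chi=0$, hence move whatever happens to their left, so the update is almost surely well defined. Let $\mathcal I$ be the set of stationary distributions of this process, that is, of probability measures $\nu$ on $\mathcal S$ such that $\eta_0\sim\nu$ implies $\eta_1\sim\nu$.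 Let $\mathcal I_e$ be the set of its extreme points: those $\nu\in\mathcal I$ that are not of the form $\nu=\alpha\nu_1+(1-\alpha)\nu_2$ with $\nu_1\ne\nu_2$ in $\mathcal I$ and $\alpha\in(0,1)$. For $\rho\in[0,1]$ let $\mu_\rho=\bigotimes_{\mathbb Z}\mathrm{Ber}(\rho)$ be the product Bernoulli measure on $\mathcal S$ with density $\rho$. Theorem. $\mathcal I_e=\{\mu_\rho:\rho\in[0,1]\}$. In particular, every $\nu\in\mathcal I$ is translation invariant: for every $n\in\mathbb Z$, $\nu$ is its own image under the shift $\tau_n:\mathcal S\to\mathcal S$, $(\tau_n\eta)(i)=\eta(i+n)$. -/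

import Mathlib

namespace S6V

open MeasureTheory ProbabilityTheory unitInterval

/-- Particle configurations on the line, `{0,1}^ℤ` with the product σ-algebra;
`η x = true` means that the site `x` is occupied. -/
abbrev Config : Type := ℤ → Bool

/-- The randomness used in one time step. At each site `x`, the first component is the wake-up
variable `χ(x)` (`true` for `1`, `false` for `0`), and the second component is `j(x) - 1`. -/
abbrev Noise : Type := ℤ → Bool × ℕ

/-- The law of the noise: all the variables are independent, `χ(x)` is `1` with probability `b₁`
and `0` with probability `1 - b₁`, and `j(x) = n` with probability `(1 - b₂) b₂ ^ (n - 1)` for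
every `n ≥ 1` (so that `j(x) - 1 = n` with probability `(1 - b₂) b₂ ^ n` for every `n ≥ 0`). -/
noncomputable def noiseLaw (b₁ b₂ : I) : Measure Noise :=
  Measure.infinitePi fun _ : ℤ => (bernoulliMeasure true false b₁).prod (geometricMeasure (σ b₂))

instance (b₁ b₂ : I) : IsProbabilityMeasure (noiseLaw b₁ b₂) := by
  unfold noiseLaw; infer_instance

/-- The wake-up variable `χ(x)`. -/
def chi (ω : Noise) (x : ℤ) : Bool := (ω x).1

/-- The jump length `j(x) ≥ 1`. -/
def jump (ω : Noise) (x : ℤ) : ℤ := (ω x).2 + 1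

/-- `z` is the site where the particle at `x` stops, given that it leaves `x`: `z` is the minimum of
`x + j(x)` and the first occupied site to the right of `x` (if there is one). -/
def Lands (η : Config) (ω : Noise) (x z : ℤ) : Prop :=
  x < z ∧ z ≤ x + jump ω x ∧ (∀ w, x < w → w < z → η w = false) ∧
    (z = x + jump ω x ∨ η z = true)

/-- The particle at `x` leaves `x` during the time step: it wakes up by itself (`χ(x) = 0`), or the
preceding particle moves and lands on `x`. When there are infinitely many particles to the left
of `x`, almost surely infinitely many of them wake up by themselves, so that this
left-to-right recursion has an almost surely unique solution. -/
inductive Moves (η : Config) (ω : Noise) : ℤ → Prop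
  | wake {x : ℤ} : η x = true → chi ω x = false → Moves η ω x
  | push {y x : ℤ} : Moves η ω y → Lands η ω y x → η x = true → Moves η ω x

/-- A site is occupied after the time step if its particle did not leave it, or if some moving
particle lands on it. -/
def OccupiedAfter (η : Config) (ω : Noise) (z : ℤ) : Prop :=
  (η z = true ∧ ¬ Moves η ω z) ∨ ∃ x, Moves η ω x ∧ Lands η ω x z

open scoped Classical in
/-- The configuration after one time step of the stochastic six vertex model. -/
noncomputable def update (η : Config) (ω : Noise) : Config :=
  fun z => decide (OccupiedAfter η ω z)

lemma measurableSet_lands (x z : ℤ) :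
    MeasurableSet {p : Config × Noise | Lands p.1 p.2 x z} := by
  have hη : ∀ (w : ℤ) (b : Bool), MeasurableSet {p : Config × Noise | p.1 w = b} := fun w b =>
    measurableSet_eq_fun (by fun_prop) measurable_const
  have hj : Measurable fun p : Config × Noise => x + jump p.2 x := by
    have h1 : Measurable fun p : Config × Noise => (p.2 x).2 := by fun_prop
    exact (measurable_from_nat (f := fun n : ℕ => x + ((n : ℤ) + 1))).comp h1
  refine MeasurableSet.inter (MeasurableSet.const _) (MeasurableSet.inter
    (measurableSet_le measurable_const hj) (MeasurableSet.inter ?_ (MeasurableSet.union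
      (measurableSet_eq_fun measurable_const hj) (hη z true))))
  exact (MeasurableSet.iInter fun w => MeasurableSet.iInter fun _ : x < w =>
    MeasurableSet.iInter fun _ : w < z => hη w false).congr (by
      ext p; simp only [Set.mem_iInter, Set.mem_ofPred_eq]; rfl)

/-- Sites whose particle moves because of a chain of at most `n` consecutive pushes. -/
def MovesIn (η : Config) (ω : Noise) : ℕ → ℤ → Prop
  | 0, x => η x = true ∧ chi ω x = false
  | n + 1, x => MovesIn η ω n x ∨ ∃ y, MovesIn η ω n y ∧ Lands η ω y x ∧ η x = true

lemma moves_iff_exists_movesIn (η : Config) (ω : Noise) (x : ℤ) :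
    Moves η ω x ↔ ∃ n, MovesIn η ω n x := by
  constructor
  · intro h
    induction h with
    | wake h1 h2 => exact ⟨0, h1, h2⟩
    | push _ h2 h3 ih =>
      obtain ⟨n, hn⟩ := ih
      exact ⟨n + 1, Or.inr ⟨_, hn, h2, h3⟩⟩
  · rintro ⟨n, hn⟩
    induction n generalizing x with
    | zero => exact Moves.wake hn.1 hn.2
    | succ n ih =>
      rcases hn with hn | ⟨y, hy, h2, h3⟩
      · exact ih x hn
      · exact Moves.push (ih y hy) h2 h3

lemma measurableSet_moves (x : ℤ) :
    MeasurableSet {p : Config × Noise | Moves p.1 p.2 x} := by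
  have hη : ∀ x : ℤ, MeasurableSet {p : Config × Noise | p.1 x = true} := fun x =>
    measurableSet_eq_fun (by fun_prop) measurable_const
  have key : ∀ (n : ℕ) (x : ℤ), MeasurableSet {p : Config × Noise | MovesIn p.1 p.2 n x} := by
    intro n
    induction n with
    | zero =>
      intro x
      have hc : MeasurableSet {p : Config × Noise | chi p.2 x = false} :=
        measurableSet_eq_fun (by unfold chi; fun_prop) measurable_const
      exact (hη x).inter hc
    | succ n ih =>
      intro x
      refine (ih x).union ?_
      exact (MeasurableSet.iUnion fun y => (ih y).inter
        ((measurableSet_lands y x).inter (hη x))).congr (by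
      ext p; simp only [Set.mem_iUnion, Set.mem_inter_iff, Set.mem_ofPred_eq]; rfl)
  exact (MeasurableSet.iUnion fun n => key n x).congr (by
    ext p; simp [moves_iff_exists_movesIn])

lemma measurable_update : Measurable (Function.uncurry update) := by
  classical
  refine measurable_pi_lambda _ fun z => measurable_to_bool ?_
  have hη : MeasurableSet {p : Config × Noise | p.1 z = true} :=
    measurableSet_eq_fun (by fun_prop) measurable_const
  have h : MeasurableSet {p : Config × Noise | OccupiedAfter p.1 p.2 z} := by
    refine (hη.inter (measurableSet_moves z).compl).union ?_
    exact (MeasurableSet.iUnion fun x => (measurableSet_moves x).inter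
      (measurableSet_lands x z)).congr (by
      ext p; simp only [Set.mem_iUnion, Set.mem_inter_iff, Set.mem_ofPred_eq]; rfl)
  exact h.congr (by ext p; simp [Function.uncurry, update])

/-- The one-step transition kernel of the stochastic six vertex model as a time-homogeneous Markov
process on `{0,1}^ℤ`: from `η`, the next configuration is `update η ω`, where `ω` is fresh noise. -/
noncomputable def kernel (b₁ b₂ : I) : Kernel Config Config :=
  (Kernel.id ×ₖ Kernel.const Config (noiseLaw b₁ b₂)).map (Function.uncurry update)

lemma kernel_apply (b₁ b₂ : I) (η : Config) :
    kernel b₁ b₂ η = (noiseLaw b₁ b₂).map (update η) := by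
  rw [kernel, Kernel.map_apply _ measurable_update, Kernel.prod_apply, Kernel.id_apply,
    Kernel.const_apply, Measure.dirac_prod, Measure.map_map measurable_update (by fun_prop)]
  rfl

instance (b₁ b₂ : I) : IsMarkovKernel (kernel b₁ b₂) :=
  Kernel.IsMarkovKernel.map _ measurable_update

/-- The set of stationary distributions of the stochastic six vertex model. -/
def stationaryDistributions (b₁ b₂ : I) : Set (Measure Config) :=
  {ν | IsProbabilityMeasure ν ∧ (kernel b₁ b₂).Invariant ν}

/-- The product Bernoulli measure with density `ρ`. -/
noncomputable def productBernoulli (ρ : I) : Measure Config :=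
  Measure.infinitePi fun _ : ℤ => bernoulliMeasure true false ρ

/-- The shift `(τ_n η)(i) = η (i + n)`. -/
def shift (n : ℤ) (η : Config) : Config := fun i => η (i + n)

end S6V

/-! ### One step as a row of vertices -/

namespace S6V
open MeasureTheory ProbabilityTheory unitInterval

/-! A step is a row of vertices: the site `x` receives a vertical path if it is occupied and a
horizontal one if a particle crosses `(x - 1, x)`. A single incoming path goes straight or turns
according to a coin, of bias `b₁` if it is vertical and `b₂` if it is horizontal (`sweep`, `flux`).
A geometric jump is a run of `b₂`-coins up to the first failure, so the given update has exactly
this law (`update_arrayNoise`, `kernel_eq_map_sweep`).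

Two copies `η`, `ξ` are coupled through their height function, whose increments are `η x - ξ x`.
Read `+1` as an opening and `-1` as a closing bracket: a closing site borrows the coins of the
opening site matched with it, and every other site uses its own. Matched sites have opposite
occupations, so a single copy never reads a coin twice and keeps the right law. With this sharing, a
lower bound on the height survives a step (`height_sub_flux_nonneg`). Moreover discrepancies are
never created at a vertex, and a vertical one meeting a horizontal one of opposite sign may
annihilate with it (`balance`).

Average the coupled laws of two stationary distributions over a long time. A step then hardly
changes the probability of a discrepancy at any site, so annihilations are rare. If horizontal
discrepancies were likely at one edge, they would be likely along a long stretch to its left, and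
large windows there would carry discrepancies in number proportional to their length. When the net
number is `o(n)` in mean, both signs must be present, and adjacent opposite discrepancies annihilate
with probability bounded below: too many annihilations (`CoinBound.fluxDiffer_lt`). Hence two
stationary distributions agree as soon as some coupling keeps the expected absolute net discrepancy
of windows of length `n` below an `o(n)`, uniformly in time and space (`CoinBound.eq_of_invariant`).

This criterion is used twice. For `ν` and its shift, coupled as `η` and `shift 1 η`, the height
starts bounded. Its mean depth does not grow, because both laws have the same current, and its mean
is fixed by the marginals; so window discrepancies stay bounded in mean and `ν` is translation
invariant (`CoinBound.map_shift_one`). For `ν` and `productBernoulli ρ`, started independently,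
window counts concentrating at `n * ρ` are enough (`CoinBound.eq_productBernoulli`); that the
product measure is stationary is a local identity at one vertex (`vertex_identity`).

For an extremal `ν`, the mean ergodic theorem gives a limit of the particle averages. A step changes
a window count by at most one, so the dynamics preserves this limit; extremality makes it a constant
`ρ`, and `ν = productBernoulli ρ`. Conversely, a stationary component of `productBernoulli ρ`
inherits the concentration at `ρ`, hence equals it. -/

/-- A path crosses the edge `(x, x + 1)`: some particle at `y ≤ x` turns right (bit `false`), and the
path it starts is not stopped (bit `false` at an empty site) up to `x`. -/
def Flows (η c : ℤ → Bool) (x : ℤ) : Prop :=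
  ∃ y ≤ x, η y = true ∧ c y = false ∧ ∀ w, y < w → w ≤ x → η w = true ∨ c w = true

open scoped Classical in
/-- The indicator of `Flows`. -/
noncomputable def flux (η c : ℤ → Bool) (x : ℤ) : Bool := decide (Flows η c x)

/-- The configuration after a step of the vertex dynamics driven by the bits `c`: at each vertex with
exactly one incoming path, that path goes straight if the bit is `true` and turns otherwise. -/
noncomputable def sweep (η c : ℤ → Bool) : Config := fun z =>
  if η z then flux η c (z - 1) || c z else flux η c (z - 1) && !c z

lemma flows_iff (η c : ℤ → Bool) (x : ℤ) :
    Flows η c x ↔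
      (η x = true ∧ (Flows η c (x - 1) ∨ c x = false)) ∨
        (η x = false ∧ Flows η c (x - 1) ∧ c x = true) := by
  constructor
  · rintro ⟨y, hy, h1, h2, h3⟩
    rcases hy.eq_or_lt with rfl | hlt
    · exact Or.inl ⟨h1, Or.inr h2⟩
    · have hp : Flows η c (x - 1) := ⟨y, by omega, h1, h2, fun w hw hw' => h3 w hw (by omega)⟩
      have := h3 x hlt le_rfl
      cases hx : η x
      · exact Or.inr ⟨rfl, hp, by simpa [hx] using this⟩
      · exact Or.inl ⟨rfl, Or.inl hp⟩
  · have ext : Flows η c (x - 1) → (η x = true ∨ c x = true) → Flows η c x := by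
      rintro ⟨y, hy, h1, h2, h3⟩ hx
      refine ⟨y, by omega, h1, h2, fun w hw hw' => ?_⟩
      rcases hw'.eq_or_lt with rfl | hlt
      · exact hx
      · exact h3 w hw (by omega)
    rintro (⟨h1, h2 | h2⟩ | ⟨_, h2, h3⟩)
    · exact ext h2 (Or.inl h1)
    · exact ⟨x, le_rfl, h1, h2, fun w hw hw' => by omega⟩
    · exact ext h2 (Or.inr h3)

/-- This recursion alone would allow a path arriving from `-∞`. The source required by `Flows`
excludes it, and `height_sub_flux_nonneg` depends on that. -/
lemma flux_eq (η c : ℤ → Bool) (x : ℤ) :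
    flux η c x = if η x then flux η c (x - 1) || !c x else flux η c (x - 1) && c x := by
  have h := flows_iff η c x
  rw [Bool.eq_iff_iff]
  unfold flux
  cases hx : η x <;> simp_all

lemma sweep_eq (η c : ℤ → Bool) (x : ℤ) :
    sweep η c x = if η x then flux η c (x - 1) || c x else flux η c (x - 1) && !c x := rfl

/-- Paths are conserved at each vertex, whatever the coin. The evolution of heights, currents and
particle counts all follows from this. -/
lemma sweep_add_flux (η c : ℤ → Bool) (x : ℤ) :
    (sweep η c x).toInt + (flux η c x).toInt = (η x).toInt + (flux η c (x - 1)).toInt := by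
  rw [flux_eq η c x, sweep_eq]
  cases η x <;> cases flux η c (x - 1) <;> cases c x <;> rfl

/-! ### The height function of a pair -/

/-- The signed discrepancy at a site. -/
def gap (η ξ : Config) (x : ℤ) : ℤ := (η x).toInt - (ξ x).toInt

/-- The height function of a pair of configurations: its increments are the discrepancies. -/
noncomputable def height (η ξ : Config) (x : ℤ) : ℤ :=
  ∑ w ∈ Finset.Ioc 0 x, gap η ξ w - ∑ w ∈ Finset.Ioc x 0, gap η ξ w

lemma height_eq (η ξ : Config) (x : ℤ) : height η ξ x = height η ξ (x - 1) + gap η ξ x := by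
  unfold height
  rcases le_or_gt 1 x with h | h
  · have e1 : Finset.Ioc 0 x = insert x (Finset.Ioc 0 (x - 1)) := by ext; simp; omega
    have e2 : Finset.Ioc x 0 = ∅ := Finset.Ioc_eq_empty (by omega)
    have e3 : Finset.Ioc (x - 1) 0 = ∅ := Finset.Ioc_eq_empty (by omega)
    rw [e1, e2, e3, Finset.sum_insert (by simp)]
    simp; ring
  · have e1 : Finset.Ioc (x - 1) 0 = insert x (Finset.Ioc x 0) := by ext; simp; omega
    have e2 : Finset.Ioc 0 x = ∅ := Finset.Ioc_eq_empty (by omega)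
    have e3 : Finset.Ioc 0 (x - 1) = ∅ := Finset.Ioc_eq_empty (by omega)
    rw [e1, e2, e3, Finset.sum_insert (by simp)]
    simp

lemma sum_gap_eq_height_sub (η ξ : Config) {a b : ℤ} (hab : a ≤ b) :
    ∑ w ∈ Finset.Ioc a b, gap η ξ w = height η ξ b - height η ξ a := by
  induction b, hab using Int.leInduction with
  | base => simp
  | succ b hab ih =>
    have e1 : Finset.Ioc a (b + 1) = insert (b + 1) (Finset.Ioc a b) := by ext; simp; omega
    rw [e1, Finset.sum_insert (by simp), ih, height_eq η ξ (b + 1)]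
    simp; ring

lemma gap_eq_one_iff (η ξ : Config) (x : ℤ) : gap η ξ x = 1 ↔ η x = true ∧ ξ x = false := by
  unfold gap; cases η x <;> cases ξ x <;> simp

lemma gap_eq_neg_one_iff (η ξ : Config) (x : ℤ) :
    gap η ξ x = -1 ↔ η x = false ∧ ξ x = true := by
  unfold gap; cases η x <;> cases ξ x <;> simp

lemma gap_eq_zero_iff (η ξ : Config) (x : ℤ) : gap η ξ x = 0 ↔ η x = ξ x := by
  unfold gap; cases η x <;> cases ξ x <;> simp

lemma gap_cases (η ξ : Config) (x : ℤ) : gap η ξ x = 0 ∨ gap η ξ x = 1 ∨ gap η ξ x = -1 := by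
  unfold gap; cases η x <;> cases ξ x <;> simp

/-! ### Bracket matching and shared coins -/

/-- The discrepancies at `y < x` are a matching pair of brackets. -/
def Paired (η ξ : Config) (y x : ℤ) : Prop :=
  y < x ∧ height η ξ x = height η ξ (y - 1) ∧
    ∀ w, y ≤ w → w < x → height η ξ (y - 1) < height η ξ w

lemma Paired.gap_left {η ξ : Config} {y x : ℤ} (h : Paired η ξ y x) : gap η ξ y = 1 := by
  have h1 := h.2.2 y le_rfl h.1
  have h2 := height_eq η ξ y
  have := gap_cases η ξ y
  omega

lemma Paired.gap_right {η ξ : Config} {y x : ℤ} (h : Paired η ξ y x) : gap η ξ x = -1 := by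
  have h1 := h.2.2 (x - 1) (by have := h.1; omega) (by omega)
  have h2 := height_eq η ξ x
  have h3 := h.2.1
  have := gap_cases η ξ x
  omega

/-- With two left ends, the height just before the inner one would be both strictly above the
closing level and equal to it. -/
lemma Paired.left_unique {η ξ : Config} {y y' x : ℤ} (h : Paired η ξ y x) (h' : Paired η ξ y' x) :
    y = y' := by
  wlog hlt : y < y' generalizing y y'
  · rcases lt_trichotomy y y' with h1 | h1 | h1
    · exact this h h' h1
    · exact h1
    · exact (this h' h h1).symm
  have := h.2.2 (y' - 1) (by omega) (by have := h'.1; omega)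
  have h1 := h.2.1
  have h2 := h'.2.1
  omega

lemma Paired.right_unique {η ξ : Config} {y x x' : ℤ} (h : Paired η ξ y x)
    (h' : Paired η ξ y x') : x = x' := by
  wlog hlt : x < x' generalizing x x'
  · rcases lt_trichotomy x x' with h1 | h1 | h1
    · exact this h h' h1
    · exact h1
    · exact (this h' h h1).symm
  have := h'.2.2 x (by have := h.1; omega) hlt
  have h1 := h.2.1
  omega

open scoped Classical in
/-- The site whose coins are used at `x`. -/
noncomputable def partner (η ξ : Config) (x : ℤ) : ℤ :=
  if h : ∃ y, Paired η ξ y x then h.choose else x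

lemma Paired.partner_eq {η ξ : Config} {y x : ℤ} (h : Paired η ξ y x) : partner η ξ x = y := by
  have hx : ∃ y, Paired η ξ y x := ⟨y, h⟩
  rw [partner, dif_pos hx]
  exact hx.choose_spec.left_unique h

lemma partner_eq_self {η ξ : Config} {x : ℤ} (h : gap η ξ x ≠ -1) : partner η ξ x = x := by
  rw [partner, dif_neg]
  rintro ⟨y, hy⟩
  exact h hy.gap_right

lemma partner_eq_or (η ξ : Config) (x : ℤ) :
    (∃ y, Paired η ξ y x ∧ partner η ξ x = y) ∨
      (¬ ∃ y, Paired η ξ y x) ∧ partner η ξ x = x := by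
  by_cases h : ∃ y, Paired η ξ y x
  · obtain ⟨y, hy⟩ := h
    exact Or.inl ⟨y, hy, hy.partner_eq⟩
  · exact Or.inr ⟨h, by rw [partner, dif_neg h]⟩

lemma eq_or_paired_of_partner_eq {η ξ : Config} {x x' : ℤ}
    (h : partner η ξ x = partner η ξ x') : x = x' ∨ Paired η ξ x x' ∨ Paired η ξ x' x := by
  rcases partner_eq_or η ξ x with ⟨y, hy, e⟩ | ⟨_, e⟩ <;>
    rcases partner_eq_or η ξ x' with ⟨y', hy', e'⟩ | ⟨_, e'⟩
  · have : y = y' := by omega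
    subst this
    exact Or.inl (hy.right_unique hy')
  · have : y = x' := by omega
    subst this
    exact Or.inr (Or.inr hy)
  · have : x = y' := by omega
    subst this
    exact Or.inr (Or.inl hy')
  · exact Or.inl (by omega)

/-- The bits seen by a configuration `ζ` when the coins are read at the sites `p x`. -/
def bits (ω : ℤ × Bool → Bool) (p : ℤ → ℤ) (ζ : Config) : ℤ → Bool := fun x => ω (p x, ζ x)

/-- Only matched sites read at the same place, and there the copy is occupied at the left end and
empty at the right end, so it reads the two different coins. Injectivity keeps the bits of one copy
independent. -/
lemma injective_partner_left (η ξ : Config) :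
    Function.Injective fun x => (partner η ξ x, η x) := by
  intro x x' h
  simp only [Prod.mk.injEq] at h
  rcases eq_or_paired_of_partner_eq h.1 with h1 | h1 | h1
  · exact h1
  all_goals
    have h2 := (gap_eq_one_iff _ _ _).1 h1.gap_left
    have h3 := (gap_eq_neg_one_iff _ _ _).1 h1.gap_right
    simp_all

lemma injective_partner_right (η ξ : Config) :
    Function.Injective fun x => (partner η ξ x, ξ x) := by
  intro x x' h
  simp only [Prod.mk.injEq] at h
  rcases eq_or_paired_of_partner_eq h.1 with h1 | h1 | h1
  · exact h1
  all_goals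
    have h2 := (gap_eq_one_iff _ _ _).1 h1.gap_left
    have h3 := (gap_eq_neg_one_iff _ _ _).1 h1.gap_right
    simp_all

/-! ### The coupling keeps lower bounds on the height -/

/-- The flux through `(x, x + 1)` in the first copy. -/
noncomputable def flux₁ (η ξ : Config) (ω : ℤ × Bool → Bool) (x : ℤ) : Bool :=
  flux η (bits ω (partner η ξ) η) x

/-- The flux through `(x, x + 1)` in the second copy. -/
noncomputable def flux₂ (η ξ : Config) (ω : ℤ × Bool → Bool) (x : ℤ) : Bool :=
  flux ξ (bits ω (partner η ξ) ξ) x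

lemma flux₁_eq (η ξ : Config) (ω : ℤ × Bool → Bool) (x : ℤ) :
    flux₁ η ξ ω x = if η x then flux₁ η ξ ω (x - 1) || !ω (partner η ξ x, true)
      else flux₁ η ξ ω (x - 1) && ω (partner η ξ x, false) := by
  rw [flux₁, flux_eq, bits]
  cases η x <;> simp [flux₁]

lemma flux₂_eq (η ξ : Config) (ω : ℤ × Bool → Bool) (x : ℤ) :
    flux₂ η ξ ω x = if ξ x then flux₂ η ξ ω (x - 1) || !ω (partner η ξ x, true)
      else flux₂ η ξ ω (x - 1) && ω (partner η ξ x, false) := by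
  rw [flux₂, flux_eq, bits]
  cases ξ x <;> simp [flux₂]

/-- If the first copy has a path through `(x, x + 1)` that the second one lacks, at a height that is
minimal on `[z, x]`, then the same holds at all edges in between. -/
lemma excess_of_height_le (η ξ : Config) (ω : ℤ × Bool → Bool) (n : ℕ) :
    ∀ z x : ℤ, z ≤ x → x - z ≤ n → (flux₁ η ξ ω x = true ∧ flux₂ η ξ ω x = false) →
      (∀ w, z ≤ w → w ≤ x → height η ξ x ≤ height η ξ w) →
      ∀ w, z ≤ w → w ≤ x → flux₁ η ξ ω w = true ∧ flux₂ η ξ ω w = false := by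
  induction n with
  | zero =>
    intro z x hzx hn hf _ w hw hw'
    have : w = x := by push_cast at hn; omega
    exact this ▸ hf
  | succ n ih =>
    intro z x hzx hn hf hh w hw hw'
    rcases hw'.eq_or_lt with rfl | hwx
    · exact hf
    have hstep := height_eq η ξ x
    have e1 := flux₁_eq η ξ ω x
    have e2 := flux₂_eq η ξ ω x
    rw [hf.1] at e1
    rw [hf.2] at e2
    rcases gap_cases η ξ x with hg | hg | hg
    -- No discrepancy at `x`: both copies read the same coin, so the excess was already there at `x
    -- - 1`.
    · have hx := (gap_eq_zero_iff _ _ _).1 hg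
      have hprev : flux₁ η ξ ω (x - 1) = true ∧ flux₂ η ξ ω (x - 1) = false := by
        rw [← hx] at e2
        revert e1 e2
        cases η x <;> cases flux₁ η ξ ω (x - 1) <;> cases flux₂ η ξ ω (x - 1) <;>
          cases ω (partner η ξ x, true) <;> cases ω (partner η ξ x, false) <;> simp
      refine ih z (x - 1) (by omega) (by push_cast at hn; omega) hprev (fun u hu hu' => ?_) w hw
        (by omega)
      have := hh u hu (by omega)
      omega
    -- A `+1` at `x` would put the height at `x - 1` below the minimum.
    · have := hh (x - 1) (by omega) (by omega)
      omega
    -- A `-1` at `x`: the excess forces both coins read there to be `true`, and an excess at `x -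
    -- 1`.
    · obtain ⟨hx1, hx2⟩ := (gap_eq_neg_one_iff _ _ _).1 hg
      simp only [hx1, hx2, Bool.false_eq_true, if_false, if_true] at e1 e2
      obtain ⟨hp1, hB⟩ := Bool.and_eq_true_iff.1 e1.symm
      obtain ⟨hp2, hA⟩ := Bool.or_eq_false_iff.1 e2.symm
      rw [Bool.not_eq_false'] at hA
      have hprev := And.intro hp1 hp2
      by_cases hall : ∀ u, z ≤ u → u ≤ x - 1 → height η ξ (x - 1) ≤ height η ξ u
      · exact ih z (x - 1) (by omega) (by push_cast at hn; omega) hprev hall w hw (by omega)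
      push Not at hall
      obtain ⟨u₀, hu₀, hu₀', hlt⟩ := hall
      -- The last return to the minimal level before `x`; the bracket closed at `x` is opened at `u
      -- + 1`.
      obtain ⟨u, ⟨⟨hu1, hu2⟩, hu3⟩, humax⟩ := Int.exists_greatest_of_bdd
        (P := fun u => (z ≤ u ∧ u ≤ x - 1) ∧ height η ξ u = height η ξ x)
        ⟨x, fun v hv => by omega⟩
        ⟨u₀, ⟨hu₀, hu₀'⟩, by have := hh u₀ hu₀ (by omega); omega⟩
      have hux : u ≠ x - 1 := by rintro rfl; omega
      have hpair : Paired η ξ (u + 1) x := by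
        refine ⟨by omega, by simpa using hu3.symm, fun v hv hv' => ?_⟩
        have h1 := hh v (by omega) (by omega)
        rcases h1.eq_or_lt with h2 | h2
        · have := humax v ⟨⟨by omega, by omega⟩, h2.symm⟩
          omega
        · simpa [hu3] using h2
      have hins := ih (u + 1) (x - 1) (by omega) (by push_cast at hn; omega) hprev
        (fun v hv hv' => by
          have := hpair.2.2 v hv (by omega)
          have := hpair.2.1
          omega)
      rcases le_or_gt (u + 1) w with hwu | hwu
      · exact hins w hwu (by omega)
      have hy := hins (u + 1) le_rfl (by omega)
      obtain ⟨hy1, hy2⟩ := (gap_eq_one_iff _ _ _).1 hpair.gap_left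
      have hpy : partner η ξ (u + 1) = u + 1 :=
        partner_eq_self (by rw [hpair.gap_left]; norm_num)
      -- The opening site reads the same two coins. Both are `true`, so no path turns there and the
      -- excess comes from `u`.
      rw [hpair.partner_eq] at hA hB
      have e3 := flux₁_eq η ξ ω (u + 1)
      have e4 := flux₂_eq η ξ ω (u + 1)
      rw [hpy, hA, hy1, hy.1] at e3
      rw [hpy, hB, hy2, hy.2] at e4
      have hu : flux₁ η ξ ω u = true ∧ flux₂ η ξ ω u = false := by simpa using And.intro e3 e4
      exact ih z u (by omega) (by push_cast at hn; omega) hu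
        (fun v hv hv' => hu3 ▸ hh v hv (by omega)) w hw (by omega)

/-- The coupled dynamics preserves the sign of the height function. -/
lemma height_sub_flux_nonneg (η ξ : Config) (ω : ℤ × Bool → Bool) (k : ℤ)
    (hk : ∀ x, 0 ≤ height η ξ x + k) (x : ℤ) :
    0 ≤ height η ξ x + k - ((flux₁ η ξ ω x).toInt - (flux₂ η ξ ω x).toInt) := by
  by_contra hneg
  have hk0 := hk x
  have hf : flux₁ η ξ ω x = true ∧ flux₂ η ξ ω x = false := by
    revert hneg
    cases flux₁ η ξ ω x <;> cases flux₂ η ξ ω x <;> simp <;> omega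
  have hx0 : height η ξ x + k = 0 := by
    rw [hf.1, hf.2] at hneg
    simp at hneg
    omega
  have hmin : ∀ w, height η ξ x ≤ height η ξ w := fun w => by have := hk w; omega
  have hall : ∀ w ≤ x, flux₁ η ξ ω w = true ∧ flux₂ η ξ ω w = false := fun w hw =>
    excess_of_height_le η ξ ω (x - w).toNat w x hw (by omega) hf (fun u _ _ => hmin u) w le_rfl hw
  -- The excess reaches back to `-∞`, but the path of the first copy has a source `y`; the
  -- contradiction is found from there.
  have hflow : Flows η (bits ω (partner η ξ) η) x := by
    simpa [flux₁, flux] using hf.1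
  obtain ⟨y, hyx, hy1, hy2, -⟩ := hflow
  have e2 := flux₂_eq η ξ ω y
  rw [(hall y hyx).2] at e2
  simp only [bits, hy1] at hy2
  have hyξ : ξ y = false := by
    cases h : ξ y
    · rfl
    · simp [h, hy2] at e2
  have hgy : gap η ξ y = 1 := (gap_eq_one_iff _ _ _).2 ⟨hy1, hyξ⟩
  have hhy := height_eq η ξ y
  have h3 := hmin (y - 1)
  have h4 : y ≠ x := by rintro rfl; omega
  have hcross : ∃ w, y < w ∧ height η ξ w ≤ height η ξ (y - 1) := ⟨x, by omega, h3⟩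
  -- The height is minimal at `x`, so it comes back to its level before `y`; the first return closes
  -- the bracket opened at `y`.
  obtain ⟨x', ⟨hx'1, hx'2⟩, hleast⟩ := Int.exists_least_of_bdd
    (P := fun w => y < w ∧ height η ξ w ≤ height η ξ (y - 1)) ⟨y, fun w hw => hw.1.le⟩ hcross
  have hx'x : x' ≤ x := hleast x ⟨by omega, h3⟩
  have hbetween : ∀ w, y ≤ w → w < x' → height η ξ (y - 1) < height η ξ w := by
    intro w hw hw'
    rcases hw.eq_or_lt with rfl | hw
    · omega
    · by_contra hcon
      have := hleast w ⟨hw, by omega⟩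
      omega
  have hpair : Paired η ξ y x' := by
    refine ⟨hx'1, ?_, hbetween⟩
    have h5 := hbetween (x' - 1) (by omega) (by omega)
    have h6 := height_eq η ξ x'
    have := gap_cases η ξ x'
    omega
  -- At `x'` the second copy reads the coin that made the first copy turn at `y`, so it emits a path
  -- too, although an excess at `x'` says it has none.
  have e3 := flux₂_eq η ξ ω x'
  obtain ⟨-, h8⟩ := (gap_eq_neg_one_iff _ _ _).1 hpair.gap_right
  rw [partner_eq_self (by rw [hgy]; norm_num)] at hy2
  rw [(hall x' hx'x).2, hpair.partner_eq, h8, hy2] at e3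
  simp at e3

end S6V

namespace S6V
open MeasureTheory ProbabilityTheory unitInterval

/-! ### The vertex description of a step -/

/-- An array of coins: `a (x, none)` is `χ(x)`, and `a (x, some k)` tells whether a particle leaving
`x` continues past `x + k + 1`. -/
noncomputable def arrayNoise (a : ℤ × Option ℕ → Bool) : Noise := fun x =>
  (a (x, none), sInf {k : ℕ | a (x, some k) = false})

/-- `y` is the last occupied site to the left of `x`. -/
def IsPred (η : Config) (y x : ℤ) : Prop :=
  y < x ∧ η y = true ∧ ∀ w, y < w → w < x → η w = false

lemma IsPred.unique {η : Config} {y y' x : ℤ} (h : IsPred η y x) (h' : IsPred η y' x) : y = y' := by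
  rcases lt_trichotomy y y' with h1 | h1 | h1
  · have := h.2.2 y' h1 h'.1; simp [h'.2.1] at this
  · exact h1
  · have := h'.2.2 y h1 h.1; simp [h.2.1] at this

open scoped Classical in
/-- The coin of the array that decides the bit at `x`. -/
noncomputable def coinIndex (η : Config) (x : ℤ) : ℤ × Option ℕ :=
  if η x then (x, none)
  else if h : ∃ y, IsPred η y x then (h.choose, some (x - h.choose - 1).toNat)
  else (x, some 0)

lemma coinIndex_of_occupied {η : Config} {x : ℤ} (h : η x = true) : coinIndex η x = (x, none) := by
  simp [coinIndex, h]

lemma coinIndex_of_isPred {η : Config} {x y : ℤ} (h : η x = false) (hy : IsPred η y x) :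
    coinIndex η x = (y, some (x - y - 1).toNat) := by
  have hex : ∃ y, IsPred η y x := ⟨y, hy⟩
  have := hex.choose_spec.unique hy
  simp [coinIndex, h, hex, this]

lemma coinIndex_of_forall_not {η : Config} {x : ℤ} (h : η x = false)
    (hx : ¬ ∃ y, IsPred η y x) : coinIndex η x = (x, some 0) := by
  simp [coinIndex, h, hx]

/-- Occupied sites read `none` coins. An empty site reads a coin of its occupied predecessor,
numbered by the distance; without predecessor it reads a coin at itself, an empty site, where no
other site looks. -/
lemma injective_coinIndex (η : Config) : Function.Injective (coinIndex η) := by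
  intro x x' h
  cases hx : η x <;> cases hx' : η x'
  · by_cases h1 : ∃ y, IsPred η y x <;> by_cases h2 : ∃ y, IsPred η y x'
    · obtain ⟨y, hy⟩ := h1
      obtain ⟨y', hy'⟩ := h2
      rw [coinIndex_of_isPred hx hy, coinIndex_of_isPred hx' hy'] at h
      simp only [Prod.mk.injEq, Option.some.injEq] at h
      have := hy.1
      have := hy'.1
      omega
    · obtain ⟨y, hy⟩ := h1
      rw [coinIndex_of_isPred hx hy, coinIndex_of_forall_not hx' h2] at h
      simp only [Prod.mk.injEq] at h
      have := hy.2.1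
      simp_all
    · obtain ⟨y, hy⟩ := h2
      rw [coinIndex_of_forall_not hx h1, coinIndex_of_isPred hx' hy] at h
      simp only [Prod.mk.injEq] at h
      have := hy.2.1
      simp_all
    · rw [coinIndex_of_forall_not hx h1, coinIndex_of_forall_not hx' h2] at h
      exact (Prod.mk.inj h).1
  · rw [coinIndex_of_occupied hx'] at h
    by_cases h1 : ∃ y, IsPred η y x
    · obtain ⟨y, hy⟩ := h1
      simp [coinIndex_of_isPred hx hy] at h
    · simp [coinIndex_of_forall_not hx h1] at h
  · rw [coinIndex_of_occupied hx] at h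
    by_cases h1 : ∃ y, IsPred η y x'
    · obtain ⟨y, hy⟩ := h1
      simp [coinIndex_of_isPred hx' hy] at h
    · simp [coinIndex_of_forall_not hx' h1] at h
  · rw [coinIndex_of_occupied hx, coinIndex_of_occupied hx'] at h
    exact (Prod.mk.inj h).1

/-- The path started by the particle at `y`, if it moves, crosses the edge `(x, x + 1)`. -/
def Crosses (η : Config) (ω : Noise) (y x : ℤ) : Prop :=
  y ≤ x ∧ x < y + jump ω y ∧ ∀ w, y < w → w ≤ x → η w = false

lemma lands_iff (η : Config) (ω : Noise) (y z : ℤ) :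
    Lands η ω y z ↔ Crosses η ω y (z - 1) ∧ (z = y + jump ω y ∨ η z = true) := by
  unfold Lands Crosses
  constructor
  · rintro ⟨h1, h2, h3, h4⟩
    exact ⟨⟨by omega, by omega, fun w hw hw' => h3 w hw (by omega)⟩, h4⟩
  · rintro ⟨⟨h1, h2, h3⟩, h4⟩
    exact ⟨by omega, by omega, fun w hw hw' => h3 w hw (by omega), h4⟩

/-- Some moving particle crosses the edge `(x, x + 1)`. -/
def Crossed (η : Config) (ω : Noise) (x : ℤ) : Prop := ∃ y, Moves η ω y ∧ Crosses η ω y x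

lemma Moves.occupied {η : Config} {ω : Noise} {x : ℤ} (h : Moves η ω x) : η x = true := by
  cases h <;> assumption

lemma moves_iff {η : Config} {ω : Noise} {x : ℤ} (hx : η x = true) :
    Moves η ω x ↔ chi ω x = false ∨ Crossed η ω (x - 1) := by
  constructor
  · intro h
    cases h with
    | wake _ h => exact Or.inl h
    | push h1 h2 _ => exact Or.inr ⟨_, h1, ((lands_iff _ _ _ _).1 h2).1⟩
  · rintro (h | ⟨y, h1, h2⟩)
    · exact Moves.wake hx h
    · exact Moves.push h1 ((lands_iff _ _ _ _).2 ⟨h2, Or.inr hx⟩) hx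

lemma Crosses.isPred {η : Config} {ω : Noise} {y x : ℤ} (h : Crosses η ω y (x - 1))
    (hy : η y = true) : IsPred η y x :=
  ⟨by have := h.1; omega, hy, fun w hw hw' => h.2.2 w hw (by omega)⟩

section

variable {a : ℤ × Option ℕ → Bool} (ha : ∀ x, ∃ k, a (x, some k) = false) (η : Config)

-- Under `hk`, all coins before the `k`-th are successes, so the `k`-th one decides whether the jump
-- goes on.
include ha in
lemma array_jump_spec (x : ℤ) (k : ℕ) (hk : (k : ℤ) < jump (arrayNoise a) x) :
    a (x, some k) = true ↔ (k : ℤ) + 1 < jump (arrayNoise a) x := by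
  have h1 : a (x, some (sInf {k : ℕ | a (x, some k) = false})) = false := Nat.sInf_mem (ha x)
  simp only [jump, arrayNoise] at hk ⊢
  constructor
  · intro h
    by_contra hcon
    have : k = sInf {k : ℕ | a (x, some k) = false} := by omega
    rw [this] at h
    simp [h] at h1
  · intro h
    by_contra hcon
    have : sInf {k : ℕ | a (x, some k) = false} ≤ k := Nat.sInf_le (by simpa using hcon)
    omega

include ha in
lemma array_bit_spec {y x : ℤ} (hx : η x = false) (hy : η y = true)
    (h : Crosses η (arrayNoise a) y (x - 1)) :
    a (coinIndex η x) = true ↔ x < y + jump (arrayNoise a) y := by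
  rw [coinIndex_of_isPred hx (h.isPred hy)]
  have h1 := h.1
  have h2 := h.2.1
  rw [array_jump_spec ha _ _ (by omega)]
  omega

include ha in
lemma flows_of_moves {y : ℤ} (h : Moves η (arrayNoise a) y) {x : ℤ}
    (hx : Crosses η (arrayNoise a) y x) : Flows η (a ∘ coinIndex η) x := by
  have ext : ∀ {y x : ℤ}, Flows η (a ∘ coinIndex η) y → η y = true →
      Crosses η (arrayNoise a) y x → Flows η (a ∘ coinIndex η) x := by
    rintro y x ⟨s, hs, h1, h2, h3⟩ hy hc
    refine ⟨s, hs.trans hc.1, h1, h2, fun w hw hw' => ?_⟩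
    rcases le_or_gt w y with hwy | hwy
    · exact h3 w hw hwy
    · refine Or.inr ((array_bit_spec ha η (hc.2.2 w hwy hw') hy ⟨by omega, ?_, fun u hu hu' =>
        hc.2.2 u hu (by omega)⟩).2 ?_)
      all_goals have := hc.2.1; omega
  induction h generalizing x with
  | @wake z h1 h2 =>
    refine ext ⟨z, le_rfl, h1, ?_, fun w hw hw' => by omega⟩ h1 hx
    have h3 : a (z, none) = false := h2
    simpa [coinIndex_of_occupied h1] using h3
  | @push y z h1 h2 h3 ih =>
    refine ext ?_ h3 hx
    rw [flows_iff]
    exact Or.inl ⟨h3, Or.inl (ih ((lands_iff _ _ _ _).1 h2).1)⟩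

lemma crosses_self (ω : Noise) (x : ℤ) : Crosses η ω x x :=
  ⟨le_rfl, by unfold jump; omega, fun w hw hw' => by omega⟩

-- A flow forgets which particle carries the path: at each occupied site the arriving particle hands
-- it over to the one it pushes. Both directions follow this relay.
include ha in
lemma crossed_iff_flows (x : ℤ) :
    Crossed η (arrayNoise a) x ↔ Flows η (a ∘ coinIndex η) x := by
  constructor
  · rintro ⟨y, hy, hc⟩
    exact flows_of_moves ha η hy hc
  · rintro ⟨s, hs, h1, h2, h3⟩
    induction x, hs using Int.leInduction with
    | base =>
      refine ⟨s, Moves.wake h1 (?_ : a (s, none) = false), crosses_self _ _ _⟩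
      simpa [coinIndex_of_occupied h1] using h2
    | succ x hsx ih =>
      obtain ⟨y, hy, hc⟩ := ih fun w hw hw' => h3 w hw (by omega)
      have hc' : Crosses η (arrayNoise a) y (x + 1 - 1) := by simpa using hc
      cases hx : η (x + 1)
      · have hb := (h3 (x + 1) (by omega) le_rfl).resolve_left (by simp [hx])
        refine ⟨y, hy, by have := hc.1; omega, (array_bit_spec ha η hx hy.occupied hc').1 hb,
          fun w hw hw' => ?_⟩
        rcases hw'.eq_or_lt with rfl | hlt
        · exact hx
        · exact hc.2.2 w hw (by omega)
      · exact ⟨x + 1, (moves_iff hx).2 (Or.inr ⟨y, hy, hc'⟩), crosses_self _ _ _⟩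

-- The new value at `z` depends only on the edge `(z - 1, z)` and one coin: an arriving particle
-- stops at an empty site exactly when its coin there fails, and always stops at an occupied one.
include ha in
lemma update_arrayNoise : update η (arrayNoise a) = sweep η (a ∘ coinIndex η) := by
  funext z
  have hC := crossed_iff_flows ha η (z - 1)
  have hU : update η (arrayNoise a) z = true ↔ OccupiedAfter η (arrayNoise a) z := by
    simp [update]
  rw [Bool.eq_iff_iff, hU]
  simp only [OccupiedAfter, lands_iff]
  cases hz : η z
  · have h1 : (sweep η (a ∘ coinIndex η) z = true) ↔
        Flows η (a ∘ coinIndex η) (z - 1) ∧ a (coinIndex η z) = false := by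
      simp [sweep_eq, hz, flux]
    rw [h1, ← hC]
    simp only [Bool.false_eq_true, false_and, or_false, false_or]
    constructor
    · rintro ⟨y, hy, hc, hj⟩
      refine ⟨⟨y, hy, hc⟩, ?_⟩
      have := array_bit_spec ha η hz hy.occupied hc
      rw [Bool.eq_false_iff, ne_eq, this]
      omega
    · rintro ⟨⟨y, hy, hc⟩, hb⟩
      refine ⟨y, hy, hc, ?_⟩
      have := array_bit_spec ha η hz hy.occupied hc
      rw [Bool.eq_false_iff, ne_eq, this] at hb
      have := hc.2.1
      omega
  · have h1 : (sweep η (a ∘ coinIndex η) z = true) ↔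
        Flows η (a ∘ coinIndex η) (z - 1) ∨ a (z, none) = true := by
      simp [sweep_eq, hz, flux, coinIndex_of_occupied hz]
    rw [h1, ← hC, moves_iff hz]
    have h2 : chi (arrayNoise a) z = a (z, none) := rfl
    have h3 : (∃ x, Moves η (arrayNoise a) x ∧ Crosses η (arrayNoise a) x (z - 1) ∧
        (z = x + jump (arrayNoise a) x ∨ True)) ↔ Crossed η (arrayNoise a) (z - 1) := by
      simp [Crossed]
    simp only [h3, h2]
    cases a (z, none) <;> simp
    tauto

end

/-! ### The law of the bits -/

lemma coe_toNNReal_eq_ofReal (p : I) : (unitInterval.toNNReal p : ENNReal) = ENNReal.ofReal p := by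
  rw [ENNReal.ofReal, ENNReal.coe_inj]
  ext; simp [p.2.1]

lemma bernoulli_true (p : I) :
    bernoulliMeasure true false p {true} = ENNReal.ofReal p := by
  simp [coe_toNNReal_eq_ofReal]

lemma bernoulli_false (p : I) :
    bernoulliMeasure true false p {false} = ENNReal.ofReal (1 - p) := by
  simp [coe_toNNReal_eq_ofReal]

/-- The law of the coins at one site of the array. -/
noncomputable def siteArrayLaw (b₁ b₂ : I) : Measure (Option ℕ → Bool) :=
  Measure.infinitePi fun o => bernoulliMeasure true false (o.elim b₁ fun _ => b₂)

instance (b₁ b₂ : I) : IsProbabilityMeasure (siteArrayLaw b₁ b₂) := by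
  unfold siteArrayLaw; infer_instance

lemma siteArrayLaw_exists_false (b₁ b₂ : I) (hb₂ : b₂ < 1) :
    ∀ᵐ u ∂siteArrayLaw b₁ b₂, ∃ k : ℕ, u (some k) = false := by
  have hle : ∀ n : ℕ, siteArrayLaw b₁ b₂ {u | ¬ ∃ k : ℕ, u (some k) = false} ≤
      ENNReal.ofReal b₂ ^ n := by
    intro n
    have h1 : siteArrayLaw b₁ b₂
        (Set.pi ((Finset.range n).map Function.Embedding.some : Finset (Option ℕ))
          fun _ => {true}) = ENNReal.ofReal b₂ ^ n := by
      rw [siteArrayLaw, Measure.infinitePi_pi _ (by measurability)]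
      simp [coe_toNNReal_eq_ofReal]
    rw [← h1]
    refine measure_mono fun u hu => ?_
    simp only [Set.mem_ofPred_eq, not_exists, Bool.not_eq_false] at hu
    intro i hi
    simp only [Finset.coe_map, Set.mem_image] at hi
    obtain ⟨k, -, rfl⟩ := hi
    exact hu k
  rw [ae_iff]
  have hlt : ENNReal.ofReal b₂ < 1 := by
    rw [ENNReal.ofReal_lt_one]; exact_mod_cast hb₂
  exact le_antisymm (ge_of_tendsto' (ENNReal.tendsto_pow_atTop_nhds_zero_of_lt_one hlt) hle)
    zero_le

lemma measurable_sInf_false :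
    Measurable fun u : Option ℕ → Bool => sInf {k : ℕ | u (some k) = false} := by
  refine measurable_to_countable' fun n => ?_
  have hm : ∀ k : ℕ, MeasurableSet {u : Option ℕ → Bool | u (some k) = false} := fun k =>
    measurableSet_eq_fun (by fun_prop) measurable_const
  -- Since `sInf ∅ = 0`, the event that no coin fails belongs to `n = 0`.
  have : (fun u : Option ℕ → Bool => sInf {k : ℕ | u (some k) = false}) ⁻¹' {n} =
      ({u | u (some n) = false} ∩ ⋂ k : ℕ, ⋂ _ : k < n, {u | u (some k) = false}ᶜ) ∪
        ({u | n = 0} ∩ ⋂ k : ℕ, {u | u (some k) = false}ᶜ) := by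
    ext u
    simp only [Set.mem_preimage, Set.mem_singleton_iff, Set.mem_union, Set.mem_inter_iff,
      Set.mem_iInter, Set.mem_compl_iff, Set.mem_ofPred_eq]
    by_cases hne : ∃ k : ℕ, u (some k) = false
    · have h1 := Nat.sInf_mem (s := {k : ℕ | u (some k) = false}) hne
      constructor
      · rintro rfl
        exact Or.inl ⟨h1, fun k hk => Nat.notMem_of_lt_sInf hk⟩
      · rintro (⟨h2, h3⟩ | ⟨-, h3⟩)
        · refine le_antisymm (Nat.sInf_le h2) ?_
          by_contra hcon
          exact h3 _ (not_le.1 hcon) h1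
        · obtain ⟨k, hk⟩ := hne
          exact absurd hk (h3 k)
    · have h1 : {k : ℕ | u (some k) = false} = ∅ := by
        ext k; simpa using fun h => hne ⟨k, h⟩
      rw [h1, Nat.sInf_empty]
      push Not at hne
      constructor
      · rintro rfl
        exact Or.inr ⟨rfl, hne⟩
      · rintro (⟨h2, -⟩ | ⟨h2, -⟩)
        · exact absurd h2 (hne n)
        · exact h2.symm
  rw [this]
  exact ((hm n).inter (.iInter fun k => .iInter fun _ => (hm k).compl)).union
    ((MeasurableSet.const _).inter (.iInter fun k => (hm k).compl))

lemma siteArrayLaw_map (b₁ b₂ : I) (hb₂ : b₂ < 1) :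
    (siteArrayLaw b₁ b₂).map (fun u => (u none, sInf {k : ℕ | u (some k) = false})) =
      (bernoulliMeasure true false b₁).prod (geometricMeasure (σ b₂)) := by
  have hmeas : Measurable fun u : Option ℕ → Bool =>
      (u none, sInf {k : ℕ | u (some k) = false}) :=
    (measurable_pi_apply none).prodMk measurable_sInf_false
  refine Measure.ext_of_singleton fun ⟨e, n⟩ => ?_
  rw [Measure.map_apply hmeas (measurableSet_singleton _), ← Set.singleton_prod_singleton,
    Measure.prod_prod, geometricMeasure_singleton (by
      intro h
      have := congrArg Subtype.val h
      simp [sub_eq_zero] at this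
      exact hb₂.ne (Subtype.ext this.symm))]
  -- Off the null event that no coin fails, the value `n` means `n` successes followed by a failure.
  let t : Option ℕ → Set Bool := fun o => o.elim {e} fun k => if k < n then {true} else {false}
  have hbox : siteArrayLaw b₁ b₂
      (Set.pi ((Finset.range (n + 1)).insertNone : Finset (Option ℕ)) t) =
      bernoulliMeasure true false b₁ {e} *
        (ENNReal.ofReal b₂ ^ n * ENNReal.ofReal (1 - b₂)) := by
    rw [siteArrayLaw, Measure.infinitePi_pi _ (fun i _ => DiscreteMeasurableSpace.forall_measurableSet _),
      Finset.prod_insertNone, Finset.prod_range_succ]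
    congr 2
    · rw [Finset.prod_congr rfl fun k hk => ?_, Finset.prod_const, Finset.card_range]
      simp [t, Finset.mem_range.1 hk, coe_toNNReal_eq_ofReal]
    · simp [t, coe_toNNReal_eq_ofReal]
  have hae : (fun u : Option ℕ → Bool => (u none, sInf {k : ℕ | u (some k) = false})) ⁻¹'
      ({e} ×ˢ {n}) =ᵐ[siteArrayLaw b₁ b₂]
        Set.pi ((Finset.range (n + 1)).insertNone : Finset (Option ℕ)) t := by
    filter_upwards [siteArrayLaw_exists_false b₁ b₂ hb₂] with u hu
    have h1 : u (some (sInf {k : ℕ | u (some k) = false})) = false := Nat.sInf_mem hu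
    rw [eq_iff_iff]
    change (u none, sInf {k : ℕ | u (some k) = false}) ∈ ({e} ×ˢ {n} : Set (Bool × ℕ)) ↔
      ∀ o ∈ ((Finset.range (n + 1)).insertNone : Finset (Option ℕ)), u o ∈ t o
    simp only [Set.mem_prod, Set.mem_singleton_iff, Finset.forall_mem_insertNone, Finset.mem_range]
    refine and_congr Iff.rfl ⟨?_, fun h => ?_⟩
    · rintro rfl k hk
      by_cases hlt : k < sInf {k : ℕ | u (some k) = false}
      · have := Nat.notMem_of_lt_sInf hlt
        simpa [t, hlt] using this
      · have : k = sInf {k : ℕ | u (some k) = false} := by omega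
        simp only [t, Option.elim, hlt, if_false]
        rw [this]; exact h1
    · have h2 : u (some n) = false := by simpa [t] using h n (by omega)
      refine le_antisymm (Nat.sInf_le h2) ?_
      by_contra hcon
      have := h _ (show sInf {k : ℕ | u (some k) = false} < n + 1 by omega)
      simp [t, not_le.1 hcon, h1] at this
  rw [measure_congr hae, hbox, ← ENNReal.ofReal_pow b₂.2.1, ← ENNReal.ofReal_mul (pow_nonneg b₂.2.1 n)]
  simp

/-- The law of the array. -/
noncomputable def arrayLaw (b₁ b₂ : I) : Measure (ℤ × Option ℕ → Bool) :=
  Measure.infinitePi fun i => bernoulliMeasure true false (i.2.elim b₁ fun _ => b₂)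

lemma measurable_arrayNoise : Measurable arrayNoise := by
  refine measurable_pi_lambda _ fun x => ?_
  refine Measurable.prodMk (by fun_prop) ?_
  exact measurable_sInf_false.comp
    (measurable_pi_lambda (fun (a : ℤ × Option ℕ → Bool) (o : Option ℕ) => a (x, o))
      fun o => by fun_prop)

lemma arrayLaw_map_curry (b₁ b₂ : I) :
    (arrayLaw b₁ b₂).map (MeasurableEquiv.curry ℤ (Option ℕ) Bool) =
      Measure.infinitePi fun _ : ℤ => siteArrayLaw b₁ b₂ :=
  Measure.infinitePi_map_curry fun (_ : ℤ) (o : Option ℕ) =>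
    bernoulliMeasure true false (o.elim b₁ fun _ => b₂)

lemma arrayLaw_map_arrayNoise (b₁ b₂ : I) (hb₂ : b₂ < 1) :
    (arrayLaw b₁ b₂).map arrayNoise = noiseLaw b₁ b₂ := by
  have hmeas : Measurable fun u : Option ℕ → Bool =>
      (u none, sInf {k : ℕ | u (some k) = false}) :=
    (measurable_pi_apply none).prodMk measurable_sInf_false
  have h := Measure.infinitePi_map_pi (fun _ : ℤ => siteArrayLaw b₁ b₂) (fun _ => hmeas)
  simp only [siteArrayLaw_map b₁ b₂ hb₂] at h
  have hmeas' : Measurable fun (u : ℤ → Option ℕ → Bool) (x : ℤ) =>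
      (u x none, sInf {k : ℕ | u x (some k) = false}) :=
    measurable_pi_lambda _ fun x => hmeas.comp (measurable_pi_apply x)
  rw [noiseLaw, ← h, ← arrayLaw_map_curry, Measure.map_map hmeas' (by fun_prop)]
  rfl

lemma arrayLaw_exists_false (b₁ b₂ : I) (hb₂ : b₂ < 1) :
    ∀ᵐ a ∂arrayLaw b₁ b₂, ∀ x, ∃ k : ℕ, a (x, some k) = false := by
  rw [ae_all_iff]
  intro x
  have hq : Measure.QuasiMeasurePreserving (fun (a : ℤ × Option ℕ → Bool) (o : Option ℕ) => a (x, o))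
      (arrayLaw b₁ b₂) (siteArrayLaw b₁ b₂) := by
    refine ⟨by fun_prop, ?_⟩
    rw [arrayLaw, Measure.map_infinitePi_infinitePi_of_inj (f := fun o : Option ℕ => (x, o))
      (fun o o' h => (Prod.mk.inj h).2)]
    exact Measure.AbsolutelyContinuous.rfl
  exact hq.ae (siteArrayLaw_exists_false b₁ b₂ hb₂)

/-- Given the configuration `η`, the law of the bits that tell whether paths go straight. -/
noncomputable def bitLaw (b₁ b₂ : I) (η : Config) : Measure (ℤ → Bool) :=
  Measure.infinitePi fun x => bernoulliMeasure true false (cond (η x) b₁ b₂)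

/-- For fixed `η` the sites read distinct coins, chosen without looking at them, so this is a
relabelling of independent variables. -/
lemma arrayLaw_map_coinIndex (b₁ b₂ : I) (η : Config) :
    (arrayLaw b₁ b₂).map (fun a => a ∘ coinIndex η) = bitLaw b₁ b₂ η := by
  have h := Measure.map_infinitePi_infinitePi_of_inj (injective_coinIndex η)
    (P := fun i : ℤ × Option ℕ => bernoulliMeasure true false (i.2.elim b₁ fun _ => b₂))
  change Measure.map (fun (a : ℤ × Option ℕ → Bool) x => a (coinIndex η x)) _ = _
  rw [arrayLaw, h, bitLaw]
  congr 1
  funext x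
  cases hx : η x
  · by_cases hp : ∃ y, IsPred η y x
    · obtain ⟨y, hy⟩ := hp
      simp [coinIndex_of_isPred hx hy]
    · simp [coinIndex_of_forall_not hx hp]
  · simp [coinIndex_of_occupied hx]

lemma measurableSet_flows (x : ℤ) :
    MeasurableSet {p : Config × (ℤ → Bool) | Flows p.1 p.2 x} := by
  have hη : ∀ w (b : Bool), MeasurableSet {p : Config × (ℤ → Bool) | p.1 w = b} := fun w b =>
    measurableSet_eq_fun (by fun_prop) measurable_const
  have hc : ∀ w (b : Bool), MeasurableSet {p : Config × (ℤ → Bool) | p.2 w = b} := fun w b =>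
    measurableSet_eq_fun (by fun_prop) measurable_const
  exact (MeasurableSet.iUnion fun y => (MeasurableSet.const (y ≤ x)).inter <|
    (hη y true).inter <| (hc y false).inter <| MeasurableSet.iInter fun w =>
      MeasurableSet.iInter fun _ : y < w => MeasurableSet.iInter fun _ : w ≤ x =>
        (hη w true).union (hc w true)).congr (by
      ext p
      simp only [Set.mem_iUnion, Set.mem_inter_iff, Set.mem_iInter, Set.mem_union,
        Set.mem_ofPred_eq]
      rfl)

lemma measurable_flux (x : ℤ) :
    Measurable fun p : Config × (ℤ → Bool) => flux p.1 p.2 x :=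
  measurable_to_bool ((measurableSet_flows x).congr (by ext p; simp [flux]))

lemma measurable_sweep : Measurable fun p : Config × (ℤ → Bool) => sweep p.1 p.2 := by
  refine measurable_pi_lambda _ fun x => ?_
  have h : Measurable fun p : Config × (ℤ → Bool) => (p.1 x, flux p.1 p.2 (x - 1), p.2 x) :=
    (by fun_prop : Measurable fun p : Config × (ℤ → Bool) => p.1 x).prodMk
      ((measurable_flux (x - 1)).prodMk (by fun_prop))
  exact (measurable_of_countable fun q : Bool × Bool × Bool =>
    if q.1 then q.2.1 || q.2.2 else q.2.1 && !q.2.2).comp h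

lemma kernel_eq_map_sweep (b₁ b₂ : I) (hb₂ : b₂ < 1) (η : Config) :
    kernel b₁ b₂ η = (bitLaw b₁ b₂ η).map (sweep η) := by
  have h1 : Measurable (update η) := measurable_update.comp measurable_prodMk_left
  have h2 : Measurable (sweep η) := measurable_sweep.comp measurable_prodMk_left
  rw [kernel_apply, ← arrayLaw_map_arrayNoise b₁ b₂ hb₂, ← arrayLaw_map_coinIndex,
    Measure.map_map h1 measurable_arrayNoise,
    Measure.map_map h2 (measurable_pi_lambda _ fun x => by fun_prop)]
  refine Measure.map_congr ?_
  filter_upwards [arrayLaw_exists_false b₁ b₂ hb₂] with a ha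
  exact update_arrayNoise ha η

end S6V

namespace S6V
open MeasureTheory ProbabilityTheory unitInterval

/-! ### The coupled step -/

/-- The law of the coins used by the coupling: at each site, one coin for an occupied site and one
for an empty site. -/
noncomputable def coins (b₁ b₂ : I) : Measure (ℤ × Bool → Bool) :=
  Measure.infinitePi fun i => bernoulliMeasure true false (cond i.2 b₁ b₂)

instance (b₁ b₂ : I) : IsProbabilityMeasure (coins b₁ b₂) := by
  unfold coins; infer_instance

lemma coins_map_bits (b₁ b₂ : I) (p : ℤ → ℤ) (ζ : Config)
    (h : Function.Injective fun x => (p x, ζ x)) :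
    (coins b₁ b₂).map (fun ω => bits ω p ζ) = bitLaw b₁ b₂ ζ :=
  Measure.map_infinitePi_infinitePi_of_inj h
    (P := fun i : ℤ × Bool => bernoulliMeasure true false (cond i.2 b₁ b₂))

/-- The coupled update of a pair of configurations. -/
noncomputable def pairUpdate (q : (Config × Config) × (ℤ × Bool → Bool)) : Config × Config :=
  (sweep q.1.1 (bits q.2 (partner q.1.1 q.1.2) q.1.1),
    sweep q.1.2 (bits q.2 (partner q.1.1 q.1.2) q.1.2))

lemma measurable_gap (x : ℤ) : Measurable fun e : Config × Config => gap e.1 e.2 x :=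
  (measurable_of_countable fun q : Bool × Bool => q.1.toInt - q.2.toInt).comp
    (by fun_prop : Measurable fun e : Config × Config => (e.1 x, e.2 x))

lemma measurable_height (x : ℤ) : Measurable fun e : Config × Config => height e.1 e.2 x := by
  unfold height
  exact (Finset.measurable_fun_sum _ fun w _ => measurable_gap w).sub
    (Finset.measurable_fun_sum _ fun w _ => measurable_gap w)

lemma measurableSet_paired (y x : ℤ) :
    MeasurableSet {e : Config × Config | Paired e.1 e.2 y x} := by
  exact ((MeasurableSet.const (y < x)).inter <|
    (measurableSet_eq_fun (measurable_height x) (measurable_height (y - 1))).inter <|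
      MeasurableSet.iInter fun w => MeasurableSet.iInter fun _ : y ≤ w =>
        MeasurableSet.iInter fun _ : w < x =>
          measurableSet_lt (measurable_height (y - 1)) (measurable_height w)).congr (by
      ext e
      simp only [Set.mem_inter_iff, Set.mem_iInter, Set.mem_ofPred_eq]
      rfl)

lemma measurable_partner (x : ℤ) : Measurable fun e : Config × Config => partner e.1 e.2 x := by
  refine measurable_to_countable' fun y => ?_
  refine ((measurableSet_paired y x).union ((MeasurableSet.const (y = x)).inter
    (MeasurableSet.iInter fun u => (measurableSet_paired u x).compl))).congr ?_
  ext e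
  simp only [Set.mem_union, Set.mem_inter_iff, Set.mem_iInter, Set.mem_compl_iff,
    Set.mem_ofPred_eq, Set.mem_preimage, Set.mem_singleton_iff]
  rcases partner_eq_or e.1 e.2 x with ⟨u, hu, h⟩ | ⟨hu, h⟩
  · constructor
    · rintro (h' | ⟨-, h'⟩)
      · exact h'.partner_eq
      · exact absurd hu (h' u)
    · intro h'
      rw [← h', h]
      exact Or.inl hu
  · constructor
    · rintro (h' | ⟨h', -⟩)
      · exact h'.partner_eq
      · rw [h, h']
    · intro h'
      exact Or.inr ⟨by rw [← h', h], fun u hu' => hu ⟨u, hu'⟩⟩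

lemma measurable_coin (x : ℤ) (b : Bool) :
    Measurable fun q : (Config × Config) × (ℤ × Bool → Bool) =>
      q.2 (partner q.1.1 q.1.2 x, b) := by
  have h : Measurable fun r : (ℤ × Bool → Bool) × ℤ => r.1 (r.2, b) :=
    measurable_from_prod_countable_left fun y => measurable_pi_apply (y, b)
  exact h.comp (measurable_snd.prodMk ((measurable_partner x).comp measurable_fst))

lemma measurable_bits {f : (Config × Config) → Config} (hf : Measurable f) :
    Measurable fun q : (Config × Config) × (ℤ × Bool → Bool) =>
      bits q.2 (partner q.1.1 q.1.2) (f q.1) := by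
  refine measurable_pi_lambda _ fun x => ?_
  have h1 : Measurable fun q : (Config × Config) × (ℤ × Bool → Bool) =>
      (f q.1 x, q.2 (partner q.1.1 q.1.2 x, true), q.2 (partner q.1.1 q.1.2 x, false)) :=
    (by fun_prop : Measurable fun q : (Config × Config) × (ℤ × Bool → Bool) => f q.1 x).prodMk
      ((measurable_coin x true).prodMk (measurable_coin x false))
  have h2 := (measurable_of_countable fun r : Bool × Bool × Bool => cond r.1 r.2.1 r.2.2).comp h1
  have h3 : (fun q : (Config × Config) × (ℤ × Bool → Bool) =>
      bits q.2 (partner q.1.1 q.1.2) (f q.1) x) = (fun r : Bool × Bool × Bool =>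
        cond r.1 r.2.1 r.2.2) ∘ fun q => (f q.1 x, q.2 (partner q.1.1 q.1.2 x, true),
          q.2 (partner q.1.1 q.1.2 x, false)) := by
    funext q
    simp only [Function.comp, bits]
    cases f q.1 x <;> rfl
  rw [h3]
  exact h2

lemma measurable_pairUpdate : Measurable pairUpdate :=
  (measurable_sweep.comp ((measurable_fst.comp measurable_fst).prodMk
    (measurable_bits measurable_fst))).prodMk
  (measurable_sweep.comp ((measurable_snd.comp measurable_fst).prodMk
    (measurable_bits measurable_snd)))

lemma measurable_flux₁ (x : ℤ) : Measurable fun q : (Config × Config) × (ℤ × Bool → Bool) =>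
    flux₁ q.1.1 q.1.2 q.2 x :=
  (measurable_flux x).comp ((measurable_fst.comp measurable_fst).prodMk
    (measurable_bits measurable_fst))

lemma measurable_flux₂ (x : ℤ) : Measurable fun q : (Config × Config) × (ℤ × Bool → Bool) =>
    flux₂ q.1.1 q.1.2 q.2 x :=
  (measurable_flux x).comp ((measurable_snd.comp measurable_fst).prodMk
    (measurable_bits measurable_snd))

/-- The law of the pair after a coupled step. -/
noncomputable def pairStep (b₁ b₂ : I) (π : Measure (Config × Config)) :
    Measure (Config × Config) :=
  (π.prod (coins b₁ b₂)).map pairUpdate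

instance (b₁ b₂ : I) (π : Measure (Config × Config)) [IsProbabilityMeasure π] :
    IsProbabilityMeasure (pairStep b₁ b₂ π) :=
  Measure.isProbabilityMeasure_map measurable_pairUpdate.aemeasurable

/-- The second copy only influences where the first one reads its coins; for a fixed pair the
reading map is injective, so the bits have law `bitLaw`. -/
lemma pairStep_map_fst (b₁ b₂ : I) (hb₂ : b₂ < 1) (π : Measure (Config × Config))
    [IsProbabilityMeasure π] :
    (pairStep b₁ b₂ π).map Prod.fst = (π.map Prod.fst).bind (kernel b₁ b₂) := by
  ext s hs
  have hm : Measurable (Prod.fst ∘ pairUpdate) := measurable_fst.comp measurable_pairUpdate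
  rw [pairStep, Measure.map_map measurable_fst measurable_pairUpdate,
    Measure.map_apply hm hs, Measure.prod_apply (hm hs),
    Measure.bind_apply hs (kernel b₁ b₂).measurable.aemeasurable,
    lintegral_map ((kernel b₁ b₂).measurable_coe hs) measurable_fst]
  refine lintegral_congr fun e => ?_
  have h1 : Measurable (sweep e.1) := measurable_sweep.comp measurable_prodMk_left
  rw [kernel_eq_map_sweep b₁ b₂ hb₂, ← coins_map_bits b₁ b₂ _ _ (injective_partner_left e.1 e.2),
    Measure.map_map h1 (measurable_pi_lambda _ fun x => by unfold bits; fun_prop),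
    Measure.map_apply (h1.comp (measurable_pi_lambda _ fun x => by unfold bits; fun_prop)) hs]
  rfl

lemma pairStep_map_snd (b₁ b₂ : I) (hb₂ : b₂ < 1) (π : Measure (Config × Config))
    [IsProbabilityMeasure π] :
    (pairStep b₁ b₂ π).map Prod.snd = (π.map Prod.snd).bind (kernel b₁ b₂) := by
  ext s hs
  have hm : Measurable (Prod.snd ∘ pairUpdate) := measurable_snd.comp measurable_pairUpdate
  rw [pairStep, Measure.map_map measurable_snd measurable_pairUpdate,
    Measure.map_apply hm hs, Measure.prod_apply (hm hs),
    Measure.bind_apply hs (kernel b₁ b₂).measurable.aemeasurable,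
    lintegral_map ((kernel b₁ b₂).measurable_coe hs) measurable_snd]
  refine lintegral_congr fun e => ?_
  have h1 : Measurable (sweep e.2) := measurable_sweep.comp measurable_prodMk_left
  rw [kernel_eq_map_sweep b₁ b₂ hb₂, ← coins_map_bits b₁ b₂ _ _ (injective_partner_right e.1 e.2),
    Measure.map_map h1 (measurable_pi_lambda _ fun x => by unfold bits; fun_prop),
    Measure.map_apply (h1.comp (measurable_pi_lambda _ fun x => by unfold bits; fun_prop)) hs]
  rfl

lemma pairUpdate_fst (q : (Config × Config) × (ℤ × Bool → Bool)) (x : ℤ) :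
    (pairUpdate q).1 x = if q.1.1 x
      then flux₁ q.1.1 q.1.2 q.2 (x - 1) || q.2 (partner q.1.1 q.1.2 x, true)
      else flux₁ q.1.1 q.1.2 q.2 (x - 1) && !q.2 (partner q.1.1 q.1.2 x, false) := by
  simp only [pairUpdate, sweep_eq, bits]
  cases q.1.1 x <;> rfl

lemma pairUpdate_snd (q : (Config × Config) × (ℤ × Bool → Bool)) (x : ℤ) :
    (pairUpdate q).2 x = if q.1.2 x
      then flux₂ q.1.1 q.1.2 q.2 (x - 1) || q.2 (partner q.1.1 q.1.2 x, true)
      else flux₂ q.1.1 q.1.2 q.2 (x - 1) && !q.2 (partner q.1.1 q.1.2 x, false) := by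
  simp only [pairUpdate, sweep_eq, bits]
  cases q.1.2 x <;> rfl

/-! ### Discrepancies -/

/-- Pairs of configurations that differ at `x`. -/
def Differ (x : ℤ) : Set (Config × Config) := {e | e.1 x ≠ e.2 x}

/-- The fluxes through `(x, x + 1)` differ. -/
def FluxDiffer (x : ℤ) : Set ((Config × Config) × (ℤ × Bool → Bool)) :=
  {q | flux₁ q.1.1 q.1.2 q.2 x ≠ flux₂ q.1.1 q.1.2 q.2 x}

/-- A vertical and a horizontal discrepancy annihilate at `x`. -/
def Annihilate (x : ℤ) : Set ((Config × Config) × (ℤ × Bool → Bool)) :=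
  {q | q.1 ∈ Differ x ∧ q ∈ FluxDiffer (x - 1) ∧ pairUpdate q ∉ Differ x ∧ q ∉ FluxDiffer x}

lemma measurableSet_differ (x : ℤ) : MeasurableSet (Differ x) :=
  (measurableSet_eq_fun (f := fun e : Config × Config => e.1 x) (g := fun e => e.2 x)
    (by fun_prop) (by fun_prop)).compl

lemma measurableSet_fluxDiffer (x : ℤ) : MeasurableSet (FluxDiffer x) :=
  (measurableSet_eq_fun (measurable_flux₁ x) (measurable_flux₂ x)).compl

lemma measurableSet_annihilate (x : ℤ) : MeasurableSet (Annihilate x) :=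
  (measurable_fst (measurableSet_differ x)).inter <| (measurableSet_fluxDiffer (x - 1)).inter <|
    (measurable_pairUpdate (measurableSet_differ x)).compl.inter (measurableSet_fluxDiffer x).compl

-- Both copies use the same two coins at `x`, so this is a finite check at one vertex: discrepancies
-- pass through, except that a vertical and a horizontal one may disappear together.
open scoped Classical in
lemma indicator_balance (q : (Config × Config) × (ℤ × Bool → Bool)) (x : ℤ) :
    (if q ∈ FluxDiffer x then (1 : ℝ) else 0) + (if pairUpdate q ∈ Differ x then 1 else 0) +
        2 * (if q ∈ Annihilate x then 1 else 0) ≤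
      (if q.1 ∈ Differ x then 1 else 0) + if q ∈ FluxDiffer (x - 1) then 1 else 0 := by
  have key : ∀ v v' f f' A B F F' S S' : Bool, F = (if v then f || !A else f && B) →
      F' = (if v' then f' || !A else f' && B) → S = (if v then f || A else f && !B) →
      S' = (if v' then f' || A else f' && !B) →
      (if F ≠ F' then (1 : ℝ) else 0) + (if S ≠ S' then 1 else 0) +
        2 * (if v ≠ v' ∧ f ≠ f' ∧ ¬ S ≠ S' ∧ ¬ F ≠ F' then 1 else 0) ≤
      (if v ≠ v' then 1 else 0) + if f ≠ f' then 1 else 0 := by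
    rintro v v' f f' A B F F' S S' rfl rfl rfl rfl
    cases v <;> cases v' <;> cases f <;> cases f' <;> cases A <;> cases B <;> norm_num
  convert! key _ _ _ _ _ _ _ _ _ _ (flux₁_eq q.1.1 q.1.2 q.2 x) (flux₂_eq q.1.1 q.1.2 q.2 x)
    (pairUpdate_fst q x) (pairUpdate_snd q x)

lemma balance (b₁ b₂ : I) (π : Measure (Config × Config)) [IsProbabilityMeasure π] (x : ℤ) :
    (π.prod (coins b₁ b₂)).real (FluxDiffer x) + (pairStep b₁ b₂ π).real (Differ x) +
        2 * (π.prod (coins b₁ b₂)).real (Annihilate x) ≤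
      π.real (Differ x) + (π.prod (coins b₁ b₂)).real (FluxDiffer (x - 1)) := by
  classical
  set P := π.prod (coins b₁ b₂)
  have h1 : (pairStep b₁ b₂ π).real (Differ x) = P.real (pairUpdate ⁻¹' Differ x) := by
    rw [measureReal_def, pairStep, Measure.map_apply measurable_pairUpdate (measurableSet_differ x)]
    rfl
  have h2 : π.real (Differ x) = P.real (Prod.fst ⁻¹' Differ x) := by
    have : π = P.map Prod.fst := by simp [P]
    conv_lhs => rw [this]
    rw [measureReal_def, Measure.map_apply measurable_fst (measurableSet_differ x)]
    rfl
  have hint : ∀ s : Set ((Config × Config) × (ℤ × Bool → Bool)), MeasurableSet s →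
      Integrable (s.indicator (1 : (Config × Config) × (ℤ × Bool → Bool) → ℝ)) P := fun s hs =>
    (integrable_const (1 : ℝ)).indicator hs
  have m1 := measurableSet_fluxDiffer x
  have m2 := measurableSet_fluxDiffer (x - 1)
  have m3 := measurableSet_annihilate x
  have m4 := measurable_pairUpdate (measurableSet_differ x)
  have m5 : MeasurableSet (Prod.fst ⁻¹' Differ x : Set ((Config × Config) × (ℤ × Bool → Bool))) :=
    measurable_fst (measurableSet_differ x)
  rw [h1, h2, ← integral_indicator_one m1, ← integral_indicator_one m2,
    ← integral_indicator_one m3, ← integral_indicator_one m4, ← integral_indicator_one m5,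
    ← integral_const_mul, ← integral_add' (hint _ m1) (hint _ m4),
    ← integral_add ((hint _ m1).add (hint _ m4)) ((hint _ m3).const_mul 2),
    ← integral_add (hint _ m5) (hint _ m2)]
  refine integral_mono (((hint _ m1).add (hint _ m4)).add ((hint _ m3).const_mul 2))
    ((hint _ m5).add (hint _ m2)) fun q => ?_
  have := indicator_balance q x
  simpa [Set.indicator_apply] using this

end S6V

namespace S6V
open MeasureTheory ProbabilityTheory unitInterval

/-! ### Lower bounds from prescribed coins -/

lemma flux_eq_of_straight (η ξ : Config) (ω : ℤ × Bool → Bool) {y x : ℤ} (hyx : y ≤ x)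
    (h : ∀ w, y < w → w ≤ x → ∀ b, ω (partner η ξ w, b) = true) :
    flux₁ η ξ ω x = flux₁ η ξ ω y ∧ flux₂ η ξ ω x = flux₂ η ξ ω y := by
  induction x, hyx using Int.leInduction with
  | base => exact ⟨rfl, rfl⟩
  | succ x hyx ih =>
    have ih := ih fun w hw hw' => h w hw (by omega)
    rw [flux₁_eq, flux₂_eq, h (x + 1) (by omega) le_rfl, h (x + 1) (by omega) le_rfl]
    simp [ih.1, ih.2]

lemma flux_eq_of_turn (η ξ : Config) (ω : ℤ × Bool → Bool) {y : ℤ}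
    (h : ∀ b, ω (partner η ξ y, b) = false) :
    flux₁ η ξ ω y = η y ∧ flux₂ η ξ ω y = ξ y := by
  rw [flux₁_eq, flux₂_eq, h, h]
  cases η y <;> cases ξ y <;> simp

/-- One copy has only a vertical and the other only a horizontal incoming path. When the two coins
differ, one path goes straight and the other turns, so they leave along the same edge. -/
lemma annihilate_of_ne (η ξ : Config) (ω : ℤ × Bool → Bool) {z : ℤ} (hz : η z ≠ ξ z)
    (h1 : flux₁ η ξ ω (z - 1) = ξ z) (h2 : flux₂ η ξ ω (z - 1) = η z)
    (h : ω (partner η ξ z, true) ≠ ω (partner η ξ z, false)) : ((η, ξ), ω) ∈ Annihilate z := by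
  simp only [Annihilate, Differ, FluxDiffer, Set.mem_ofPred_eq, pairUpdate_fst, pairUpdate_snd,
    flux₁_eq η ξ ω z, flux₂_eq η ξ ω z, h1, h2]
  revert hz h
  generalize η z = u
  generalize ξ z = v
  generalize ω (partner η ξ z, true) = A
  generalize ω (partner η ξ z, false) = B
  revert u v A B
  decide

/-- Adjacent opposite discrepancies: those at `y < z` are opposite, and there is none between. -/
def Opposite (η ξ : Config) (y z : ℤ) : Prop :=
  y < z ∧ η y ≠ ξ y ∧ η z = ξ y ∧ ξ z = η y ∧ ∀ w, y < w → w < z → η w = ξ w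

/-- The discrepancy at `y` turns, runs straight to `z` and meets the opposite one. Equal coins at
`y` and different ones at `z` can only be prescribed when `y` and `z` do not share coins. -/
lemma annihilate_of_not_paired {η ξ : Config} {y z : ℤ} (h : Opposite η ξ y z)
    (ω : ℤ × Bool → Bool) (hy : ∀ b, ω (partner η ξ y, b) = false)
    (hw : ∀ w, y < w → w < z → ∀ b, ω (partner η ξ w, b) = true)
    (hz : ω (partner η ξ z, true) ≠ ω (partner η ξ z, false)) :
    ((η, ξ), ω) ∈ Annihilate z := by
  obtain ⟨h1, h2, h3, h4, h5⟩ := h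
  have e1 := flux_eq_of_turn η ξ ω hy
  have e2 := flux_eq_of_straight η ξ ω (show y ≤ z - 1 by omega)
    fun w hw1 hw2 => hw w hw1 (by omega)
  refine annihilate_of_ne η ξ ω (by rw [h3, h4]; exact h2.symm) ?_ ?_ hz
  · rw [e2.1, e1.1, h4]
  · rw [e2.2, e1.2, h3]

/-- Here `y` and `z` share coins, which must differ for an annihilation. Turning at `y - 1` makes
the fluxes into `y` equal to the occupations of `y - 1`. The coins at `y` are chosen from these:
either the incoming discrepancy annihilates with that of `y`, or an excess of the first copy leaves
`y` and annihilates at `z`. -/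
lemma annihilate_of_paired {η ξ : Config} {y z : ℤ} (h : Opposite η ξ y z)
    (hp : Paired η ξ y z) (ω : ℤ × Bool → Bool)
    (hy : ∀ b, ω (partner η ξ (y - 1), b) = false)
    (hA : ω (y, true) = (η (y - 1) && ξ (y - 1)))
    (hB : ω (y, false) = !(η (y - 1) && ξ (y - 1)))
    (hw : ∀ w, y < w → w < z → ∀ b, ω (partner η ξ w, b) = true) :
    ((η, ξ), ω) ∈ Annihilate y ∨ ((η, ξ), ω) ∈ Annihilate z := by
  obtain ⟨h1, h2, h3, h4, h5⟩ := h
  have hpy : partner η ξ y = y := partner_eq_self (by rw [hp.gap_left]; norm_num)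
  obtain ⟨hy1, hy2⟩ := (gap_eq_one_iff _ _ _).1 hp.gap_left
  have e1 := flux_eq_of_turn η ξ ω hy
  have hne : ω (y, true) ≠ ω (y, false) := by
    rw [hA, hB]; cases (η (y - 1) && ξ (y - 1)) <;> simp
  by_cases hc : η (y - 1) = false ∧ ξ (y - 1) = true
  · left
    refine annihilate_of_ne η ξ ω h2 ?_ ?_ (by rwa [hpy])
    · rw [e1.1, hc.1, hy2]
    · rw [e1.2, hc.2, hy1]
  · right
    have e3 := flux₁_eq η ξ ω y
    have e4 := flux₂_eq η ξ ω y
    rw [hpy, e1.1, hy1, hA] at e3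
    rw [hpy, e1.2, hy2, hB] at e4
    have e5 : flux₁ η ξ ω y = true ∧ flux₂ η ξ ω y = false := by
      rw [e3, e4]
      revert hc
      cases η (y - 1) <;> cases ξ (y - 1) <;> simp
    have e2 := flux_eq_of_straight η ξ ω (show y ≤ z - 1 by omega)
      fun w hw1 hw2 => hw w hw1 (by omega)
    refine annihilate_of_ne η ξ ω (by rw [h3, h4]; exact h2.symm) ?_ ?_ (by rwa [hp.partner_eq])
    · rw [e2.1, e5.1, h4, hy1]
    · rw [e2.2, e5.2, h3, hy2]

open scoped Classical in
/-- For adjacent opposite discrepancies, some values of finitely many coins force an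
annihilation. -/
lemma exists_coins_annihilate {η ξ : Config} {y z : ℤ} (h : Opposite η ξ y z) :
    ∃ E : ℤ × Bool → Bool, ∀ ω : ℤ × Bool → Bool,
      (∀ w, y - 1 ≤ w → w ≤ z → ∀ b, ω (partner η ξ w, b) = E (partner η ξ w, b)) →
        ∃ x, y ≤ x ∧ x ≤ z ∧ ((η, ξ), ω) ∈ Annihilate x := by
  have hyz := h.1
  have hgz : gap η ξ z ≠ 0 := by
    rw [Ne, gap_eq_zero_iff, h.2.2.1, h.2.2.2.1]; exact h.2.1.symm
  have hgy : gap η ξ y ≠ 0 := by rw [Ne, gap_eq_zero_iff]; exact h.2.1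
  have hgw : ∀ w, y < w → w < z → gap η ξ w = 0 := fun w hw hw' => by
    rw [gap_eq_zero_iff]; exact h.2.2.2.2 w hw hw'
  -- Sites strictly between carry no discrepancy, so no other site reads their coins and these can
  -- be set freely.
  have hmid : ∀ u w, y < w → w < z → partner η ξ w = partner η ξ u → w = u := by
    intro u w hw hw' he
    rcases eq_or_paired_of_partner_eq he with h1 | h1 | h1
    · exact h1
    · have := h1.gap_left; rw [hgw w hw hw'] at this; norm_num at this
    · have := h1.gap_right; rw [hgw w hw hw'] at this; norm_num at this
  by_cases hp : Paired η ξ y z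
  · refine ⟨fun i => if i.1 = y then
        (if i.2 then (η (y - 1) && ξ (y - 1)) else !(η (y - 1) && ξ (y - 1)))
      else if i.1 = partner η ξ (y - 1) then false else true, fun ω hω => ?_⟩
    have hpy : partner η ξ y = y := partner_eq_self (by rw [hp.gap_left]; norm_num)
    have hne : partner η ξ (y - 1) ≠ y := by
      intro he
      rcases partner_eq_or η ξ (y - 1) with ⟨u, hu, he'⟩ | ⟨-, he'⟩
      · have := hu.1; omega
      · omega
    have hy := hω y (by omega) (by omega)
    rw [hpy] at hy
    have hprev : ∀ b, ω (partner η ξ (y - 1), b) = false := fun b => by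
      rw [hω (y - 1) le_rfl (by omega)]
      simp [hne]
    have hbetween : ∀ w, y < w → w < z → ∀ b, ω (partner η ξ w, b) = true := fun w hw hw' b => by
      rw [hω w (by omega) (by omega)]
      have n1 : partner η ξ w ≠ y := fun he => by
        have := hmid y w hw hw' (by rw [he, hpy]); omega
      have n2 : partner η ξ w ≠ partner η ξ (y - 1) := fun he => by
        have := hmid _ w hw hw' he; omega
      simp [n1, n2]
    rcases annihilate_of_paired h hp ω hprev (by simpa using hy true)
      (by simpa using hy false) hbetween with h1 | h1
    · exact ⟨y, le_rfl, hyz.le, h1⟩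
    · exact ⟨z, hyz.le, le_rfl, h1⟩
  · have hne : partner η ξ z ≠ partner η ξ y := by
      intro he
      rcases eq_or_paired_of_partner_eq he with h1 | h1 | h1
      · omega
      · have := h1.1; omega
      · exact hp h1
    refine ⟨fun i => if i.1 = partner η ξ y then false
      else if i.1 = partner η ξ z then i.2 else true, fun ω hω => ?_⟩
    refine ⟨z, hyz.le, le_rfl, annihilate_of_not_paired h ω (fun b => ?_)
      (fun w hw hw' b => ?_) ?_⟩
    · rw [hω y (by omega) (by omega)]; simp
    · rw [hω w (by omega) (by omega)]
      have n1 : partner η ξ w ≠ partner η ξ y := fun he => by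
        have := hmid _ w hw hw' he; omega
      have n2 : partner η ξ w ≠ partner η ξ z := fun he => by
        have := hmid _ w hw hw' he; omega
      simp [n1, n2]
    · rw [hω z (by omega) le_rfl, hω z (by omega) le_rfl]
      simp [hne]

/-- Discrepancies of both signs in a window contain adjacent opposite ones. -/
lemma exists_opposite {η ξ : Config} {a b u v : ℤ} (hu : a < u ∧ u ≤ b) (hv : a < v ∧ v ≤ b)
    (hu1 : gap η ξ u = 1) (hv1 : gap η ξ v = -1) :
    ∃ y z, a < y ∧ z ≤ b ∧ Opposite η ξ y z := by
  obtain ⟨p, q, hpq, hap, hqb, hp, hq⟩ : ∃ p q, p < q ∧ a < p ∧ q ≤ b ∧ gap η ξ p ≠ 0 ∧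
      gap η ξ q = - gap η ξ p := by
    rcases lt_trichotomy u v with h | h | h
    · exact ⟨u, v, h, hu.1, hv.2, by omega, by omega⟩
    · subst h; omega
    · exact ⟨v, u, h, hv.1, hu.2, by omega, by omega⟩
  -- `z` is the first discrepancy after `p` with the opposite sign, `y` the last one before `z` with
  -- the sign of `p`; no discrepancy of either sign is left between them.
  obtain ⟨z, ⟨hz1, hz2⟩, hzmin⟩ := Int.exists_least_of_bdd
    (P := fun w => p < w ∧ gap η ξ w = - gap η ξ p) ⟨p, fun w hw => hw.1.le⟩ ⟨q, hpq, hq⟩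
  obtain ⟨y, ⟨⟨hy1, hy3⟩, hy2⟩, hymax⟩ := Int.exists_greatest_of_bdd
    (P := fun w => (p ≤ w ∧ w < z) ∧ gap η ξ w = gap η ξ p) ⟨z, fun w hw => hw.1.2.le⟩
    ⟨p, ⟨le_rfl, hz1⟩, rfl⟩
  refine ⟨y, z, by omega, (hzmin q ⟨hpq, hq⟩).trans hqb, hy3, ?_, ?_⟩
  · rw [Ne, ← gap_eq_zero_iff, hy2]; exact hp
  have hyz : gap η ξ z = - gap η ξ y := by rw [hz2, hy2]
  have hy0 : gap η ξ y ≠ 0 := by omega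
  refine ⟨?_, ?_, fun w hw hw' => ?_⟩
  · revert hyz hy0; unfold gap
    cases η y <;> cases ξ y <;> cases η z <;> cases ξ z <;> simp
  · revert hyz hy0; unfold gap
    cases η y <;> cases ξ y <;> cases η z <;> cases ξ z <;> simp
  · rw [← gap_eq_zero_iff]
    by_contra hne
    have h1 := gap_cases η ξ w
    have h2 := gap_cases η ξ p
    rcases (by omega : gap η ξ w = gap η ξ p ∨ gap η ξ w = - gap η ξ p) with h3 | h3
    · have := hymax w ⟨⟨by omega, hw'⟩, h3⟩; omega
    · have := hzmin w ⟨by omega, h3⟩; omega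

/-! ### Probability bounds for discrepancies and annihilations -/

section Bounds

variable {b₁ b₂ : I} {m : ℝ}

lemma le_bernoulli {p : I} (h1 : m ≤ p) (h2 : m ≤ 1 - p) (e : Bool) :
    ENNReal.ofReal m ≤ bernoulliMeasure true false p {e} := by
  cases e
  · rw [bernoulli_false]; exact ENNReal.ofReal_le_ofReal h2
  · rw [bernoulli_true]; exact ENNReal.ofReal_le_ofReal h1

lemma bernoulli_true_le {p : I} (h2 : m ≤ 1 - p) :
    bernoulliMeasure true false p {true} ≤ ENNReal.ofReal (1 - m) := by
  rw [bernoulli_true]; exact ENNReal.ofReal_le_ofReal (by linarith)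

/-- `m` is a lower bound for all the probabilities of the values of the coins. -/
def CoinBound (b₁ b₂ : I) (m : ℝ) : Prop :=
  0 < m ∧ m ≤ 1 ∧ m ≤ b₁ ∧ m ≤ 1 - b₁ ∧ m ≤ b₂ ∧ m ≤ 1 - b₂

lemma exists_coinBound (hb₁ : 0 < b₁ ∧ b₁ < 1) (hb₂ : 0 < b₂ ∧ b₂ < 1) :
    ∃ m, CoinBound b₁ b₂ m := by
  have h1 : (0 : ℝ) < b₁ := by exact_mod_cast hb₁.1
  have h2 : (b₁ : ℝ) < 1 := by exact_mod_cast hb₁.2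
  have h3 : (0 : ℝ) < b₂ := by exact_mod_cast hb₂.1
  have h4 : (b₂ : ℝ) < 1 := by exact_mod_cast hb₂.2
  refine ⟨min (min b₁ (1 - b₁)) (min b₂ (1 - b₂)), ?_, ?_, ?_, ?_, ?_, ?_⟩
  · simp only [lt_min_iff]; exact ⟨⟨h1, by linarith⟩, h3, by linarith⟩
  · exact ((min_le_left _ _).trans (min_le_left _ _)).trans h2.le
  · exact (min_le_left _ _).trans (min_le_left _ _)
  · exact (min_le_left _ _).trans (min_le_right _ _)
  · exact (min_le_right _ _).trans (min_le_left _ _)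
  · exact (min_le_right _ _).trans (min_le_right _ _)

lemma CoinBound.pow_le_coins (hm : CoinBound b₁ b₂ m) (F : Finset (ℤ × Bool))
    (E : ℤ × Bool → Bool) :
    ENNReal.ofReal m ^ F.card ≤ coins b₁ b₂ {ω | ∀ i ∈ F, ω i = E i} := by
  have h : coins b₁ b₂ {ω | ∀ i ∈ F, ω i = E i} =
      ∏ i ∈ F, bernoulliMeasure true false (cond i.2 b₁ b₂) {E i} :=
    Measure.infinitePi_pi _ (t := fun i => {E i}) fun i _ => measurableSet_singleton _
  rw [h, ← Finset.prod_const]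
  refine Finset.prod_le_prod' fun i _ => ?_
  obtain ⟨-, -, h1, h2, h3, h4⟩ := hm
  rcases i with ⟨x, _ | _⟩
  · exact le_bernoulli h3 h4 _
  · exact le_bernoulli h1 h2 _

lemma CoinBound.coins_le_pow (hm : CoinBound b₁ b₂ m) (F : Finset (ℤ × Bool)) :
    coins b₁ b₂ {ω | ∀ i ∈ F, ω i = true} ≤ ENNReal.ofReal (1 - m) ^ F.card := by
  have h : coins b₁ b₂ {ω | ∀ i ∈ F, ω i = true} =
      ∏ i ∈ F, bernoulliMeasure true false (cond i.2 b₁ b₂) {true} :=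
    Measure.infinitePi_pi _ (t := fun i => {true}) fun i _ => measurableSet_singleton _
  rw [h, ← Finset.prod_const]
  refine Finset.prod_le_prod' fun i _ => ?_
  obtain ⟨-, -, h1, h2, h3, h4⟩ := hm
  rcases i with ⟨x, _ | _⟩
  · exact bernoulli_true_le h4
  · exact bernoulli_true_le h2

lemma mul_le_prod_real {α β : Type*} [MeasurableSpace α] [MeasurableSpace β] {π : Measure α}
    {μ : Measure β} [IsProbabilityMeasure π] [IsProbabilityMeasure μ] {A : Set α}
    {S : Set (α × β)} (hA : MeasurableSet A) (hS : MeasurableSet S) {c : ℝ} (hc : 0 ≤ c)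
    (h : ∀ e ∈ A, ENNReal.ofReal c ≤ μ {ω | (e, ω) ∈ S}) :
    c * π.real A ≤ (π.prod μ).real S := by
  have h1 : ENNReal.ofReal c * π A ≤ (π.prod μ) S := by
    rw [Measure.prod_apply hS, ← lintegral_indicator_const hA]
    refine lintegral_mono fun e => ?_
    by_cases he : e ∈ A
    · rw [Set.indicator_of_mem he]; exact h e he
    · rw [Set.indicator_of_notMem he]; exact zero_le
  have h2 := ENNReal.toReal_mono (measure_ne_top _ _) h1
  rwa [ENNReal.toReal_mul, ENNReal.toReal_ofReal hc] at h2

lemma prod_real_le {α β : Type*} [MeasurableSpace α] [MeasurableSpace β] {π : Measure α}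
    {μ : Measure β} [IsProbabilityMeasure π] [IsProbabilityMeasure μ]
    {S : Set (α × β)} (hS : MeasurableSet S) {c : ℝ} (hc : 0 ≤ c)
    (h : ∀ e, μ {ω | (e, ω) ∈ S} ≤ ENNReal.ofReal c) :
    (π.prod μ).real S ≤ c := by
  have h1 : (π.prod μ) S ≤ ENNReal.ofReal c := by
    rw [Measure.prod_apply hS]
    calc ∫⁻ e, μ (Prod.mk e ⁻¹' S) ∂π ≤ ∫⁻ _, ENNReal.ofReal c ∂π := lintegral_mono fun e => h e
      _ = ENNReal.ofReal c := by simp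
  have h2 := ENNReal.toReal_mono ENNReal.ofReal_ne_top h1
  rwa [ENNReal.toReal_ofReal hc] at h2

variable (π : Measure (Config × Config)) [IsProbabilityMeasure π]

/-- If both coins read at `x` fail, the flux out of `x` is the occupation of `x` in each copy. -/
lemma CoinBound.differ_le (hm : CoinBound b₁ b₂ m) (x : ℤ) :
    m ^ 2 * π.real (Differ x) ≤ (π.prod (coins b₁ b₂)).real (FluxDiffer x) := by
  classical
  refine mul_le_prod_real (measurableSet_differ x) (measurableSet_fluxDiffer x)
    (pow_nonneg hm.1.le _) fun e he => ?_
  let F : Finset (ℤ × Bool) := {(partner e.1 e.2 x, true), (partner e.1 e.2 x, false)}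
  have hF : F.card = 2 := Finset.card_pair (by simp)
  rw [ENNReal.ofReal_pow hm.1.le, ← hF]
  refine (hm.pow_le_coins F fun _ => false).trans (measure_mono fun ω hω => ?_)
  have h1 := flux_eq_of_turn e.1 e.2 ω (y := x) fun b => hω (partner e.1 e.2 x, b) (by
    cases b <;> simp [F])
  simp only [FluxDiffer, Set.mem_ofPred_eq, h1.1, h1.2]
  exact he

/-- Some site of the window `(a, b]` carries a discrepancy of each sign. -/
def BothSigns (a b : ℤ) : Set (Config × Config) :=
  {e | (∃ u, (a < u ∧ u ≤ b) ∧ gap e.1 e.2 u = 1) ∧ ∃ v, (a < v ∧ v ≤ b) ∧ gap e.1 e.2 v = -1}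

lemma measurableSet_bothSigns (a b : ℤ) : MeasurableSet (BothSigns a b) := by
  have h : ∀ k : ℤ, MeasurableSet {e : Config × Config |
      ∃ u, (a < u ∧ u ≤ b) ∧ gap e.1 e.2 u = k} := fun k =>
    (MeasurableSet.iUnion fun u => (MeasurableSet.const (a < u ∧ u ≤ b)).inter
      (measurableSet_eq_fun (measurable_gap u) (measurable_const (a := k)))).congr (by
        ext e; simp)
  exact (h 1).inter (h (-1))

/-- The exponent bounds the number of coins to prescribe: two at each of at most `n + 1` sites, the
window and the site before it. -/
lemma CoinBound.bothSigns_le (hm : CoinBound b₁ b₂ m) (a : ℤ) (n : ℕ) :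
    m ^ (2 * (n + 1)) * π.real (BothSigns a (a + n)) ≤
      ∑ x ∈ Finset.Ioc a (a + n), (π.prod (coins b₁ b₂)).real (Annihilate x) := by
  classical
  refine le_trans ?_ (measureReal_biUnion_finset_le _ _)
  refine mul_le_prod_real (measurableSet_bothSigns _ _)
    (Finset.measurableSet_biUnion _ fun x _ => measurableSet_annihilate x)
    (pow_nonneg hm.1.le _) fun e he => ?_
  obtain ⟨⟨u, hu, hu1⟩, v, hv, hv1⟩ := he
  obtain ⟨y, z, hay, hzb, hop⟩ := exists_opposite hu hv hu1 hv1
  obtain ⟨E, hE⟩ := exists_coins_annihilate hop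
  let F : Finset (ℤ × Bool) :=
    (Finset.Icc (y - 1) z).image (partner e.1 e.2) ×ˢ (Finset.univ : Finset Bool)
  have hF : F.card ≤ 2 * (n + 1) := by
    rw [Finset.card_product, mul_comm]
    refine Nat.mul_le_mul (by simp) (Finset.card_image_le.trans ?_)
    simp only [Int.card_Icc]
    omega
  calc ENNReal.ofReal (m ^ (2 * (n + 1))) ≤ ENNReal.ofReal m ^ F.card := by
        rw [← ENNReal.ofReal_pow hm.1.le]
        exact ENNReal.ofReal_le_ofReal (pow_le_pow_of_le_one hm.1.le hm.2.1 hF)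
    _ ≤ _ := hm.pow_le_coins F E
    _ ≤ _ := measure_mono fun ω hω => ?_
  obtain ⟨x, hx1, hx2, hx3⟩ := hE ω fun w hw hw' b => hω (partner e.1 e.2 w, b) (by
    simp only [F, Finset.mem_product, Finset.mem_univ, and_true]
    exact Finset.mem_image_of_mem _ (Finset.mem_Icc.2 ⟨hw, hw'⟩))
  simp only [Set.mem_ofPred_eq, Set.mem_iUnion]
  exact ⟨x, Finset.mem_Ioc.2 ⟨by omega, by omega⟩, hx3⟩

/-- A failing coin makes the outgoing flux equal to the occupation, erasing the incoming flux;
agreement then persists as long as the sites agree. -/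
lemma not_fluxDiffer_of_bit_false (η ξ : Config) (ω : ℤ × Bool → Bool) {w x : ℤ} (hwx : w ≤ x)
    (h : ∀ u, w ≤ u → u ≤ x → η u = ξ u) (hw : ω (w, η w) = false) :
    flux₁ η ξ ω x = flux₂ η ξ ω x := by
  induction x, hwx using Int.leInduction with
  | base =>
    have hp : partner η ξ w = w := partner_eq_self (by
      rw [(gap_eq_zero_iff _ _ _).2 (h w le_rfl le_rfl)]; norm_num)
    rw [flux₁_eq, flux₂_eq, hp, ← h w le_rfl le_rfl]
    cases hη : η w <;> simp_all
  | succ x hwx ih =>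
    have ih := ih fun u hu hu' => h u hu (by omega)
    rw [flux₁_eq, flux₂_eq, ← h (x + 1) (by omega) le_rfl]
    simp [ih]

/-- A flux discrepancy at `a + K` comes with a vertical one at one of the last `K` sites, unless all
`K` coins of the first copy succeed. -/
lemma CoinBound.fluxDiffer_le (hm : CoinBound b₁ b₂ m) (a : ℤ) (K : ℕ) :
    (π.prod (coins b₁ b₂)).real (FluxDiffer (a + K)) ≤
      ∑ w ∈ Finset.Ioc a (a + K), π.real (Differ w) + (1 - m) ^ K := by
  classical
  set P := π.prod (coins b₁ b₂)
  have h2 : ∀ x, π.real (Differ x) = P.real (Prod.fst ⁻¹' Differ x) := by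
    intro x
    have : π = P.map Prod.fst := by simp [P]
    conv_lhs => rw [this]
    rw [measureReal_def, Measure.map_apply measurable_fst (measurableSet_differ x)]
    rfl
  let S : Set ((Config × Config) × (ℤ × Bool → Bool)) :=
    {q | ∀ w ∈ Finset.Ioc a (a + K), q.2 (w, q.1.1 w) = true}
  have hS : MeasurableSet S := by
    have : S = ⋂ w ∈ Finset.Ioc a (a + (K : ℤ)), {q | q.2 (w, q.1.1 w) = true} := by
      ext q; simp [S]
    rw [this]
    refine Finset.measurableSet_biInter _ fun w _ => ?_
    refine measurableSet_eq_fun ?_ measurable_const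
    have h1 : Measurable fun q : (Config × Config) × (ℤ × Bool → Bool) =>
        (q.1.1 w, q.2 (w, true), q.2 (w, false)) := by fun_prop
    have h3 := (measurable_of_countable fun r : Bool × Bool × Bool =>
      cond r.1 r.2.1 r.2.2).comp h1
    have h4 : (fun q : (Config × Config) × (ℤ × Bool → Bool) => q.2 (w, q.1.1 w)) =
        (fun r : Bool × Bool × Bool => cond r.1 r.2.1 r.2.2) ∘
          fun q => (q.1.1 w, q.2 (w, true), q.2 (w, false)) := by
      funext q
      simp only [Function.comp]
      cases q.1.1 w <;> rfl
    rw [h4]; exact h3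
  have hsub : FluxDiffer (a + K) ⊆
      (⋃ w ∈ Finset.Ioc a (a + (K : ℤ)), Prod.fst ⁻¹' Differ w) ∪ S := by
    intro q hq
    by_contra hcon
    simp only [Set.mem_union, Set.mem_iUnion, not_or, not_exists] at hcon
    obtain ⟨hc1, hc2⟩ := hcon
    simp only [S, Set.mem_ofPred_eq, not_forall] at hc2
    obtain ⟨w, hw, hwf⟩ := hc2
    have hw' := Finset.mem_Ioc.1 hw
    refine hq (not_fluxDiffer_of_bit_false q.1.1 q.1.2 q.2 hw'.2 (fun u hu hu' => ?_)
      (by simpa using hwf))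
    by_contra hne
    exact hc1 u (Finset.mem_Ioc.2 ⟨by omega, hu'⟩) hne
  have hSle : P.real S ≤ (1 - m) ^ K := by
    have hm1 : 0 ≤ 1 - m := by linarith [hm.2.1]
    refine prod_real_le hS (pow_nonneg hm1 _) fun e => ?_
    let F : Finset (ℤ × Bool) := (Finset.Ioc a (a + (K : ℤ))).image fun w => (w, e.1 w)
    have hF : F.card = K := by
      rw [Finset.card_image_of_injective _ fun w w' h => (Prod.mk.inj h).1]
      simp
    rw [ENNReal.ofReal_pow hm1]
    conv_rhs => rw [← hF]
    refine (measure_mono fun ω hω => ?_).trans (hm.coins_le_pow F)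
    intro i hi
    obtain ⟨w, hw, rfl⟩ := Finset.mem_image.1 hi
    exact hω w hw
  calc P.real (FluxDiffer (a + K)) ≤ P.real (⋃ w ∈ Finset.Ioc a (a + (K : ℤ)),
        Prod.fst ⁻¹' Differ w) + P.real S :=
        (measureReal_mono hsub).trans (measureReal_union_le _ _)
    _ ≤ _ := by
        refine add_le_add ?_ hSle
        simp only [h2]
        exact measureReal_biUnion_finset_le _ _

end Bounds

end S6V

namespace S6V
open MeasureTheory ProbabilityTheory unitInterval Filter Topology

/-! ### Almost stationary couplings have few discrepancies -/

lemma mul_le_sum_Ioc_of_blocks (f : ℤ → ℝ) (a : ℤ) (n : ℕ) (r : ℝ) (M : ℕ)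
    (h : ∀ j < M, r ≤ ∑ x ∈ Finset.Ioc (a + j * n) (a + j * n + n), f x) :
    M * r ≤ ∑ x ∈ Finset.Ioc a (a + M * n), f x := by
  induction M with
  | zero => simp
  | succ M ih =>
    have e1 : Finset.Ioc a (a + ((M + 1 : ℕ) : ℤ) * n) =
        Finset.Ioc a (a + M * n) ∪ Finset.Ioc (a + M * n) (a + M * n + n) := by
      rw [Finset.Ioc_union_Ioc_eq_Ioc (by nlinarith [mul_nonneg (Int.natCast_nonneg M) (Int.natCast_nonneg n)]) (by omega)]
      congr 1; push_cast; ring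
    have hd : Disjoint (Finset.Ioc a (a + M * n)) (Finset.Ioc (a + M * n) (a + M * n + (n : ℤ))) :=
      Finset.disjoint_left.2 fun x hx hx' => by
        have := (Finset.mem_Ioc.1 hx).2
        have := (Finset.mem_Ioc.1 hx').1
        omega
    rw [e1, Finset.sum_union hd]
    have h1 := ih fun j hj => h j (by omega)
    have h2 := h M (by omega)
    push_cast
    linarith

-- If only one sign occurs, the number of discrepancies is the absolute value of their sum;
-- otherwise `n` bounds it.
open scoped Classical in
lemma sum_differ_le (η ξ : Config) (a : ℤ) (n : ℕ) :
    ∑ x ∈ Finset.Ioc a (a + n), (if (η, ξ) ∈ Differ x then (1 : ℝ) else 0) ≤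
      |∑ x ∈ Finset.Ioc a (a + n), (gap η ξ x : ℝ)| +
        n * if (η, ξ) ∈ BothSigns a (a + n) then 1 else 0 := by
  have hcard : ∑ x ∈ Finset.Ioc a (a + (n : ℤ)), (1 : ℝ) = n := by simp
  have hg : ∀ x, (if (η, ξ) ∈ Differ x then (1 : ℝ) else 0) = |(gap η ξ x : ℝ)| := by
    intro x
    by_cases h : η x = ξ x
    · rw [if_neg (by simpa [Differ] using h), (gap_eq_zero_iff _ _ _).2 h]
      simp
    · rw [if_pos (show (η, ξ) ∈ Differ x from h)]
      have h1 := mt (gap_eq_zero_iff η ξ x).1 h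
      rcases (by have := gap_cases η ξ x; omega : gap η ξ x = 1 ∨ gap η ξ x = -1) with h2 | h2 <;>
        rw [h2] <;> simp
  by_cases hb : (η, ξ) ∈ BothSigns a (a + n)
  · rw [if_pos hb, mul_one]
    have : ∑ x ∈ Finset.Ioc a (a + (n : ℤ)), (if (η, ξ) ∈ Differ x then (1 : ℝ) else 0) ≤ n := by
      rw [← hcard]
      refine Finset.sum_le_sum fun x _ => ?_
      split_ifs <;> norm_num
    linarith [abs_nonneg (∑ x ∈ Finset.Ioc a (a + (n : ℤ)), (gap η ξ x : ℝ))]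
  · rw [if_neg hb, mul_zero, add_zero]
    simp only [hg]
    have hb' : (∀ u ∈ Finset.Ioc a (a + (n : ℤ)), gap η ξ u ≠ 1) ∨
        ∀ u ∈ Finset.Ioc a (a + (n : ℤ)), gap η ξ u ≠ -1 := by
      by_contra hcon
      push Not at hcon
      obtain ⟨⟨u, hu, hu1⟩, v, hv, hv1⟩ := hcon
      exact hb ⟨⟨u, Finset.mem_Ioc.1 hu, hu1⟩, v, Finset.mem_Ioc.1 hv, hv1⟩
    rcases hb' with h | h
    · have h0 : ∀ x ∈ Finset.Ioc a (a + (n : ℤ)), (gap η ξ x : ℝ) ≤ 0 := fun x hx => by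
        have := gap_cases η ξ x; have := h x hx
        exact_mod_cast (by omega : gap η ξ x ≤ 0)
      rw [abs_of_nonpos (Finset.sum_nonpos h0), ← Finset.sum_neg_distrib]
      exact Finset.sum_le_sum fun x hx => (abs_of_nonpos (h0 x hx)).le
    · have h0 : ∀ x ∈ Finset.Ioc a (a + (n : ℤ)), (0 : ℝ) ≤ gap η ξ x := fun x hx => by
        have := gap_cases η ξ x; have := h x hx
        exact_mod_cast (by omega : 0 ≤ gap η ξ x)
      rw [abs_of_nonneg (Finset.sum_nonneg h0)]
      exact Finset.sum_le_sum fun x hx => (abs_of_nonneg (h0 x hx)).le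

lemma measurable_gap_real (x : ℤ) :
    Measurable fun e : Config × Config => (gap e.1 e.2 x : ℝ) :=
  (measurable_of_countable fun k : ℤ => (k : ℝ)).comp (measurable_gap x)

lemma abs_gap_le (η ξ : Config) (x : ℤ) : |(gap η ξ x : ℝ)| ≤ 1 := by
  rcases gap_cases η ξ x with h | h | h <;> rw [h] <;> norm_num

lemma integrable_gap (π : Measure (Config × Config)) [IsProbabilityMeasure π] (x : ℤ) :
    Integrable (fun e : Config × Config => (gap e.1 e.2 x : ℝ)) π :=
  Integrable.of_bound (measurable_gap_real x).aestronglyMeasurable 1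
    (ae_of_all _ fun e => by rw [Real.norm_eq_abs]; exact abs_gap_le _ _ _)

lemma sum_differ_real_le (π : Measure (Config × Config)) [IsProbabilityMeasure π] (a : ℤ) (n : ℕ) :
    ∑ x ∈ Finset.Ioc a (a + n), π.real (Differ x) ≤
      ∫ e, |∑ x ∈ Finset.Ioc a (a + n), (gap e.1 e.2 x : ℝ)| ∂π +
        n * π.real (BothSigns a (a + n)) := by
  classical
  have hint : ∀ s : Set (Config × Config), MeasurableSet s →
      Integrable (s.indicator (1 : Config × Config → ℝ)) π := fun s hs =>
    (integrable_const (1 : ℝ)).indicator hs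
  have hsum : Integrable (fun e : Config × Config =>
      |∑ x ∈ Finset.Ioc a (a + (n : ℤ)), (gap e.1 e.2 x : ℝ)|) π :=
    (integrable_finsetSum _ fun x _ => integrable_gap π x).abs
  have hb := hint _ (measurableSet_bothSigns a (a + n))
  rw [← integral_indicator_one (measurableSet_bothSigns a (a + n)), ← integral_const_mul,
    ← integral_add hsum (hb.const_mul _)]
  simp_rw [← integral_indicator_one (measurableSet_differ _)]
  rw [← integral_finsetSum _ fun x _ => hint _ (measurableSet_differ x)]
  refine integral_mono (integrable_finsetSum _ fun x _ => hint _ (measurableSet_differ x))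
    (hsum.add (hb.const_mul _)) fun e => ?_
  have := sum_differ_le e.1 e.2 a n
  simpa [Set.indicator_apply] using this

/-- The frequency of discrepancies at a site drops by at most `ε` in a coupled step. -/
def AlmostStationary (b₁ b₂ : I) (ε : ℝ) (π : Measure (Config × Config)) : Prop :=
  ∀ x, π.real (Differ x) ≤ (pairStep b₁ b₂ π).real (Differ x) + ε

variable {b₁ b₂ : I} {m : ℝ}

/-- The fluxes in `balance` telescope over the window, and almost stationarity costs `ε` per site.
-/
lemma sum_annihilate_le {ε : ℝ} {π : Measure (Config × Config)} [IsProbabilityMeasure π]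
    (h : AlmostStationary b₁ b₂ ε π) (a : ℤ) (N : ℕ) :
    (π.prod (coins b₁ b₂)).real (FluxDiffer (a + N)) +
        2 * ∑ x ∈ Finset.Ioc a (a + N), (π.prod (coins b₁ b₂)).real (Annihilate x) ≤
      (π.prod (coins b₁ b₂)).real (FluxDiffer a) + ε * N := by
  induction N with
  | zero => simp
  | succ N ih =>
    have e1 : Finset.Ioc a (a + ((N + 1 : ℕ) : ℤ)) =
        insert (a + (N + 1 : ℕ)) (Finset.Ioc a (a + N)) := by
      ext; simp; omega
    rw [e1, Finset.sum_insert (by simp)]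
    have h1 := balance b₁ b₂ π (a + (N + 1 : ℕ))
    have h2 := h (a + (N + 1 : ℕ))
    rw [show a + ((N + 1 : ℕ) : ℤ) - 1 = a + N by push_cast; ring] at h1
    push_cast at h1 h2 ⊢
    linarith

/-- From left to right the probability of a flux discrepancy grows by at most `ε` per site, so the
value `δ` at one edge forces `δ / 2` on a long stretch to its left. Each block of `K` sites there
has at least `δ / 4` vertical discrepancies in mean, twice what the net count allows; so both signs
occur, and the annihilations add up to more than the flux can pay for. `K` precedes `L` so that the
window length can be adapted to the coupling, and `ε` comes last. -/
theorem CoinBound.fluxDiffer_lt (hm : CoinBound b₁ b₂ m) {δ : ℝ} (hδ : 0 < δ) :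
    ∃ K : ℕ, 0 < K ∧ ∀ L : ℕ, 0 < L → ∃ ε > 0, ∀ (π : Measure (Config × Config))
      [IsProbabilityMeasure π], AlmostStationary b₁ b₂ ε π →
      (∀ a : ℤ, ∫ e, |∑ x ∈ Finset.Ioc a (a + (L * K : ℕ)), (gap e.1 e.2 x : ℝ)| ∂π ≤
        L * (δ / 8)) →
      ∀ x, (π.prod (coins b₁ b₂)).real (FluxDiffer x) < δ := by
  have hm0 := hm.1
  obtain ⟨K₀, hK₀⟩ := exists_pow_lt_of_lt_one (show (0 : ℝ) < δ / 4 by positivity)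
    (show 1 - m < 1 by linarith)
  refine ⟨K₀ + 1, by omega, fun L hL => ?_⟩
  set K := K₀ + 1 with hKdef
  have hK : (1 - m) ^ K ≤ δ / 4 :=
    (pow_le_pow_of_le_one (by linarith [hm.2.1]) (by linarith) (Nat.le_succ K₀)).trans hK₀.le
  have hKpos : (0 : ℝ) < K := by positivity
  have hLpos : (0 : ℝ) < L := by exact_mod_cast hL
  set n := L * K with hn
  have hnpos : (0 : ℝ) < n := by rw [hn]; push_cast; positivity
  set r := m ^ (2 * (n + 1)) * (δ / (8 * K)) with hr
  have hrpos : 0 < r := by positivity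
  -- Each window of length `n` will contribute at least `r` annihilations, so `M` windows exceed
  -- `1`.
  obtain ⟨M, hM⟩ := exists_nat_gt (1 / r)
  have hMr : 1 < M * r := by rwa [div_lt_iff₀ hrpos] at hM
  have hMpos : (0 : ℝ) < M := lt_trans (by positivity) hM
  -- The error over the whole stretch is at most `δ / 2`, to propagate the flux, and at most `1`,
  -- for the contradiction `2 * M * r ≤ 1 + 1`.
  refine ⟨min (δ / 2) 1 / (M * n), by positivity, fun π _ hπ hwin x₀ => ?_⟩
  by_contra! hx₀
  set ε := min (δ / 2) 1 / (M * n) with hε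
  have hεpos : 0 ≤ ε := by positivity
  have hεMn : ε * (M * n) = min (δ / 2) 1 := by rw [hε]; field_simp
  set P := π.prod (coins b₁ b₂) with hP
  set a := x₀ - M * n with ha
  have hd : ∀ j : ℕ, j ≤ M * n → δ / 2 ≤ P.real (FluxDiffer (a + j)) := by
    intro j hj
    have h1 := sum_annihilate_le hπ (a + j) (M * n - j)
    rw [show a + (j : ℤ) + ((M * n - j : ℕ) : ℤ) = x₀ by rw [ha]; push_cast [hj]; ring] at h1
    have h2 : 0 ≤ ∑ x ∈ Finset.Ioc (a + (j : ℤ)) x₀, P.real (Annihilate x) :=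
      Finset.sum_nonneg fun _ _ => measureReal_nonneg
    have h3 : ε * ((M * n - j : ℕ) : ℝ) ≤ δ / 2 := by
      calc ε * ((M * n - j : ℕ) : ℝ) ≤ ε * ((M * n : ℕ) : ℝ) := by
            gcongr; omega
        _ = min (δ / 2) 1 := by push_cast; exact hεMn
        _ ≤ δ / 2 := min_le_left _ _
    linarith
  have hblock : ∀ j : ℕ, j + K ≤ M * n →
      δ / 4 ≤ ∑ x ∈ Finset.Ioc (a + j) (a + j + K), π.real (Differ x) := by
    intro j hj
    have h1 := hd (j + K) hj
    have h2 := hm.fluxDiffer_le π (a + j) K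
    rw [show a + ((j + K : ℕ) : ℤ) = a + j + K by push_cast; ring] at h1
    linarith
  have hwindow : ∀ j < M, r ≤ ∑ x ∈ Finset.Ioc (a + j * n) (a + j * n + n),
      P.real (Annihilate x) := by
    intro j hj
    have hjM : j * n + n ≤ M * n := by nlinarith
    have h1 := mul_le_sum_Ioc_of_blocks (fun x => π.real (Differ x)) (a + j * n) K (δ / 4) L
      fun i hi => by
        have h2 : j * n + i * K + K ≤ M * n := by
          have : i * K + K ≤ n := by rw [hn]; nlinarith
          omega
        have h3 := hblock (j * n + i * K) h2
        push_cast at h3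
        rwa [show a + ((j : ℤ) * n + i * K) = a + j * n + i * K by ring] at h3
    rw [show a + (j : ℤ) * n + (L : ℤ) * K = a + j * n + n by rw [hn]; push_cast; ring] at h1
    have h4 := sum_differ_real_le π (a + j * n) n
    have h5 := hwin (a + j * n)
    have h6 : L * (δ / 8) ≤ n * π.real (BothSigns (a + j * n) (a + j * n + n)) := by linarith
    have h7 : δ / (8 * K) ≤ π.real (BothSigns (a + j * n) (a + j * n + n)) := by
      have h8 : (n : ℝ) = L * K := by rw [hn]; push_cast; ring
      rw [h8, mul_assoc] at h6
      have h9 := le_of_mul_le_mul_left h6 hLpos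
      rw [div_le_iff₀ (by positivity)]
      linarith
    calc r ≤ m ^ (2 * (n + 1)) * π.real (BothSigns (a + j * n) (a + j * n + n)) := by
          rw [hr]; gcongr
      _ ≤ _ := hm.bothSigns_le π _ n
  have h1 := mul_le_sum_Ioc_of_blocks (fun x => P.real (Annihilate x)) a n r M hwindow
  have h2 := sum_annihilate_le hπ a (M * n)
  push_cast at h2
  rw [hεMn] at h2
  have h3 : P.real (FluxDiffer a) ≤ 1 := measureReal_le_one
  have h4 : 0 ≤ P.real (FluxDiffer (a + M * n)) := measureReal_nonneg
  have h5 := min_le_right (δ / 2) 1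
  linarith

/-! ### From rare discrepancies to equal laws -/

lemma le_of_differ_le {ν ν' : Measure Config} {π : Measure (Config × Config)}
    [IsProbabilityMeasure π]
    (h1 : π.map Prod.fst = ν) (h2 : π.map Prod.snd = ν') {δ : ℝ}
    (hδ : ∀ x, π.real (Differ x) ≤ δ) (F : Finset ℤ) {S : Set (F → Bool)} (hS : MeasurableSet S) :
    |(ν.map F.restrict).real S - (ν'.map F.restrict).real S| ≤ F.card * δ := by
  classical
  have hr : Measurable (F.restrict : Config → F → Bool) := Finset.measurable_restrict F
  have e1 : (ν.map F.restrict).real S = π.real (Prod.fst ⁻¹' (F.restrict ⁻¹' S)) := by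
    rw [← h1, measureReal_def, Measure.map_apply hr hS, Measure.map_apply measurable_fst (hr hS)]
    rfl
  have e2 : (ν'.map F.restrict).real S = π.real (Prod.snd ⁻¹' (F.restrict ⁻¹' S)) := by
    rw [← h2, measureReal_def, Measure.map_apply hr hS, Measure.map_apply measurable_snd (hr hS)]
    rfl
  have hU : π.real (⋃ x ∈ F, Differ x) ≤ F.card * δ := by
    refine (measureReal_biUnion_finset_le _ _).trans ?_
    rw [← nsmul_eq_mul]
    exact Finset.sum_le_card_nsmul _ _ _ fun x _ => hδ x
  have heq : ∀ e : Config × Config, e ∉ ⋃ x ∈ F, Differ x →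
      F.restrict e.1 = F.restrict e.2 := by
    intro e he
    simp only [Set.mem_iUnion, not_exists] at he
    funext x
    have := he x x.2
    simpa [Differ] using this
  have i1 : (Prod.fst ⁻¹' (F.restrict ⁻¹' S) : Set (Config × Config)) ⊆
      Prod.snd ⁻¹' (F.restrict ⁻¹' S) ∪ ⋃ x ∈ F, Differ x := by
    intro e he
    by_cases hu : e ∈ ⋃ x ∈ F, Differ x
    · exact Or.inr hu
    · left
      simp only [Set.mem_preimage] at he ⊢
      rwa [← heq e hu]
  have i2 : (Prod.snd ⁻¹' (F.restrict ⁻¹' S) : Set (Config × Config)) ⊆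
      Prod.fst ⁻¹' (F.restrict ⁻¹' S) ∪ ⋃ x ∈ F, Differ x := by
    intro e he
    by_cases hu : e ∈ ⋃ x ∈ F, Differ x
    · exact Or.inr hu
    · left
      simp only [Set.mem_preimage] at he ⊢
      rwa [heq e hu]
  have j1 := (measureReal_mono i1 (measure_ne_top π _)).trans (measureReal_union_le _ _)
  have j2 := (measureReal_mono i2 (measure_ne_top π _)).trans (measureReal_union_le _ _)
  rw [e1, e2, abs_le]
  constructor <;> linarith

/-- By `differ_le`, rare flux discrepancies mean rare vertical ones. The multiple `L * K` of `K` is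
taken so large that `s` satisfies the window condition of `fluxDiffer_lt`; the finite-dimensional
marginals then agree. -/
theorem CoinBound.eq_of_couplings (hm : CoinBound b₁ b₂ m) {ν ν' : Measure Config}
    [IsProbabilityMeasure ν] [IsProbabilityMeasure ν'] {s : ℕ → ℝ}
    (hs : Tendsto (fun n : ℕ => s n / n) atTop (𝓝 0))
    (h : ∀ ε > 0, ∃ π : Measure (Config × Config), IsProbabilityMeasure π ∧
      π.map Prod.fst = ν ∧ π.map Prod.snd = ν' ∧ AlmostStationary b₁ b₂ ε π ∧
      ∀ (n : ℕ) (a : ℤ),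
        ∫ e, |∑ x ∈ Finset.Ioc a (a + n), (gap e.1 e.2 x : ℝ)| ∂π ≤ s n) :
    ν = ν' := by
  have key : ∀ δ > 0, ∃ π : Measure (Config × Config), IsProbabilityMeasure π ∧
      π.map Prod.fst = ν ∧ π.map Prod.snd = ν' ∧ ∀ x, π.real (Differ x) ≤ δ := by
    intro δ hδ
    have hm2 : 0 < m ^ 2 := pow_pos hm.1 2
    obtain ⟨K, hK, hKL⟩ := hm.fluxDiffer_lt (show 0 < m ^ 2 * δ by positivity)
    have hKpos : (0 : ℝ) < K := by exact_mod_cast hK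
    have hev := (hs.eventually (gt_mem_nhds (show 0 < m ^ 2 * δ / 8 / K by positivity))).and
      (eventually_gt_atTop 0)
    obtain ⟨N, hN⟩ := eventually_atTop.1 hev
    have hL : 0 < N + 1 := Nat.succ_pos N
    obtain ⟨ε, hε, hπ⟩ := hKL (N + 1) hL
    obtain ⟨π, hp, h1, h2, h3, h4⟩ := h ε hε
    refine ⟨π, hp, h1, h2, fun x => ?_⟩
    have h5 := hπ π h3 (fun a => ?_) x
    · have h6 := hm.differ_le π x
      exact le_of_mul_le_mul_left (h6.trans h5.le) hm2
    · refine (h4 _ a).trans ?_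
      obtain ⟨h7, h8⟩ := hN ((N + 1) * K) (by nlinarith)
      rw [div_lt_iff₀ (by exact_mod_cast h8)] at h7
      refine h7.le.trans (le_of_eq ?_)
      push_cast
      field_simp
  have hproj : ∀ F : Finset ℤ, ν.map F.restrict = ν'.map F.restrict := by
    intro F
    have hr : Measurable (F.restrict : Config → F → Bool) := Finset.measurable_restrict F
    have := Measure.isProbabilityMeasure_map (μ := ν) hr.aemeasurable
    have := Measure.isProbabilityMeasure_map (μ := ν') hr.aemeasurable
    ext S hS
    rw [← measureReal_eq_measureReal_iff]
    by_contra hne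
    have hpos : 0 < |(ν.map F.restrict).real S - (ν'.map F.restrict).real S| :=
      abs_pos.2 (sub_ne_zero.2 hne)
    set c := |(ν.map F.restrict).real S - (ν'.map F.restrict).real S|
    obtain ⟨π, hp, h1, h2, h3⟩ := key (c / (F.card + 1)) (by positivity)
    have h4 := le_of_differ_le h1 h2 h3 F hS
    have h5 : (F.card : ℝ) * (c / (F.card + 1)) < c := by
      rw [mul_div_assoc', div_lt_iff₀ (by positivity)]
      nlinarith
    exact absurd h4 (not_le.2 h5)
  have l1 : IsProjectiveLimit ν fun F : Finset ℤ => ν'.map F.restrict := hproj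
  have l2 : IsProjectiveLimit ν' fun F : Finset ℤ => ν'.map F.restrict := fun F => rfl
  exact l1.unique l2

/-! ### Time averages -/

lemma pairStep_apply (b₁ b₂ : I) (π : Measure (Config × Config)) [SFinite π]
    {s : Set (Config × Config)} (hs : MeasurableSet s) :
    pairStep b₁ b₂ π s = ∫⁻ e, coins b₁ b₂ (Prod.mk e ⁻¹' (pairUpdate ⁻¹' s)) ∂π := by
  rw [pairStep, Measure.map_apply measurable_pairUpdate hs,
    Measure.prod_apply (measurable_pairUpdate hs)]

/-- The average of the first `T` laws along the coupled dynamics. -/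
noncomputable def timeAverage (b₁ b₂ : I) (π : Measure (Config × Config)) (T : ℕ) :
    Measure (Config × Config) :=
  (T : ENNReal)⁻¹ • ∑ t ∈ Finset.range T, (pairStep b₁ b₂)^[t] π

instance (b₁ b₂ : I) (π : Measure (Config × Config)) [IsProbabilityMeasure π] (t : ℕ) :
    IsProbabilityMeasure ((pairStep b₁ b₂)^[t] π) := by
  induction t with
  | zero => simpa
  | succ t ih => rw [Function.iterate_succ_apply']; infer_instance

section TimeAverage

variable (π : Measure (Config × Config)) [IsProbabilityMeasure π] {T : ℕ} (hT : 0 < T)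

omit [IsProbabilityMeasure π] in
lemma timeAverage_apply (s : Set (Config × Config)) :
    timeAverage b₁ b₂ π T s = (T : ENNReal)⁻¹ * ∑ t ∈ Finset.range T, (pairStep b₁ b₂)^[t] π s := by
  simp [timeAverage]

omit [IsProbabilityMeasure π] in
include hT in
lemma timeAverage_apply_of_forall {s : Set (Config × Config)} {c : ENNReal}
    (h : ∀ t, (pairStep b₁ b₂)^[t] π s = c) : timeAverage b₁ b₂ π T s = c := by
  rw [timeAverage_apply]
  simp only [h, Finset.sum_const, Finset.card_range, nsmul_eq_mul]
  rw [← mul_assoc, ENNReal.inv_mul_cancel (by exact_mod_cast hT.ne') (by simp), one_mul]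

include hT in
lemma isProbabilityMeasure_timeAverage : IsProbabilityMeasure (timeAverage b₁ b₂ π T) :=
  ⟨timeAverage_apply_of_forall π hT fun _ => measure_univ⟩

lemma timeAverage_real (s : Set (Config × Config)) :
    (timeAverage b₁ b₂ π T).real s =
      (T : ℝ)⁻¹ * ∑ t ∈ Finset.range T, ((pairStep b₁ b₂)^[t] π).real s := by
  rw [measureReal_def, timeAverage_apply, ENNReal.toReal_mul, ENNReal.toReal_sum (by simp)]
  simp [measureReal_def]

include hT in
lemma pairStep_timeAverage_real {s : Set (Config × Config)} (hs : MeasurableSet s) :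
    (pairStep b₁ b₂ (timeAverage b₁ b₂ π T)).real s =
      (T : ℝ)⁻¹ * ∑ t ∈ Finset.range T, ((pairStep b₁ b₂)^[t + 1] π).real s := by
  have := isProbabilityMeasure_timeAverage (b₁ := b₁) (b₂ := b₂) π hT
  rw [measureReal_def, pairStep_apply _ _ _ hs, timeAverage, lintegral_smul_measure,
    lintegral_finsetSum_measure, smul_eq_mul, ENNReal.toReal_mul]
  simp only [← pairStep_apply _ _ _ hs, ← Function.iterate_succ_apply']
  rw [ENNReal.toReal_sum (by simp)]
  simp [measureReal_def]

-- The averages before and after a step differ by the first and the last of `T + 1` probabilities,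
-- divided by `T`.
include hT in
lemma almostStationary_timeAverage : AlmostStationary b₁ b₂ (T : ℝ)⁻¹ (timeAverage b₁ b₂ π T) := by
  intro x
  rw [timeAverage_real π, pairStep_timeAverage_real π hT (measurableSet_differ x)]
  have h := Finset.sum_range_sub' (fun t => ((pairStep b₁ b₂)^[t] π).real (Differ x)) T
  rw [Finset.sum_sub_distrib] at h
  have h1 : ((pairStep b₁ b₂)^[0] π).real (Differ x) ≤ 1 := measureReal_le_one
  have h2 : 0 ≤ ((pairStep b₁ b₂)^[T] π).real (Differ x) := measureReal_nonneg
  have hTpos : (0 : ℝ) < (T : ℝ)⁻¹ := by positivity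
  nlinarith

omit [IsProbabilityMeasure π] in
include hT in
lemma integral_timeAverage_le {f : Config × Config → ℝ} {c : ℝ}
    (hf : ∀ t, Integrable f ((pairStep b₁ b₂)^[t] π))
    (h : ∀ t, ∫ e, f e ∂((pairStep b₁ b₂)^[t] π) ≤ c) :
    ∫ e, f e ∂(timeAverage b₁ b₂ π T) ≤ c := by
  have hTpos : (0 : ℝ) < T := by exact_mod_cast hT
  rw [timeAverage, integral_smul_measure, integral_finsetSum_measure fun t _ => hf t]
  simp only [ENNReal.toReal_inv, ENNReal.toReal_natCast, smul_eq_mul]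
  rw [inv_mul_le_iff₀ hTpos]
  refine (Finset.sum_le_card_nsmul _ _ _ fun t _ => h t).trans ?_
  simp

end TimeAverage

lemma pairStep_iterate_map (hb₂ : b₂ < 1) {ν ν' : Measure Config}
    (hν : (kernel b₁ b₂).Invariant ν) (hν' : (kernel b₁ b₂).Invariant ν')
    (π : Measure (Config × Config)) [IsProbabilityMeasure π]
    (h1 : π.map Prod.fst = ν) (h2 : π.map Prod.snd = ν') (t : ℕ) :
    ((pairStep b₁ b₂)^[t] π).map Prod.fst = ν ∧ ((pairStep b₁ b₂)^[t] π).map Prod.snd = ν' := by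
  induction t with
  | zero => exact ⟨h1, h2⟩
  | succ t ih =>
    rw [Function.iterate_succ_apply', pairStep_map_fst _ _ hb₂, pairStep_map_snd _ _ hb₂, ih.1, ih.2]
    exact ⟨hν, hν'⟩

/-- Two stationary distributions coincide if they have a coupling for which the differences of the
numbers of particles in windows are on average small at all times. -/
theorem CoinBound.eq_of_invariant (hm : CoinBound b₁ b₂ m) {ν ν' : Measure Config}
    [IsProbabilityMeasure ν] [IsProbabilityMeasure ν'] (hν : (kernel b₁ b₂).Invariant ν)
    (hν' : (kernel b₁ b₂).Invariant ν') (π : Measure (Config × Config)) [IsProbabilityMeasure π]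
    (h1 : π.map Prod.fst = ν) (h2 : π.map Prod.snd = ν') {s : ℕ → ℝ}
    (hs : Tendsto (fun n : ℕ => s n / n) atTop (𝓝 0))
    (h : ∀ (t n : ℕ) (a : ℤ), ∫ e, |∑ x ∈ Finset.Ioc a (a + n), (gap e.1 e.2 x : ℝ)|
      ∂((pairStep b₁ b₂)^[t] π) ≤ s n) :
    ν = ν' := by
  have hb₂ : b₂ < 1 := by
    have : (b₂ : ℝ) < 1 := by have := hm.1; have := hm.2.2.2.2.2; linarith
    exact_mod_cast this
  refine hm.eq_of_couplings hs fun ε hε => ?_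
  obtain ⟨T, hT⟩ := exists_nat_gt ε⁻¹
  have hT0 : 0 < T := by
    have : (0 : ℝ) < T := lt_trans (by positivity) hT
    exact_mod_cast this
  have hmap := pairStep_iterate_map hb₂ hν hν' π h1 h2
  refine ⟨timeAverage b₁ b₂ π T, isProbabilityMeasure_timeAverage π hT0, ?_, ?_, ?_, ?_⟩
  · ext S hS
    rw [Measure.map_apply measurable_fst hS]
    refine timeAverage_apply_of_forall π hT0 fun t => ?_
    rw [← Measure.map_apply measurable_fst hS, (hmap t).1]
  · ext S hS
    rw [Measure.map_apply measurable_snd hS]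
    refine timeAverage_apply_of_forall π hT0 fun t => ?_
    rw [← Measure.map_apply measurable_snd hS, (hmap t).2]
  · intro x
    have h3 := almostStationary_timeAverage (b₁ := b₁) (b₂ := b₂) π hT0 x
    have h4 : (T : ℝ)⁻¹ ≤ ε := inv_le_of_inv_le₀ hε hT.le
    linarith
  · intro n a
    exact integral_timeAverage_le π hT0
      (fun t => (integrable_finsetSum _ fun x _ => integrable_gap _ x).abs) fun t => h t n a

end S6V

namespace S6V
open MeasureTheory ProbabilityTheory unitInterval Filter Topology

/-! ### Shifts -/

@[simp] lemma shift_apply (n : ℤ) (η : Config) (x : ℤ) : shift n η x = η (x + n) := rfl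

lemma measurable_shift (n : ℤ) : Measurable (shift n) :=
  measurable_pi_lambda _ fun x => by simp only [shift_apply]; fun_prop

lemma flux_shift (n : ℤ) (η c : ℤ → Bool) (x : ℤ) :
    flux (shift n η) (shift n c) x = flux η c (x + n) := by
  have h : Flows (shift n η) (shift n c) x ↔ Flows η c (x + n) := by
    constructor
    · rintro ⟨y, hy, h1, h2, h3⟩
      refine ⟨y + n, by omega, h1, h2, fun w hw hw' => ?_⟩
      simpa using h3 (w - n) (by omega) (by omega)
    · rintro ⟨y, hy, h1, h2, h3⟩
      refine ⟨y - n, by omega, by simpa using h1, by simpa using h2, fun w hw hw' => ?_⟩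
      simpa using h3 (w + n) (by omega) (by omega)
  rw [Bool.eq_iff_iff]
  simpa [flux] using h

lemma sweep_shift (n : ℤ) (η c : ℤ → Bool) :
    sweep (shift n η) (shift n c) = shift n (sweep η c) := by
  funext x
  simp only [sweep_eq, shift_apply, flux_shift]
  rw [show x - 1 + n = x + n - 1 by ring]

lemma bitLaw_shift (b₁ b₂ : I) (n : ℤ) (η : Config) :
    bitLaw b₁ b₂ (shift n η) = (bitLaw b₁ b₂ η).map (shift n) := by
  have h := Measure.map_infinitePi_infinitePi_of_inj (f := fun x : ℤ => x + n)
    (add_left_injective n) (P := fun x : ℤ => bernoulliMeasure true false (cond (η x) b₁ b₂))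
  exact h.symm

lemma kernel_shift (b₁ b₂ : I) (hb₂ : b₂ < 1) (n : ℤ) (η : Config) :
    kernel b₁ b₂ (shift n η) = (kernel b₁ b₂ η).map (shift n) := by
  have h1 : ∀ ζ, Measurable (sweep ζ) := fun ζ => measurable_sweep.comp measurable_prodMk_left
  rw [kernel_eq_map_sweep _ _ hb₂, kernel_eq_map_sweep _ _ hb₂, bitLaw_shift,
    Measure.map_map (h1 _) (measurable_shift n), Measure.map_map (measurable_shift n) (h1 _)]
  congr 1
  funext c
  exact sweep_shift n η c

lemma invariant_map_shift {b₁ b₂ : I} (hb₂ : b₂ < 1) {ν : Measure Config}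
    (hν : (kernel b₁ b₂).Invariant ν) (n : ℤ) : (kernel b₁ b₂).Invariant (ν.map (shift n)) := by
  change (ν.map (shift n)).bind (kernel b₁ b₂) = ν.map (shift n)
  conv_rhs => rw [← (hν : ν.bind (kernel b₁ b₂) = ν)]
  ext s hs
  rw [Measure.bind_apply hs (kernel b₁ b₂).measurable.aemeasurable,
    lintegral_map ((kernel b₁ b₂).measurable_coe hs) (measurable_shift n),
    Measure.map_apply (measurable_shift n) hs,
    Measure.bind_apply (measurable_shift n hs) (kernel b₁ b₂).measurable.aemeasurable]
  refine lintegral_congr fun η => ?_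
  rw [kernel_shift _ _ hb₂, Measure.map_apply (measurable_shift n) hs]

/-! ### The current -/

/-- The bits seen by a configuration that reads the coins at their own sites. -/
def ownBits (q : Config × (ℤ × Bool → Bool)) : ℤ → Bool := bits q.2 id q.1

lemma measurable_ownBits : Measurable ownBits := by
  refine measurable_pi_lambda _ fun x => ?_
  have h1 : Measurable fun q : Config × (ℤ × Bool → Bool) =>
      (q.1 x, q.2 (x, true), q.2 (x, false)) := by fun_prop
  have h2 := (measurable_of_countable fun r : Bool × Bool × Bool => cond r.1 r.2.1 r.2.2).comp h1
  have h3 : (fun q : Config × (ℤ × Bool → Bool) => ownBits q x) =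
      (fun r : Bool × Bool × Bool => cond r.1 r.2.1 r.2.2) ∘
        fun q => (q.1 x, q.2 (x, true), q.2 (x, false)) := by
    funext q
    simp only [Function.comp, ownBits, bits, id]
    cases q.1 x <;> rfl
  rw [h3]; exact h2

/-- The probability that a particle crosses the edge `(x, x + 1)` in a step. -/
noncomputable def current (b₁ b₂ : I) (ν : Measure Config) (x : ℤ) : ENNReal :=
  ν.prod (coins b₁ b₂) {q | flux q.1 (ownBits q) x = true}

lemma measurableSet_ownFlux (x : ℤ) :
    MeasurableSet {q : Config × (ℤ × Bool → Bool) | flux q.1 (ownBits q) x = true} :=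
  measurableSet_eq_fun ((measurable_flux x).comp (measurable_fst.prodMk measurable_ownBits))
    measurable_const

lemma coins_map_ownBits (b₁ b₂ : I) (η : Config) :
    (coins b₁ b₂).map (fun ω => ownBits (η, ω)) = bitLaw b₁ b₂ η :=
  coins_map_bits b₁ b₂ id η fun _ _ h => (Prod.mk.inj h).1

lemma coins_flux_eq (b₁ b₂ : I) (η : Config) (p : ℤ → ℤ)
    (hp : Function.Injective fun x => (p x, η x)) (x : ℤ) :
    coins b₁ b₂ {ω | flux η (bits ω p η) x = true} =
      coins b₁ b₂ {ω | flux η (ownBits (η, ω)) x = true} := by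
  have hs : MeasurableSet {c : ℤ → Bool | flux η c x = true} :=
    measurableSet_eq_fun ((measurable_flux x).comp measurable_prodMk_left) measurable_const
  have h1 := congrArg (fun μ => μ {c : ℤ → Bool | flux η c x = true}) (coins_map_bits b₁ b₂ p η hp)
  have h2 := congrArg (fun μ => μ {c : ℤ → Bool | flux η c x = true}) (coins_map_ownBits b₁ b₂ η)
  have hm : Measurable fun ω => ownBits (η, ω) := measurable_ownBits.comp measurable_prodMk_left
  beta_reduce at h1 h2
  rw [Measure.map_apply (measurable_pi_lambda _ fun x => by unfold bits; fun_prop) hs] at h1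
  rw [Measure.map_apply hm hs] at h2
  exact h1.trans h2.symm

lemma prod_flux₁ (b₁ b₂ : I) (π : Measure (Config × Config)) [IsProbabilityMeasure π] (x : ℤ) :
    π.prod (coins b₁ b₂) {q | flux₁ q.1.1 q.1.2 q.2 x = true} =
      current b₁ b₂ (π.map Prod.fst) x := by
  rw [current, Measure.prod_apply (measurableSet_eq_fun (measurable_flux₁ x) measurable_const),
    Measure.prod_apply (measurableSet_ownFlux x),
    lintegral_map (measurable_measure_prodMk_left (measurableSet_ownFlux x)) measurable_fst]
  exact lintegral_congr fun e => coins_flux_eq b₁ b₂ e.1 _ (injective_partner_left e.1 e.2) x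

lemma prod_flux₂ (b₁ b₂ : I) (π : Measure (Config × Config)) [IsProbabilityMeasure π] (x : ℤ) :
    π.prod (coins b₁ b₂) {q | flux₂ q.1.1 q.1.2 q.2 x = true} =
      current b₁ b₂ (π.map Prod.snd) x := by
  rw [current, Measure.prod_apply (measurableSet_eq_fun (measurable_flux₂ x) measurable_const),
    Measure.prod_apply (measurableSet_ownFlux x),
    lintegral_map (measurable_measure_prodMk_left (measurableSet_ownFlux x)) measurable_snd]
  exact lintegral_congr fun e => coins_flux_eq b₁ b₂ e.2 _ (injective_partner_right e.1 e.2) x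

lemma prod_map_sweep (b₁ b₂ : I) (hb₂ : b₂ < 1) (ν : Measure Config) :
    (ν.prod (coins b₁ b₂)).map (fun q => sweep q.1 (ownBits q)) = ν.bind (kernel b₁ b₂) := by
  have hm : Measurable fun q : Config × (ℤ × Bool → Bool) => sweep q.1 (ownBits q) :=
    measurable_sweep.comp (measurable_fst.prodMk measurable_ownBits)
  ext s hs
  rw [Measure.map_apply hm hs, Measure.prod_apply (hm hs),
    Measure.bind_apply hs (kernel b₁ b₂).measurable.aemeasurable]
  refine lintegral_congr fun η => ?_
  have h1 : Measurable (sweep η) := measurable_sweep.comp measurable_prodMk_left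
  have h2 : Measurable fun ω => ownBits (η, ω) := measurable_ownBits.comp measurable_prodMk_left
  rw [kernel_eq_map_sweep b₁ b₂ hb₂, ← coins_map_ownBits, Measure.map_map h1 h2,
    Measure.map_apply (h1.comp h2) hs]
  rfl

/-- Stationarity keeps the occupation probability of `x`, so conservation of paths there equates the
incoming and outgoing currents. -/
lemma current_eq_sub_one {b₁ b₂ : I} (hb₂ : b₂ < 1) {ν : Measure Config} [IsProbabilityMeasure ν]
    (hν : (kernel b₁ b₂).Invariant ν) (x : ℤ) :
    current b₁ b₂ ν x = current b₁ b₂ ν (x - 1) := by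
  classical
  set P := ν.prod (coins b₁ b₂) with hP
  have hm : Measurable fun q : Config × (ℤ × Bool → Bool) => sweep q.1 (ownBits q) :=
    measurable_sweep.comp (measurable_fst.prodMk measurable_ownBits)
  have hs : MeasurableSet {η : Config | η x = true} :=
    measurableSet_eq_fun (by fun_prop) measurable_const
  have e1 : P {q | sweep q.1 (ownBits q) x = true} = ν {η | η x = true} := by
    conv_rhs => rw [← (hν : ν.bind (kernel b₁ b₂) = ν), ← prod_map_sweep b₁ b₂ hb₂ ν]
    rw [Measure.map_apply hm hs]
    rfl
  have e2 : P {q | q.1 x = true} = ν {η | η x = true} := by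
    have : ν = P.map Prod.fst := by simp [hP]
    conv_rhs => rw [this, Measure.map_apply measurable_fst hs]
    rfl
  have hbal : P {q | sweep q.1 (ownBits q) x = true} + P {q | flux q.1 (ownBits q) x = true} =
      P {q | q.1 x = true} + P {q | flux q.1 (ownBits q) (x - 1) = true} := by
    have m1 : MeasurableSet {q : Config × (ℤ × Bool → Bool) | sweep q.1 (ownBits q) x = true} :=
      hm hs
    have m2 : MeasurableSet {q : Config × (ℤ × Bool → Bool) | q.1 x = true} := measurable_fst hs
    have m3 := measurableSet_ownFlux x
    have m4 := measurableSet_ownFlux (x - 1)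
    rw [← lintegral_indicator_one m1, ← lintegral_indicator_one m2, ← lintegral_indicator_one m3,
      ← lintegral_indicator_one m4, ← lintegral_add_left (measurable_one.indicator m1),
      ← lintegral_add_left (measurable_one.indicator m2)]
    refine lintegral_congr fun q => ?_
    have h := sweep_add_flux q.1 (ownBits q) x
    simp only [Set.indicator_apply, Set.mem_ofPred_eq, Pi.one_apply]
    revert h
    generalize sweep q.1 (ownBits q) x = s
    generalize flux q.1 (ownBits q) x = f
    generalize flux q.1 (ownBits q) (x - 1) = f'
    generalize q.1 x = v
    cases s <;> cases f <;> cases f' <;> cases v <;> simp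
  rw [e1, e2] at hbal
  exact (ENNReal.add_right_inj (measure_ne_top ν _)).1 hbal

lemma current_map_shift (b₁ b₂ : I) (ν : Measure Config) [IsProbabilityMeasure ν] (n x : ℤ) :
    current b₁ b₂ (ν.map (shift n)) x = current b₁ b₂ ν (x + n) := by
  have hinj : Function.Injective fun i : ℤ × Bool => (i.1 + n, i.2) := by
    rintro ⟨a, b⟩ ⟨a', b'⟩ h
    simp only [Prod.mk.injEq] at h
    ext
    · simp; omega
    · simp [h.2]
  have hc : (coins b₁ b₂).map (fun ω i => ω (i.1 + n, i.2)) = coins b₁ b₂ :=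
    Measure.map_infinitePi_infinitePi_of_inj hinj
      (P := fun i : ℤ × Bool => bernoulliMeasure true false (cond i.2 b₁ b₂))
  have hm : Measurable fun (ω : ℤ × Bool → Bool) (i : ℤ × Bool) => ω (i.1 + n, i.2) := by fun_prop
  have h := Measure.map_prod_map ν (coins b₁ b₂) (measurable_shift n) hm
  rw [hc] at h
  rw [current, h, Measure.map_apply ((measurable_shift n).prodMap hm) (measurableSet_ownFlux x),
    current]
  congr 1
  ext q
  simp only [Set.mem_preimage, Set.mem_ofPred_eq]
  rw [← flux_shift n q.1 (ownBits q) x]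
  rfl

/-! ### The depth of the height function -/

/-- The depth of the height function of a pair below `0`. -/
noncomputable def depth (e : Config × Config) : ENNReal :=
  ⨆ x : ℤ, ENNReal.ofReal (-(height e.1 e.2 x : ℝ))

lemma measurable_height_real (x : ℤ) :
    Measurable fun e : Config × Config => (height e.1 e.2 x : ℝ) :=
  (measurable_of_countable fun k : ℤ => (k : ℝ)).comp (measurable_height x)

lemma measurable_depth : Measurable depth :=
  Measurable.iSup fun x => ENNReal.measurable_ofReal.comp (measurable_height_real x).neg

lemma neg_height_le_depth {e : Config × Config} (h : depth e ≠ ⊤) (x : ℤ) :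
    -(height e.1 e.2 x : ℝ) ≤ (depth e).toReal := by
  have h1 : ENNReal.ofReal (-(height e.1 e.2 x : ℝ)) ≤ depth e :=
    le_iSup (fun x : ℤ => ENNReal.ofReal (-(height e.1 e.2 x : ℝ))) x
  exact (ENNReal.ofReal_le_iff_le_toReal h).1 h1

lemma height_zero (η ξ : Config) : height η ξ 0 = 0 := by simp [height]

lemma eq_height_of_increments {η ξ : Config} {f : ℤ → ℤ} (h0 : f 0 = 0)
    (h : ∀ x, f x = f (x - 1) + gap η ξ x) (x : ℤ) : f x = height η ξ x := by
  induction x using Int.induction_on with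
  | zero => rw [h0, height_zero]
  | succ n ih => rw [h, height_eq]; simp only [add_sub_cancel_right]; rw [ih]
  | pred n ih =>
    have h1 := h (-n)
    have h2 := height_eq η ξ (-n)
    omega

/-- A step subtracts the flux difference; the last term restores the normalisation `height 0 = 0`.
-/
lemma height_pairUpdate (q : (Config × Config) × (ℤ × Bool → Bool)) (x : ℤ) :
    height (pairUpdate q).1 (pairUpdate q).2 x = height q.1.1 q.1.2 x -
        ((flux₁ q.1.1 q.1.2 q.2 x).toInt - (flux₂ q.1.1 q.1.2 q.2 x).toInt) +
      ((flux₁ q.1.1 q.1.2 q.2 0).toInt - (flux₂ q.1.1 q.1.2 q.2 0).toInt) := by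
  symm
  refine eq_height_of_increments (f := fun x => height q.1.1 q.1.2 x -
        ((flux₁ q.1.1 q.1.2 q.2 x).toInt - (flux₂ q.1.1 q.1.2 q.2 x).toInt) +
      ((flux₁ q.1.1 q.1.2 q.2 0).toInt - (flux₂ q.1.1 q.1.2 q.2 0).toInt))
    (by simp [height_zero]) (fun x => ?_) x
  have h1 := height_eq q.1.1 q.1.2 x
  have h2 := sweep_add_flux q.1.1 (bits q.2 (partner q.1.1 q.1.2) q.1.1) x
  have h3 := sweep_add_flux q.1.2 (bits q.2 (partner q.1.1 q.1.2) q.1.2) x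
  simp only [gap, pairUpdate, flux₁, flux₂] at *
  omega

/-- `height_sub_flux_nonneg` keeps the lower bound of the height, and the recentring at `0` moves it
by the net flux there. Heights are integers, so the level `k` may be the floor of the depth. -/
lemma depth_pairUpdate_add_le (q : (Config × Config) × (ℤ × Bool → Bool)) :
    depth (pairUpdate q) + (if flux₁ q.1.1 q.1.2 q.2 0 = true then 1 else 0) ≤
      depth q.1 + (if flux₂ q.1.1 q.1.2 q.2 0 = true then 1 else 0) := by
  by_cases htop : depth q.1 = ⊤
  · simp [htop]
  set r := (depth q.1).toReal with hr
  set k : ℤ := ⌊r⌋ with hk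
  have hkr : (k : ℝ) ≤ r := Int.floor_le r
  have hnn : ∀ x, 0 ≤ height q.1.1 q.1.2 x + k := by
    intro x
    have h1 : (-(height q.1.1 q.1.2 x) : ℤ) ≤ k := by
      rw [hk, Int.le_floor]
      push_cast
      exact neg_height_le_depth htop x
    omega
  have hH := height_sub_flux_nonneg q.1.1 q.1.2 q.2 k hnn
  set f₁ : ℤ := (flux₁ q.1.1 q.1.2 q.2 0).toInt with hf₁
  set f₂ : ℤ := (flux₂ q.1.1 q.1.2 q.2 0).toInt with hf₂
  have hle : ∀ x, -(height (pairUpdate q).1 (pairUpdate q).2 x) ≤ k - (f₁ - f₂) := by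
    intro x
    have := hH x
    rw [height_pairUpdate]
    omega
  have h0 : 0 ≤ k - (f₁ - f₂) := by simpa [height_zero] using hle 0
  have hd : depth (pairUpdate q) ≤ ENNReal.ofReal ((k - (f₁ - f₂) : ℤ) : ℝ) := by
    refine iSup_le fun x => ENNReal.ofReal_le_ofReal ?_
    exact_mod_cast hle x
  have e1 : (if flux₁ q.1.1 q.1.2 q.2 0 = true then 1 else 0 : ENNReal) =
      ENNReal.ofReal (f₁ : ℝ) := by
    rw [hf₁]; cases flux₁ q.1.1 q.1.2 q.2 0 <;> simp
  have e2 : (if flux₂ q.1.1 q.1.2 q.2 0 = true then 1 else 0 : ENNReal) =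
      ENNReal.ofReal (f₂ : ℝ) := by
    rw [hf₂]; cases flux₂ q.1.1 q.1.2 q.2 0 <;> simp
  have n1 : (0 : ℝ) ≤ f₁ := by rw [hf₁]; cases flux₁ q.1.1 q.1.2 q.2 0 <;> simp
  have n2 : (0 : ℝ) ≤ f₂ := by rw [hf₂]; cases flux₂ q.1.1 q.1.2 q.2 0 <;> simp
  have n3 : (0 : ℝ) ≤ ((k - (f₁ - f₂) : ℤ) : ℝ) := by exact_mod_cast h0
  rw [e1, e2]
  calc depth (pairUpdate q) + ENNReal.ofReal (f₁ : ℝ)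
      ≤ ENNReal.ofReal ((k - (f₁ - f₂) : ℤ) : ℝ) + ENNReal.ofReal (f₁ : ℝ) := by gcongr
    _ = ENNReal.ofReal ((k : ℝ) + f₂) := by
        rw [← ENNReal.ofReal_add n3 n1]; congr 1; push_cast; ring
    _ ≤ ENNReal.ofReal (r + f₂) := ENNReal.ofReal_le_ofReal (by linarith)
    _ = depth q.1 + ENNReal.ofReal (f₂ : ℝ) := by
        rw [ENNReal.ofReal_add ENNReal.toReal_nonneg n2, ENNReal.ofReal_toReal htop]

/-- With equal currents, the two flux terms of `depth_pairUpdate_add_le` have the same finite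
integral and cancel. -/
lemma lintegral_depth_pairStep_le (b₁ b₂ : I) (π : Measure (Config × Config))
    [IsProbabilityMeasure π]
    (h : current b₁ b₂ (π.map Prod.fst) 0 = current b₁ b₂ (π.map Prod.snd) 0) :
    ∫⁻ e, depth e ∂(pairStep b₁ b₂ π) ≤ ∫⁻ e, depth e ∂π := by
  set P := π.prod (coins b₁ b₂) with hP
  have m1 : MeasurableSet {q : (Config × Config) × (ℤ × Bool → Bool) |
      flux₁ q.1.1 q.1.2 q.2 0 = true} := measurableSet_eq_fun (measurable_flux₁ 0) measurable_const
  have m2 : MeasurableSet {q : (Config × Config) × (ℤ × Bool → Bool) |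
      flux₂ q.1.1 q.1.2 q.2 0 = true} := measurableSet_eq_fun (measurable_flux₂ 0) measurable_const
  rw [← prod_flux₁, ← prod_flux₂] at h
  have hfst : ∫⁻ e, depth e ∂π = ∫⁻ q, depth q.1 ∂P := by
    have : π = P.map Prod.fst := by simp [hP]
    conv_lhs => rw [this]
    rw [lintegral_map measurable_depth measurable_fst]
  rw [pairStep, lintegral_map measurable_depth measurable_pairUpdate, hfst]
  have hne : P {q | flux₁ q.1.1 q.1.2 q.2 0 = true} ≠ ⊤ := measure_ne_top _ _
  rw [← ENNReal.add_le_add_iff_right hne]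
  conv_rhs => rw [h]
  rw [← lintegral_indicator_one m1, ← lintegral_indicator_one m2,
    ← lintegral_add_right _ (measurable_one.indicator m1),
    ← lintegral_add_right _ (measurable_one.indicator m2)]
  refine lintegral_mono fun q => ?_
  simpa [Set.indicator_apply] using depth_pairUpdate_add_le q

lemma integrable_height (π : Measure (Config × Config)) [IsProbabilityMeasure π] (x : ℤ) :
    Integrable (fun e : Config × Config => (height e.1 e.2 x : ℝ)) π := by
  simp only [height, Int.cast_sub, Int.cast_sum]
  exact (integrable_finsetSum _ fun w _ => integrable_gap π w).sub
    (integrable_finsetSum _ fun w _ => integrable_gap π w)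

lemma integral_gap (π : Measure (Config × Config)) [IsProbabilityMeasure π] (x : ℤ) :
    ∫ e, (gap e.1 e.2 x : ℝ) ∂π =
      ∫ η, ((η x).toInt : ℝ) ∂(π.map Prod.fst) - ∫ η, ((η x).toInt : ℝ) ∂(π.map Prod.snd) := by
  have hm : Measurable fun η : Config => ((η x).toInt : ℝ) :=
    (measurable_of_countable fun b : Bool => (b.toInt : ℝ)).comp (measurable_pi_apply x)
  have hb : ∀ b : Bool, ‖(b.toInt : ℝ)‖ ≤ 1 := by intro b; cases b <;> simp
  rw [integral_map measurable_fst.aemeasurable hm.aestronglyMeasurable,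
    integral_map measurable_snd.aemeasurable hm.aestronglyMeasurable, ← integral_sub]
  · simp [gap]
  · exact Integrable.of_bound (hm.comp measurable_fst).aestronglyMeasurable 1
      (ae_of_all _ fun e => hb _)
  · exact Integrable.of_bound (hm.comp measurable_snd).aestronglyMeasurable 1
      (ae_of_all _ fun e => hb _)

/-- The height is a sum of one-copy terms, so its mean sees only the marginals; along the coupled
dynamics of stationary laws it is constant. -/
lemma integral_height_congr (π π' : Measure (Config × Config)) [IsProbabilityMeasure π]
    [IsProbabilityMeasure π'] (h1 : π.map Prod.fst = π'.map Prod.fst)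
    (h2 : π.map Prod.snd = π'.map Prod.snd) (x : ℤ) :
    ∫ e, (height e.1 e.2 x : ℝ) ∂π = ∫ e, (height e.1 e.2 x : ℝ) ∂π' := by
  simp only [height, Int.cast_sub, Int.cast_sum]
  have hi : ∀ (μ : Measure (Config × Config)) [IsProbabilityMeasure μ] (s : Finset ℤ),
      Integrable (fun e : Config × Config => ∑ w ∈ s, (gap e.1 e.2 w : ℝ)) μ := fun μ _ s =>
    integrable_finsetSum _ fun w _ => integrable_gap μ w
  rw [integral_sub (hi π _) (hi π _), integral_sub (hi π' _) (hi π' _),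
    integral_finsetSum _ fun w _ => integrable_gap π w,
    integral_finsetSum _ fun w _ => integrable_gap π w,
    integral_finsetSum _ fun w _ => integrable_gap π' w,
    integral_finsetSum _ fun w _ => integrable_gap π' w]
  simp only [integral_gap, h1, h2]

/-- Adding the depth makes both heights nonnegative, so their difference is at most their sum: four
terms of mean at most `1`. -/
lemma integral_abs_sum_gap_le (π : Measure (Config × Config)) [IsProbabilityMeasure π]
    (hd : ∫⁻ e, depth e ∂π ≤ 1) (hh : ∀ x, ∫ e, (height e.1 e.2 x : ℝ) ∂π ≤ 1) (n : ℕ) (a : ℤ) :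
    ∫ e, |∑ x ∈ Finset.Ioc a (a + n), (gap e.1 e.2 x : ℝ)| ∂π ≤ 4 := by
  have hfin : ∫⁻ e, depth e ∂π ≠ ⊤ := (hd.trans_lt ENNReal.one_lt_top).ne
  have hD : Integrable (fun e => (depth e).toReal) π :=
    integrable_toReal_of_lintegral_ne_top measurable_depth.aemeasurable hfin
  have hae : ∀ᵐ e ∂π, depth e ≠ ⊤ := by
    filter_upwards [ae_lt_top measurable_depth hfin] with e he using he.ne
  have hD1 : ∫ e, (depth e).toReal ∂π ≤ 1 := by
    rw [integral_toReal measurable_depth.aemeasurable (ae_lt_top measurable_depth hfin)]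
    exact ENNReal.toReal_le_of_le_ofReal zero_le_one (by simpa using hd)
  have i1 := integrable_height π (a + n)
  have i2 := integrable_height π a
  calc ∫ e, |∑ x ∈ Finset.Ioc a (a + (n : ℤ)), (gap e.1 e.2 x : ℝ)| ∂π
      ≤ ∫ e, ((height e.1 e.2 (a + n) : ℝ) + (depth e).toReal) +
          ((height e.1 e.2 a : ℝ) + (depth e).toReal) ∂π := by
        refine integral_mono_ae (integrable_finsetSum _ fun x _ => integrable_gap π x).abs
          ((i1.add hD).add (i2.add hD)) ?_
        filter_upwards [hae] with e he
        have h1 := neg_height_le_depth he (a + n)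
        have h2 := neg_height_le_depth he a
        have h3 := sum_gap_eq_height_sub e.1 e.2 (show a ≤ a + n by omega)
        have h4 : ∑ x ∈ Finset.Ioc a (a + (n : ℤ)), (gap e.1 e.2 x : ℝ) =
            height e.1 e.2 (a + n) - height e.1 e.2 a := by exact_mod_cast h3
        simp only [h4]
        rw [abs_le]
        constructor <;> linarith
    _ = (∫ e, (height e.1 e.2 (a + n) : ℝ) ∂π + ∫ e, (depth e).toReal ∂π) +
          (∫ e, (height e.1 e.2 a : ℝ) ∂π + ∫ e, (depth e).toReal ∂π) := by
        rw [← integral_add i1 hD, ← integral_add i2 hD]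
        exact integral_add (i1.add hD) (i2.add hD)
    _ ≤ 4 := by linarith [hh (a + n), hh a]

/-! ### Stationary distributions are translation invariant -/

lemma height_shift_one (η : Config) (x : ℤ) :
    height η (shift 1 η) x = (η 1).toInt - (η (x + 1)).toInt := by
  symm
  refine eq_height_of_increments (f := fun x => (η 1).toInt - (η (x + 1)).toInt) (by simp)
    (fun x => ?_) x
  simp [gap]

/-- Coupling `η` with its own shift makes the height telescope to a difference of two occupations.
Its depth is then at most `1` and stays so in mean, as the shift does not change the current. -/
theorem CoinBound.map_shift_one {b₁ b₂ : I} {m : ℝ} (hm : CoinBound b₁ b₂ m) {ν : Measure Config}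
    [IsProbabilityMeasure ν] (hν : (kernel b₁ b₂).Invariant ν) : ν.map (shift 1) = ν := by
  have hb₂ : b₂ < 1 := by
    have : (b₂ : ℝ) < 1 := by have := hm.1; have := hm.2.2.2.2.2; linarith
    exact_mod_cast this
  have hms : Measurable fun η : Config => (η, shift 1 η) :=
    measurable_id.prodMk (measurable_shift 1)
  set π := ν.map fun η => (η, shift 1 η) with hπ
  have hp : IsProbabilityMeasure π := Measure.isProbabilityMeasure_map hms.aemeasurable
  have hp' : IsProbabilityMeasure (ν.map (shift 1)) :=
    Measure.isProbabilityMeasure_map (measurable_shift 1).aemeasurable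
  have h1 : π.map Prod.fst = ν := by
    rw [hπ, Measure.map_map measurable_fst hms]
    exact Measure.map_id
  have h2 : π.map Prod.snd = ν.map (shift 1) := by
    rw [hπ, Measure.map_map measurable_snd hms]
    rfl
  have hν' := invariant_map_shift hb₂ hν 1
  have hmap := pairStep_iterate_map hb₂ hν hν' π h1 h2
  have hcur : current b₁ b₂ ν 0 = current b₁ b₂ (ν.map (shift 1)) 0 := by
    rw [current_map_shift, current_eq_sub_one hb₂ hν (0 + 1)]
    simp
  have hdepth : ∀ t, ∫⁻ e, depth e ∂((pairStep b₁ b₂)^[t] π) ≤ 1 := by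
    intro t
    induction t with
    | zero =>
      rw [Function.iterate_zero, id, hπ, lintegral_map measurable_depth hms]
      calc ∫⁻ η, depth (η, shift 1 η) ∂ν ≤ ∫⁻ _, 1 ∂ν := by
            refine lintegral_mono fun η => iSup_le fun x => ?_
            have key : ∀ u v : Bool, -(u.toInt - v.toInt) ≤ 1 := by decide
            rw [ENNReal.ofReal_le_one]
            have h := key (η 1) (η (x + 1))
            rw [← height_shift_one] at h
            exact_mod_cast h
        _ = 1 := by simp
    | succ t ih =>
      rw [Function.iterate_succ_apply']
      refine (lintegral_depth_pairStep_le b₁ b₂ _ ?_).trans ih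
      rw [(hmap t).1, (hmap t).2, hcur]
  have hheight : ∀ t x, ∫ e, (height e.1 e.2 x : ℝ) ∂((pairStep b₁ b₂)^[t] π) ≤ 1 := by
    intro t x
    rw [integral_height_congr _ π (by rw [(hmap t).1, h1]) (by rw [(hmap t).2, h2]), hπ,
      integral_map hms.aemeasurable (measurable_height_real x).aestronglyMeasurable]
    have hint : Integrable (fun η => (height η (shift 1 η) x : ℝ)) ν :=
      (integrable_height π x).comp_measurable hms
    calc ∫ η, (height η (shift 1 η) x : ℝ) ∂ν ≤ ∫ _, (1 : ℝ) ∂ν := by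
          refine integral_mono hint (integrable_const 1) fun η => ?_
          simp only [height_shift_one]
          cases η 1 <;> cases η (x + 1) <;> simp
      _ = 1 := by simp
  refine (hm.eq_of_invariant hν hν' π h1 h2 (s := fun _ => 4)
    (tendsto_const_div_atTop_nhds_zero_nat 4) fun t n a => ?_).symm
  exact integral_abs_sum_gap_le _ (hdepth t) (hheight t) n a

lemma shift_shift (m n : ℤ) (η : Config) : shift m (shift n η) = shift (m + n) η := by
  funext x; simp [add_assoc]

theorem CoinBound.map_shift {b₁ b₂ : I} {m : ℝ} (hm : CoinBound b₁ b₂ m) {ν : Measure Config}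
    [IsProbabilityMeasure ν] (hν : (kernel b₁ b₂).Invariant ν) (n : ℤ) : ν.map (shift n) = ν := by
  have h1 := hm.map_shift_one hν
  have hstep : ∀ n, ν.map (shift (n + 1)) = ν.map (shift n) := by
    intro n
    conv_rhs => rw [← h1]
    rw [Measure.map_map (measurable_shift n) (measurable_shift 1)]
    congr 1
    funext η
    exact (shift_shift n 1 η).symm
  have h0 : ν.map (shift 0) = ν := by
    have : shift 0 = id := by funext η x; simp
    rw [this, Measure.map_id]
  induction n using Int.induction_on with
  | zero => exact h0
  | succ n ih => rw [hstep, ih]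
  | pred n ih => rw [← hstep, sub_add_cancel, ih]

end S6V

namespace S6V
open MeasureTheory ProbabilityTheory unitInterval Filter Topology

/-! ### Product Bernoulli measures are stationary -/

instance (ρ : I) : IsProbabilityMeasure (productBernoulli ρ) := by
  unfold productBernoulli; infer_instance

/-- The law of a bit, given whether its site is occupied. -/
noncomputable def bitKernel (b₁ b₂ : I) : Kernel Bool Bool :=
  Kernel.ofFunOfCountable fun v => bernoulliMeasure true false (cond v b₁ b₂)

instance (b₁ b₂ : I) : IsMarkovKernel (bitKernel b₁ b₂) :=
  ⟨fun v => by unfold bitKernel; exact inferInstanceAs (IsProbabilityMeasure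
    (bernoulliMeasure true false (cond v b₁ b₂)))⟩

/-- The joint law of the occupation variable and the bit at a site, at density `ρ`. -/
noncomputable def siteLaw (b₁ b₂ ρ : I) : Measure (Bool × Bool) :=
  (bernoulliMeasure true false ρ).compProd (bitKernel b₁ b₂)

instance (b₁ b₂ ρ : I) : IsProbabilityMeasure (siteLaw b₁ b₂ ρ) := by
  unfold siteLaw; infer_instance

/-- The configuration at density `ρ`, jointly with the bits that drive its update. -/
noncomputable def fieldLaw (b₁ b₂ ρ : I) : Measure (ℤ → Bool × Bool) :=
  Measure.infinitePi fun _ => siteLaw b₁ b₂ ρ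

instance (b₁ b₂ ρ : I) : IsProbabilityMeasure (fieldLaw b₁ b₂ ρ) := by
  unfold fieldLaw; infer_instance

/-- Given `η`, the bit at a site is independent of the others with a law depending on that site
only, so averaging over the product measure factorises. -/
lemma prod_coins_map_eq_fieldLaw (b₁ b₂ ρ : I) :
    ((productBernoulli ρ).prod (coins b₁ b₂)).map (fun q x => (q.1 x, ownBits q x)) =
      fieldLaw b₁ b₂ ρ := by
  have hm : Measurable fun (q : Config × (ℤ × Bool → Bool)) (x : ℤ) => (q.1 x, ownBits q x) :=
    measurable_pi_lambda _ fun x => (by fun_prop : Measurable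
      fun q : Config × (ℤ × Bool → Bool) => q.1 x).prodMk
        ((measurable_pi_apply x).comp measurable_ownBits)
  refine Measure.eq_infinitePi _ fun s t ht => ?_
  have hs : MeasurableSet (Set.pi (s : Set ℤ) t) :=
    MeasurableSet.pi s.countable_toSet fun i _ => ht i
  have hinner : ∀ η : Config, coins b₁ b₂
      {ω | (fun x => (η x, ownBits (η, ω) x)) ∈ Set.pi (s : Set ℤ) t} =
      ∏ i ∈ s, bitKernel b₁ b₂ (η i) (Prod.mk (η i) ⁻¹' t i) := by
    intro η
    have h1 : Measurable fun ω => ownBits (η, ω) := measurable_ownBits.comp measurable_prodMk_left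
    have h2 : ∀ i, MeasurableSet (Prod.mk (η i) ⁻¹' t i) := fun i => measurable_prodMk_left (ht i)
    have h3 := Measure.infinitePi_pi
      (fun x => bernoulliMeasure true false (cond (η x) b₁ b₂)) (s := s) (fun i _ => h2 i)
    change bitLaw b₁ b₂ η _ = _ at h3
    rw [← coins_map_ownBits, Measure.map_apply h1
      (MeasurableSet.pi s.countable_toSet fun i _ => h2 i)] at h3
    exact h3
  have hmeas : ∀ i, Measurable fun v : Bool => bitKernel b₁ b₂ v (Prod.mk v ⁻¹' t i) := fun i =>
    measurable_of_countable _
  have hind := iIndepFun_infinitePi (P := fun _ : ℤ => bernoulliMeasure true false ρ)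
    (X := fun i (v : Bool) => bitKernel b₁ b₂ v (Prod.mk v ⁻¹' t i)) hmeas
  rw [Measure.map_apply hm hs, Measure.prod_apply (hm hs)]
  calc ∫⁻ η, coins b₁ b₂ {ω | (fun x => (η x, ownBits (η, ω) x)) ∈ Set.pi (s : Set ℤ) t}
          ∂(productBernoulli ρ)
      = ∫⁻ η, ∏ i ∈ s, bitKernel b₁ b₂ (η i) (Prod.mk (η i) ⁻¹' t i) ∂(productBernoulli ρ) :=
        lintegral_congr hinner
    _ = ∏ i ∈ s, ∫⁻ η, bitKernel b₁ b₂ (η i) (Prod.mk (η i) ⁻¹' t i) ∂(productBernoulli ρ) :=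
        lintegral_prod_eq_prod_lintegral_of_indepFun s _ hind
          fun i => (hmeas i).comp (measurable_pi_apply i)
    _ = _ := by
        refine Finset.prod_congr rfl fun i _ => ?_
        rw [siteLaw, Measure.compProd_apply (ht i)]
        conv_rhs => rw [← Measure.infinitePi_map_eval (fun _ : ℤ => bernoulliMeasure true false ρ) i]
        rw [lintegral_map (hmeas i) (measurable_pi_apply i)]
        rfl

/-- The probability of the value `v` under the Bernoulli law of parameter `p`. -/
def weight (p : ℝ) (v : Bool) : ℝ := if v then p else 1 - p

lemma bernoulli_real_singleton (p : I) (v : Bool) :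
    (bernoulliMeasure true false p).real {v} = weight p v := by
  cases v
  · rw [measureReal_def, bernoulli_false, ENNReal.toReal_ofReal (by linarith [p.2.2])]
    simp [weight]
  · rw [measureReal_def, bernoulli_true, ENNReal.toReal_ofReal p.2.1]
    simp [weight]

lemma siteLaw_real_singleton (b₁ b₂ ρ : I) (v c : Bool) :
    (siteLaw b₁ b₂ ρ).real {(v, c)} = weight ρ v * weight (cond v b₁ b₂) c := by
  rw [← bernoulli_real_singleton, show ((cond v (b₁ : ℝ) b₂)) = ((cond v b₁ b₂ : I) : ℝ) by
    cases v <;> rfl, ← bernoulli_real_singleton, ← Set.singleton_prod_singleton, measureReal_def,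
    siteLaw, Measure.compProd_apply_prod (measurableSet_singleton _) (measurableSet_singleton _),
    lintegral_singleton, mul_comm, ENNReal.toReal_mul]
  rfl

/-- The occupation variables of a field. -/
def occ (z : ℤ → Bool × Bool) : Config := fun x => (z x).1

/-- The bits of a field. -/
def bit (z : ℤ → Bool × Bool) : ℤ → Bool := fun x => (z x).2

lemma measurable_occ_bit : Measurable fun z : ℤ → Bool × Bool => (occ z, bit z) := by
  refine Measurable.prodMk ?_ ?_ <;> refine measurable_pi_lambda _ fun x => ?_
  · simp only [occ]; fun_prop
  · simp only [bit]; fun_prop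

lemma measurable_fieldFlux (x : ℤ) : Measurable fun z => flux (occ z) (bit z) x :=
  (measurable_flux x).comp measurable_occ_bit

lemma measurable_fieldSweep : Measurable fun z => sweep (occ z) (bit z) :=
  measurable_sweep.comp measurable_occ_bit

lemma fieldLaw_map_sweep (b₁ b₂ ρ : I) (hb₂ : b₂ < 1) :
    (fieldLaw b₁ b₂ ρ).map (fun z => sweep (occ z) (bit z)) =
      (productBernoulli ρ).bind (kernel b₁ b₂) := by
  have hm : Measurable fun (q : Config × (ℤ × Bool → Bool)) (x : ℤ) => (q.1 x, ownBits q x) :=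
    measurable_pi_lambda _ fun x => (by fun_prop : Measurable
      fun q : Config × (ℤ × Bool → Bool) => q.1 x).prodMk
        ((measurable_pi_apply x).comp measurable_ownBits)
  rw [← prod_map_sweep b₁ b₂ hb₂, ← prod_coins_map_eq_fieldLaw,
    Measure.map_map measurable_fieldSweep hm]
  rfl

/-- The σ-algebra generated by the sites up to `x`. -/
abbrev past (x : ℤ) : MeasurableSpace (ℤ → Bool × Bool) :=
  ⨆ i ∈ Set.Iic x, (inferInstance : MeasurableSpace (Bool × Bool)).comap fun z => z i

/-- Such an `f` is unchanged by first overwriting all sites beyond `x`, and this truncation is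
measurable for the past. -/
lemma measurable_past {x : ℤ} {β : Type*} [MeasurableSpace β] {f : (ℤ → Bool × Bool) → β}
    (hf : Measurable f) (h : ∀ z z', (∀ i ≤ x, z i = z' i) → f z = f z') : Measurable[past x] f := by
  have htrunc : Measurable[past x] fun (z : ℤ → Bool × Bool) (i : ℤ) =>
      if i ≤ x then z i else (false, false) := by
    refine @measurable_pi_lambda _ _ _ (past x) _ _ fun i => ?_
    by_cases hi : i ≤ x
    · simp only [hi, if_true]
      exact Measurable.mono (comap_measurable _)
        (le_iSup₂_of_le (f := fun i (_ : i ∈ Set.Iic x) =>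
          (inferInstance : MeasurableSpace (Bool × Bool)).comap fun z : ℤ → Bool × Bool => z i)
          i hi le_rfl) le_rfl
    · simp only [hi, if_false]
      exact @measurable_const _ _ _ (past x) _
  have : f = f ∘ fun (z : ℤ → Bool × Bool) (i : ℤ) => if i ≤ x then z i else (false, false) := by
    funext z
    exact h _ _ fun i hi => by simp [hi]
  rw [this]
  exact hf.comp htrunc

lemma fieldLaw_inter (b₁ b₂ ρ : I) {x : ℤ} {A : Set (ℤ → Bool × Bool)}
    (hA : MeasurableSet[past x] A) (v c : Bool) :
    (fieldLaw b₁ b₂ ρ).real (A ∩ {z | z (x + 1) = (v, c)}) =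
      (fieldLaw b₁ b₂ ρ).real A * (weight ρ v * weight (cond v b₁ b₂) c) := by
  have hind := iIndepFun_infinitePi (P := fun _ : ℤ => siteLaw b₁ b₂ ρ)
    (X := fun i (v : Bool × Bool) => v) (fun i => measurable_id)
  have h2 := indep_iSup_of_disjoint (m := fun i : ℤ =>
    (inferInstance : MeasurableSpace (Bool × Bool)).comap fun z : ℤ → Bool × Bool => z i)
    (fun i => (measurable_pi_apply i).comap_le) hind
    (S := Set.Iic x) (T := {x + 1}) (by simp)
  have hB : MeasurableSet[⨆ i ∈ ({x + 1} : Set ℤ), (inferInstance :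
      MeasurableSpace (Bool × Bool)).comap fun z : ℤ → Bool × Bool => z i]
      {z | z (x + 1) = (v, c)} := by
    exact (le_iSup₂_of_le (f := fun i (_ : i ∈ ({x + 1} : Set ℤ)) =>
      (inferInstance : MeasurableSpace (Bool × Bool)).comap fun z : ℤ → Bool × Bool => z i)
      (x + 1) rfl le_rfl) _ ⟨{(v, c)}, measurableSet_singleton _, rfl⟩
  have h3 := (Indep_iff _ _ _).1 h2 A {z | z (x + 1) = (v, c)} hA hB
  have h4 : (fieldLaw b₁ b₂ ρ).real {z | z (x + 1) = (v, c)} = (siteLaw b₁ b₂ ρ).real {(v, c)} := by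
    rw [← Measure.infinitePi_map_eval (fun _ : ℤ => siteLaw b₁ b₂ ρ) (x + 1), measureReal_def,
      measureReal_def, Measure.map_apply (measurable_pi_apply _) (measurableSet_singleton _)]
    rfl
  rw [← siteLaw_real_singleton, ← h4, measureReal_def, measureReal_def, measureReal_def,
    ← ENNReal.toReal_mul]
  exact congrArg ENNReal.toReal h3

lemma flux_congr {η c η' c' : ℤ → Bool} {x : ℤ} (h : ∀ i ≤ x, η i = η' i ∧ c i = c' i) :
    flux η c x = flux η' c' x := by
  have key : Flows η c x ↔ Flows η' c' x := by
    constructor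
    · rintro ⟨y, hy, h1, h2, h3⟩
      exact ⟨y, hy, by rw [← (h y hy).1, h1], by rw [← (h y hy).2, h2], fun w hw hw' => by
        rw [← (h w hw').1, ← (h w hw').2]; exact h3 w hw hw'⟩
    · rintro ⟨y, hy, h1, h2, h3⟩
      exact ⟨y, hy, by rw [(h y hy).1, h1], by rw [(h y hy).2, h2], fun w hw hw' => by
        rw [(h w hw').1, (h w hw').2]; exact h3 w hw hw'⟩
  rw [Bool.eq_iff_iff]
  simpa [flux] using key

/-- The occupation variables after the update lie in `t` on a window, and the flux out of the
window is `k`. -/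
def windowEvent (t : ℤ → Set Bool) (a : ℤ) (n : ℕ) (k : Bool) : Set (ℤ → Bool × Bool) :=
  {z | (∀ i, a < i → i ≤ a + n → sweep (occ z) (bit z) i ∈ t i) ∧
    flux (occ z) (bit z) (a + n) = k}

lemma measurableSet_windowEvent (t : ℤ → Set Bool) (a : ℤ) (n : ℕ) (k : Bool) :
    MeasurableSet (windowEvent t a n k) := by
  have h1 : ∀ i, MeasurableSet {z | sweep (occ z) (bit z) i ∈ t i} := fun i =>
    ((measurable_pi_apply i).comp measurable_fieldSweep) (Set.Finite.measurableSet (Set.toFinite _))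
  have h2 : MeasurableSet {z | flux (occ z) (bit z) (a + n) = k} :=
    measurable_fieldFlux (a + n) (measurableSet_singleton k)
  exact ((MeasurableSet.iInter fun i => MeasurableSet.iInter fun _ : a < i =>
    MeasurableSet.iInter fun _ : i ≤ a + n => h1 i).inter h2).congr (by
      ext z; simp only [windowEvent, Set.mem_inter_iff, Set.mem_iInter, Set.mem_ofPred_eq])

lemma measurableSet_past_windowEvent (t : ℤ → Set Bool) (a : ℤ) (n : ℕ) (k : Bool) :
    MeasurableSet[past (a + n)] (windowEvent t a n k) := by
  have h := measurable_past (x := a + n) (f := fun z => z ∈ windowEvent t a n k)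
    (measurableSet_setOfPred.1 (measurableSet_windowEvent t a n k)) (fun z z' hz => ?_)
  · exact (@measurableSet_setOfPred _ (past (a + n)) _).2 h
  · have hf : ∀ x ≤ a + n, flux (occ z) (bit z) x = flux (occ z') (bit z') x := fun x hx =>
      flux_congr fun i hi => by simp [occ, bit, hz i (hi.trans hx)]
    have hs : ∀ x ≤ a + n, sweep (occ z) (bit z) x = sweep (occ z') (bit z') x := fun x hx => by
      rw [sweep_eq, sweep_eq, hf _ (by omega)]
      rw [show occ z x = occ z' x from congrArg Prod.fst (hz x hx),
        show bit z x = bit z' x from congrArg Prod.snd (hz x hx)]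
    simp only [windowEvent, Set.mem_ofPred_eq, hf _ le_rfl, eq_iff_iff]
    refine and_congr (forall_congr' fun i => forall_congr' fun _ => forall_congr' fun hi => ?_)
      Iff.rfl
    rw [hs i hi]

/-- The occupation of the outgoing vertical edge of a vertex with incoming flux `f`, incoming
occupation `v` and bit `c`. -/
def outSite (f v c : Bool) : Bool := if v then f || c else f && !c

/-- The outgoing flux of a vertex with incoming flux `f`, incoming occupation `v` and bit `c`. -/
def outFlux (f v c : Bool) : Bool := if v then f || !c else f && c

open scoped Classical in
lemma windowEvent_succ_inter (t : ℤ → Set Bool) (a : ℤ) (n : ℕ) (k f v c : Bool) :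
    windowEvent t a (n + 1) k ∩
        (fun z => (flux (occ z) (bit z) (a + n), z (a + n + 1))) ⁻¹' {(f, v, c)} =
      if outSite f v c ∈ t (a + n + 1) ∧ outFlux f v c = k then
        windowEvent t a n f ∩ {z | z (a + n + 1) = (v, c)} else ∅ := by
  have hvert : ∀ z : ℤ → Bool × Bool, flux (occ z) (bit z) (a + n) = f → z (a + n + 1) = (v, c) →
      sweep (occ z) (bit z) (a + n + 1) = outSite f v c ∧
        flux (occ z) (bit z) (a + n + 1) = outFlux f v c := by
    intro z h1 h2
    rw [sweep_eq, flux_eq _ _ (a + n + 1), add_sub_cancel_right, h1,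
      show occ z (a + n + 1) = v from congrArg Prod.fst h2,
      show bit z (a + n + 1) = c from congrArg Prod.snd h2]
    exact ⟨rfl, rfl⟩
  have hcast : a + ((n + 1 : ℕ) : ℤ) = a + n + 1 := by push_cast; ring
  ext z
  simp only [windowEvent, Set.mem_inter_iff, Set.mem_preimage, Set.mem_singleton_iff,
    Set.mem_ofPred_eq, Prod.mk.injEq, hcast]
  constructor
  · rintro ⟨⟨h1, h2⟩, h3, h4⟩
    have h5 := hvert z h3 h4
    rw [if_pos ⟨by rw [← h5.1]; exact h1 _ (by omega) le_rfl, by rw [← h5.2]; exact h2⟩]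
    exact ⟨⟨fun i hi hi' => h1 i hi (by omega), h3⟩, h4⟩
  · intro h
    split_ifs at h with hc
    · obtain ⟨⟨h1, h3⟩, h4⟩ := h
      have h5 := hvert z h3 h4
      refine ⟨⟨fun i hi hi' => ?_, by rw [h5.2]; exact hc.2⟩, h3, h4⟩
      rcases (by omega : i ≤ a + n ∨ i = a + n + 1) with hi' | rfl
      · exact h1 i hi hi'
      · rw [h5.1]; exact hc.1
    · exact h.elim

open scoped Classical in
lemma fieldLaw_windowEvent_succ (b₁ b₂ ρ : I) (t : ℤ → Set Bool) (a : ℤ) (n : ℕ) (k : Bool) :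
    (fieldLaw b₁ b₂ ρ).real (windowEvent t a (n + 1) k) =
      ∑ r : Bool × Bool × Bool,
        if outSite r.1 r.2.1 r.2.2 ∈ t (a + n + 1) ∧ outFlux r.1 r.2.1 r.2.2 = k then
          (fieldLaw b₁ b₂ ρ).real (windowEvent t a n r.1) *
            (weight ρ r.2.1 * weight (cond r.2.1 b₁ b₂) r.2.2)
        else 0 := by
  have hg : Measurable fun z => (flux (occ z) (bit z) (a + n), z (a + n + 1)) :=
    (measurable_fieldFlux _).prodMk (measurable_pi_apply _)
  have h := sum_measureReal_preimage_singleton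
    (μ := (fieldLaw b₁ b₂ ρ).restrict (windowEvent t a (n + 1) k)) Finset.univ
    (fun y _ => hg (measurableSet_singleton y))
  rw [Finset.coe_univ, Set.preimage_univ, measureReal_restrict_apply MeasurableSet.univ,
    Set.univ_inter] at h
  rw [← h]
  refine Finset.sum_congr rfl fun r _ => ?_
  rw [measureReal_restrict_apply (hg (measurableSet_singleton r)), Set.inter_comm,
    windowEvent_succ_inter]
  split_ifs with hc
  · exact fieldLaw_inter _ _ _ (measurableSet_past_windowEvent _ _ _ _) _ _
  · simp

lemma fieldLaw_flux_const (b₁ b₂ ρ : I) (x : ℤ) :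
    (fieldLaw b₁ b₂ ρ).real {z | flux (occ z) (bit z) (x + 1) = true} =
      (fieldLaw b₁ b₂ ρ).real {z | flux (occ z) (bit z) x = true} := by
  have hmap : (fieldLaw b₁ b₂ ρ).map (fun z i => z (i + 1)) = fieldLaw b₁ b₂ ρ :=
    Measure.map_infinitePi_infinitePi_of_inj (f := fun i : ℤ => i + 1) (add_left_injective 1)
      (P := fun _ : ℤ => siteLaw b₁ b₂ ρ)
  conv_rhs => rw [← hmap]
  have hs : MeasurableSet {z | flux (occ z) (bit z) x = true} :=
    measurable_fieldFlux x (measurableSet_singleton true)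
  rw [measureReal_def, measureReal_def, Measure.map_apply (by fun_prop) hs]
  congr 2
  ext z
  have := flux_shift 1 (occ z) (bit z) x
  simp only [Set.mem_preimage, Set.mem_ofPred_eq]
  rw [← this]
  rfl

/-- The probability that a path crosses a given edge in the stationary model of density `ρ`. -/
noncomputable def fluxDensity (b₁ b₂ ρ : ℝ) : ℝ := ρ * (1 - b₁) / (1 - ρ * b₁ - (1 - ρ) * b₂)

lemma windowEvent_zero (t : ℤ → Set Bool) (a : ℤ) (k : Bool) :
    windowEvent t a 0 k = {z | flux (occ z) (bit z) a = k} := by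
  ext z
  simp only [windowEvent, Set.mem_ofPred_eq, Nat.cast_zero, add_zero]
  exact ⟨fun h => h.2, fun h => ⟨fun i hi hi' => by omega, h⟩⟩

lemma fieldLaw_flux_false (b₁ b₂ ρ : I) (x : ℤ) :
    (fieldLaw b₁ b₂ ρ).real {z | flux (occ z) (bit z) x = false} =
      1 - (fieldLaw b₁ b₂ ρ).real {z | flux (occ z) (bit z) x = true} := by
  have hs : MeasurableSet {z | flux (occ z) (bit z) x = true} :=
    measurable_fieldFlux x (measurableSet_singleton true)
  rw [← probReal_compl_eq_one_sub hs]
  congr 1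
  ext z
  simp

lemma denominator_pos {b₁ b₂ : I} (hb₁ : b₁ < 1) (hb₂ : b₂ < 1) (ρ : I) :
    0 < 1 - (ρ : ℝ) * b₁ - (1 - ρ) * b₂ := by
  have h1 : (b₁ : ℝ) < 1 := by exact_mod_cast hb₁
  have h2 : (b₂ : ℝ) < 1 := by exact_mod_cast hb₂
  have h3 := ρ.2.1
  have h4 := ρ.2.2
  rcases h3.eq_or_lt with h | h
  · rw [← h]; linarith
  · nlinarith [mul_pos h (sub_pos.2 h1), mul_nonneg (sub_nonneg.2 h4) (sub_pos.2 h2).le]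

/-- The field is i.i.d., so the flux probability `θ` is the same at `x` and `x + 1`; the vertex rule
gives `θ = ρ (1 - b₁) + θ (ρ b₁ + (1 - ρ) b₂)`. -/
lemma fieldLaw_flux (b₁ b₂ ρ : I) (hb₁ : b₁ < 1) (hb₂ : b₂ < 1) (x : ℤ) (k : Bool) :
    (fieldLaw b₁ b₂ ρ).real {z | flux (occ z) (bit z) x = k} =
      weight (fluxDensity b₁ b₂ ρ) k := by
  have h := fieldLaw_windowEvent_succ b₁ b₂ ρ (fun _ => Set.univ) x 0 true
  have h1 : windowEvent (fun _ => Set.univ) x 1 true = {z | flux (occ z) (bit z) (x + 1) = true} := by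
    ext z; simp [windowEvent]
  rw [zero_add, h1, fieldLaw_flux_const] at h
  simp only [windowEvent_zero, Fintype.sum_prod_type, Fintype.sum_bool, fieldLaw_flux_false] at h
  simp [weight, outFlux] at h
  have hD := denominator_pos hb₁ hb₂ ρ
  have key : (fieldLaw b₁ b₂ ρ).real {z | flux (occ z) (bit z) x = true} =
      fluxDensity b₁ b₂ ρ := by
    rw [fluxDensity, eq_div_iff hD.ne']
    linarith
  cases k
  · rw [fieldLaw_flux_false, key]; simp [weight]
  · rw [key]; simp [weight]

/-- A Burke property: independent incoming edges, of density `fluxDensity` horizontally and `ρ`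
vertically, leave independent with the same densities. All cases reduce to the equation `hθ`. -/
lemma vertex_identity {b₁ b₂ : I} (hb₁ : b₁ < 1) (hb₂ : b₂ < 1) (ρ : I) (t : Set Bool) (k : Bool)
    [DecidablePred (· ∈ t)] :
    (∑ r : Bool × Bool × Bool,
        if outSite r.1 r.2.1 r.2.2 ∈ t ∧ outFlux r.1 r.2.1 r.2.2 = k then
          weight (fluxDensity b₁ b₂ ρ) r.1 * (weight ρ r.2.1 * weight (cond r.2.1 b₁ b₂) r.2.2)
        else 0) =
      (bernoulliMeasure true false ρ).real t * weight (fluxDensity b₁ b₂ ρ) k := by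
  have hD := denominator_pos hb₁ hb₂ ρ
  rw [bernoulliMeasure_real_apply _ (Set.toFinite t).measurableSet]
  have hθ : fluxDensity b₁ b₂ ρ * (1 - (ρ : ℝ) * b₁ - (1 - ρ) * b₂) = ρ * (1 - b₁) :=
    div_mul_cancel₀ _ hD.ne'
  simp only [Fintype.sum_prod_type, Fintype.sum_bool]
  by_cases h1 : true ∈ t <;> by_cases h2 : false ∈ t <;> cases k <;>
    simp [h1, h2, weight, outSite, outFlux] <;> linarith

/-- The flux out of a window is independent of the updated occupations inside, which is what allows
one more site to be appended by `vertex_identity`. -/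
lemma fieldLaw_windowEvent (b₁ b₂ ρ : I) (hb₁ : b₁ < 1) (hb₂ : b₂ < 1) (t : ℤ → Set Bool) (a : ℤ)
    (n : ℕ) (k : Bool) :
    (fieldLaw b₁ b₂ ρ).real (windowEvent t a n k) =
      (∏ i ∈ Finset.Ioc a (a + n), (bernoulliMeasure true false ρ).real (t i)) *
        weight (fluxDensity b₁ b₂ ρ) k := by
  classical
  induction n generalizing k with
  | zero => simp [windowEvent_zero, fieldLaw_flux b₁ b₂ ρ hb₁ hb₂]
  | succ n ih =>
    have hI : Finset.Ioc a (a + ((n + 1 : ℕ) : ℤ)) =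
        insert (a + n + 1) (Finset.Ioc a (a + (n : ℤ))) := by
      ext i; simp only [Finset.mem_Ioc, Finset.mem_insert]; push_cast; omega
    rw [hI, Finset.prod_insert (by simp), mul_right_comm,
      ← vertex_identity hb₁ hb₂ ρ (t (a + n + 1)) k, fieldLaw_windowEvent_succ, Finset.sum_mul]
    refine Finset.sum_congr rfl fun r _ => ?_
    split_ifs with h
    · rw [ih]; ring
    · simp

theorem productBernoulli_invariant {b₁ b₂ : I} (hb₁ : b₁ < 1) (hb₂ : b₂ < 1) (ρ : I) :
    (kernel b₁ b₂).Invariant (productBernoulli ρ) := by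
  classical
  change (productBernoulli ρ).bind (kernel b₁ b₂) = productBernoulli ρ
  rw [← fieldLaw_map_sweep b₁ b₂ ρ hb₂]
  refine Measure.eq_infinitePi _ fun s t ht => ?_
  rw [Measure.map_apply measurable_fieldSweep
    (MeasurableSet.pi s.countable_toSet fun i _ => ht i)]
  obtain ⟨N, hN⟩ : ∃ N : ℕ, ∀ i ∈ s, |i| ≤ N := by
    refine ⟨s.sup Int.natAbs, fun i hi => ?_⟩
    have := Finset.le_sup (f := Int.natAbs) hi
    rw [Int.abs_eq_natAbs]
    exact_mod_cast this
  -- The finite set of sites is completed to an interval by unconstrained sites.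
  set t' : ℤ → Set Bool := fun i => if i ∈ s then t i else Set.univ with ht'
  set a : ℤ := -N - 1
  set n : ℕ := 2 * N + 1
  have hwin : ∀ i ∈ s, a < i ∧ i ≤ a + n := fun i hi => by
    have := abs_le.1 (hN i hi)
    simp only [a, n]; push_cast; omega
  have hset : (fun z => sweep (occ z) (bit z)) ⁻¹' Set.pi (s : Set ℤ) t =
      windowEvent t' a n true ∪ windowEvent t' a n false := by
    ext z
    simp only [windowEvent, Set.mem_preimage, Set.mem_pi, Finset.mem_coe, Set.mem_union,
      Set.mem_ofPred_eq]
    rw [← and_or_left, and_iff_left (by cases flux (occ z) (bit z) (a + n) <;> simp)]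
    constructor
    · intro h i _ _
      by_cases hi : i ∈ s
      · simpa [ht', hi] using h i hi
      · simp [ht', hi]
    · intro h i hi
      simpa [ht', hi] using h i (hwin i hi).1 (hwin i hi).2
  have hdisj : Disjoint (windowEvent t' a n true) (windowEvent t' a n false) :=
    Set.disjoint_left.2 fun z h1 h2 => by simpa [h1.2] using h2.2
  have hreal : (fieldLaw b₁ b₂ ρ).real (windowEvent t' a n true ∪ windowEvent t' a n false) =
      ∏ i ∈ s, (bernoulliMeasure true false ρ).real (t i) := by
    rw [measureReal_union hdisj (measurableSet_windowEvent _ _ _ _),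
      fieldLaw_windowEvent b₁ b₂ ρ hb₁ hb₂, fieldLaw_windowEvent b₁ b₂ ρ hb₁ hb₂, ← mul_add]
    simp only [weight, if_true, Bool.false_eq_true, if_false, add_sub_cancel, mul_one]
    symm
    calc ∏ i ∈ s, (bernoulliMeasure true false ρ).real (t i)
        = ∏ i ∈ s, (bernoulliMeasure true false ρ).real (t' i) :=
          Finset.prod_congr rfl fun i hi => by simp [ht', hi]
      _ = _ := Finset.prod_subset (fun i hi => Finset.mem_Ioc.2 (hwin i hi))
          fun i _ hi => by simp [ht', hi]
  rw [hset, ← ENNReal.toReal_eq_toReal_iff' (measure_ne_top _ _)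
    (ENNReal.prod_ne_top fun i _ => measure_ne_top _ _), ENNReal.toReal_prod]
  exact hreal

end S6V

namespace S6V
open MeasureTheory ProbabilityTheory unitInterval Filter Topology

/-! ### Particle counts -/

/-- The number of particles in `(a, a + n]`. -/
noncomputable def count (a : ℤ) (n : ℕ) (η : Config) : ℝ := ∑ x ∈ Finset.Ioc a (a + n), ((η x).toInt : ℝ)

/-- The expected distance between the number of particles in `(0, n]` and `n * ρ`. -/
noncomputable def deviation (ν : Measure Config) (ρ : ℝ) (n : ℕ) : ℝ :=
  ∫ η, |count 0 n η - n * ρ| ∂ν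

lemma measurable_toInt (x : ℤ) : Measurable fun η : Config => ((η x).toInt : ℝ) :=
  (measurable_of_countable fun b : Bool => (b.toInt : ℝ)).comp (measurable_pi_apply x)

lemma measurable_count (a : ℤ) (n : ℕ) : Measurable (count a n) :=
  Finset.measurable_fun_sum _ fun x _ => measurable_toInt x

lemma toInt_mem_Icc (b : Bool) : (b.toInt : ℝ) ∈ Set.Icc (0 : ℝ) 1 := by
  cases b <;> simp

lemma count_nonneg (a : ℤ) (n : ℕ) (η : Config) : 0 ≤ count a n η :=
  Finset.sum_nonneg fun _ _ => (toInt_mem_Icc _).1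

lemma count_le (a : ℤ) (n : ℕ) (η : Config) : count a n η ≤ n := by
  have h : count a n η ≤ ∑ _x ∈ Finset.Ioc a (a + (n : ℤ)), (1 : ℝ) :=
    Finset.sum_le_sum fun _ _ => (toInt_mem_Icc _).2
  simpa using h

lemma memLp_count (ν : Measure Config) [IsFiniteMeasure ν] (a : ℤ) (n : ℕ) (p : ENNReal) :
    MemLp (count a n) p ν :=
  MemLp.of_bound (measurable_count a n).aestronglyMeasurable n (ae_of_all _ fun η => by
    rw [Real.norm_eq_abs, abs_of_nonneg (count_nonneg a n η)]; exact count_le a n η)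

lemma integrable_abs_count_sub (ν : Measure Config) [IsFiniteMeasure ν] (a : ℤ) (n : ℕ) (r : ℝ) :
    Integrable (fun η => |count a n η - r|) ν :=
  ((memLp_one_iff_integrable.1 (memLp_count ν a n 1)).sub (integrable_const r)).abs

lemma count_shift (a : ℤ) (n : ℕ) (η : Config) : count 0 n (shift a η) = count a n η := by
  unfold count
  simp only [shift_apply, zero_add]
  refine Finset.sum_bij' (fun x _ => x + a) (fun x _ => x - a) ?_ ?_ ?_ ?_ ?_ <;>
    simp only [Finset.mem_Ioc] <;> intros <;> first | omega | rfl | simp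

lemma integral_abs_count_sub {ν : Measure Config} (hs : ∀ a, ν.map (shift a) = ν) (a : ℤ)
    (n : ℕ) (ρ : ℝ) : ∫ η, |count a n η - n * ρ| ∂ν = deviation ν ρ n := by
  rw [deviation]
  conv_rhs => rw [← hs a]
  have h : AEStronglyMeasurable (fun η => |count 0 n η - n * ρ|) (ν.map (shift a)) :=
    (continuous_abs.measurable.comp
      ((measurable_count 0 n).sub measurable_const)).aestronglyMeasurable
  rw [integral_map (measurable_shift a).aemeasurable h]
  simp only [count_shift]

lemma sum_gap_eq_count_sub (e : Config × Config) (a : ℤ) (n : ℕ) :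
    ∑ x ∈ Finset.Ioc a (a + n), (gap e.1 e.2 x : ℝ) = count a n e.1 - count a n e.2 := by
  simp [count, gap]

lemma memLp_toInt (ν : Measure Config) [IsFiniteMeasure ν] (x : ℤ) (p : ENNReal) :
    MemLp (fun η : Config => ((η x).toInt : ℝ)) p ν :=
  MemLp.of_bound (measurable_toInt x).aestronglyMeasurable 1 (ae_of_all _ fun η => by
    rw [Real.norm_eq_abs, abs_of_nonneg (toInt_mem_Icc _).1]; exact (toInt_mem_Icc _).2)

lemma pairwise_indepFun_toInt (ρ : I) {x y : ℤ} (hxy : x ≠ y) :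
    IndepFun (fun η : Config => ((η x).toInt : ℝ)) (fun η => ((η y).toInt : ℝ))
      (productBernoulli ρ) := by
  have hind := iIndepFun_infinitePi (P := fun _ : ℤ => bernoulliMeasure true false ρ)
    (X := fun _ (b : Bool) => b) fun _ => measurable_id
  exact (hind.indepFun hxy).comp (φ := fun b : Bool => (b.toInt : ℝ))
    (ψ := fun b : Bool => (b.toInt : ℝ)) (measurable_of_countable _) (measurable_of_countable _)

lemma variance_toInt_le (ρ : I) (x : ℤ) :
    variance (fun η : Config => ((η x).toInt : ℝ)) (productBernoulli ρ) ≤ 1 := by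
  have h := variance_le_sq_of_bounded (μ := productBernoulli ρ)
    (ae_of_all _ fun η : Config => toInt_mem_Icc (η x)) (measurable_toInt x).aemeasurable
  exact h.trans (by norm_num)

lemma variance_count_le (ρ : I) (n : ℕ) : variance (count 0 n) (productBernoulli ρ) ≤ n := by
  have h := IndepFun.variance_sum (μ := productBernoulli ρ)
    (X := fun (x : ℤ) (η : Config) => ((η x).toInt : ℝ)) (s := Finset.Ioc (0 : ℤ) (0 + n))
    (fun x _ => memLp_toInt _ x 2) fun x _ y _ hxy => pairwise_indepFun_toInt ρ hxy
  have h1 : (∑ x ∈ Finset.Ioc (0 : ℤ) (0 + n), fun η : Config => ((η x).toInt : ℝ)) = count 0 n := by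
    funext η; rw [Finset.sum_apply, count]
  rw [← h1, h]
  refine (Finset.sum_le_card_nsmul _ _ 1 fun x _ => variance_toInt_le ρ x).trans ?_
  simp

lemma integral_count (ρ : I) (n : ℕ) : ∫ η, count 0 n η ∂(productBernoulli ρ) = n * ρ := by
  unfold count
  have hi : ∀ x, Integrable (fun η : Config => ((η x).toInt : ℝ)) (productBernoulli ρ) := fun x =>
    memLp_one_iff_integrable.1 (memLp_toInt _ x 1)
  have h1 : ∀ x, ∫ η : Config, ((η x).toInt : ℝ) ∂(productBernoulli ρ) = ρ := by
    intro x
    have h2 : ∫ η : Config, ((η x).toInt : ℝ) ∂(productBernoulli ρ) =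
        ∫ b, (b.toInt : ℝ) ∂(bernoulliMeasure true false ρ) := by
      rw [← Measure.infinitePi_map_eval (fun _ : ℤ => bernoulliMeasure true false ρ) x,
        integral_map (measurable_pi_apply x).aemeasurable
          (measurable_of_countable _).aestronglyMeasurable]
      rfl
    rw [h2, integral_fintype (Integrable.of_finite)]
    simp [bernoulli_real_singleton, weight]
  rw [integral_finsetSum _ fun x _ => hi x]
  simp [h1]

lemma tendsto_deviation_productBernoulli (ρ : I) :
    Tendsto (fun n => deviation (productBernoulli ρ) ρ n / n) atTop (𝓝 0) := by
  have hle : ∀ n, deviation (productBernoulli ρ) ρ n ≤ Real.sqrt n := by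
    intro n
    rcases Nat.eq_zero_or_pos n with rfl | hn
    · simp [deviation, count]
    have hn' : (0 : ℝ) < n := by exact_mod_cast hn
    have hs := Real.sqrt_pos.2 hn'
    have hss := Real.mul_self_sqrt hn'.le
    have hsq : Integrable (fun η => (count 0 n η - n * ρ) ^ 2) (productBernoulli ρ) :=
      ((memLp_count _ 0 n 2).sub (memLp_const _)).integrable_sq
    have hvar : ∫ η, (count 0 n η - n * ρ) ^ 2 ∂(productBernoulli ρ) ≤ n := by
      rw [← integral_count ρ n, ← variance_eq_integral (measurable_count 0 n).aemeasurable]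
      exact variance_count_le ρ n
    -- From `2 √n |X| ≤ X² + n` and a variance of at most `n`.
    have h1 : 2 * Real.sqrt n * deviation (productBernoulli ρ) ρ n ≤ n + n := by
      rw [deviation, ← integral_const_mul]
      calc ∫ η, 2 * Real.sqrt n * |count 0 n η - n * ρ| ∂(productBernoulli ρ)
          ≤ ∫ η, ((count 0 n η - n * ρ) ^ 2 + n) ∂(productBernoulli ρ) := by
            refine integral_mono ((integrable_abs_count_sub _ 0 n _).const_mul _)
              (hsq.add (integrable_const _)) fun η => ?_
            have := sq_nonneg (|count 0 n η - n * ρ| - Real.sqrt n)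
            have h2 := sq_abs (count 0 n η - n * ρ)
            simp only
            nlinarith
        _ ≤ n + n := by
            rw [integral_add hsq (integrable_const _)]
            simpa using hvar
    nlinarith
  refine squeeze_zero (fun n => ?_) (fun n => ?_) (g := fun n : ℕ => (Real.sqrt n)⁻¹) ?_
  · exact div_nonneg (integral_nonneg fun _ => abs_nonneg _) (Nat.cast_nonneg n)
  · calc deviation (productBernoulli ρ) ρ n / n ≤ Real.sqrt n / n := by gcongr; exact hle n
      _ = (Real.sqrt n)⁻¹ := by rw [Real.sqrt_div_self', one_div]
  · exact (Real.tendsto_sqrt_atTop.comp tendsto_natCast_atTop_atTop).inv_tendsto_atTop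

/-- A stationary distribution whose particle averages concentrate at `ρ` is the product Bernoulli
measure of density `ρ`. -/
theorem CoinBound.eq_productBernoulli {b₁ b₂ : I} {m : ℝ} (hm : CoinBound b₁ b₂ m) (hb₁ : b₁ < 1)
    (hb₂ : b₂ < 1) {ν : Measure Config} [IsProbabilityMeasure ν] (hν : (kernel b₁ b₂).Invariant ν)
    (ρ : I) (h : Tendsto (fun n => deviation ν ρ n / n) atTop (𝓝 0)) : ν = productBernoulli ρ := by
  have hμ := productBernoulli_invariant hb₁ hb₂ ρ
  have h1 : (ν.prod (productBernoulli ρ)).map Prod.fst = ν := by simp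
  have h2 : (ν.prod (productBernoulli ρ)).map Prod.snd = productBernoulli ρ := by simp
  have hmap := pairStep_iterate_map hb₂ hν hμ _ h1 h2
  -- The start is the independent coupling. Independence is lost later, but each deviation involves
  -- one marginal only, hence is constant in time, and in `a` by translation invariance.
  refine hm.eq_of_invariant hν hμ _ h1 h2
    (s := fun n => deviation ν ρ n + deviation (productBernoulli ρ) ρ n) ?_ fun t n a => ?_
  · simpa [add_div] using h.add (tendsto_deviation_productBernoulli ρ)
  · set π := (pairStep b₁ b₂)^[t] (ν.prod (productBernoulli ρ))
    have hi1 : Integrable (fun e : Config × Config => |count a n e.1 - n * ρ|) π := by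
      have := integrable_abs_count_sub (π.map Prod.fst) a n (n * ρ)
      exact this.comp_measurable measurable_fst
    have hi2 : Integrable (fun e : Config × Config => |count a n e.2 - n * ρ|) π := by
      have := integrable_abs_count_sub (π.map Prod.snd) a n (n * ρ)
      exact this.comp_measurable measurable_snd
    have hmeas : AEStronglyMeasurable (fun η => |count a n η - n * ρ|) ν :=
      (integrable_abs_count_sub ν a n _).aestronglyMeasurable
    have e1 : ∫ e, |count a n e.1 - n * ρ| ∂π = deviation ν ρ n := by
      rw [← integral_abs_count_sub (hm.map_shift hν) a n ρ]
      conv_rhs => rw [← (hmap t).1]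
      rw [integral_map measurable_fst.aemeasurable
        (integrable_abs_count_sub _ a n _).aestronglyMeasurable]
    have e2 : ∫ e, |count a n e.2 - n * ρ| ∂π = deviation (productBernoulli ρ) ρ n := by
      rw [← integral_abs_count_sub (hm.map_shift hμ) a n ρ]
      conv_rhs => rw [← (hmap t).2]
      rw [integral_map measurable_snd.aemeasurable
        (integrable_abs_count_sub _ a n _).aestronglyMeasurable]
    rw [← e1, ← e2, ← integral_add hi1 hi2]
    refine integral_mono (integrable_finsetSum _ fun x _ => integrable_gap π x).abs
      (hi1.add hi2) fun e => ?_
    simp only [sum_gap_eq_count_sub]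
    have := abs_sub (count a n e.1 - n * ρ) (count a n e.2 - n * ρ)
    rwa [sub_sub_sub_cancel_right] at this

end S6V

namespace S6V
open MeasureTheory ProbabilityTheory unitInterval Filter Topology

/-! ### Extremal stationary distributions -/

lemma count_succ (n : ℕ) : count 0 (n + 1) = count 0 n + fun η => ((η (n + 1)).toInt : ℝ) := by
  funext η
  have hI : Finset.Ioc (0 : ℤ) (0 + ((n + 1 : ℕ) : ℤ)) =
      insert ((n : ℤ) + 1) (Finset.Ioc 0 (0 + (n : ℤ))) := by
    ext i; simp only [Finset.mem_Ioc, Finset.mem_insert]; push_cast; omega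
  rw [Pi.add_apply, count, hI, Finset.sum_insert (by simp), count, add_comm]

lemma count_sweep (η c : ℤ → Bool) (n : ℕ) :
    count 0 n (sweep η c) - count 0 n η = ((flux η c 0).toInt : ℝ) - (flux η c n).toInt := by
  induction n with
  | zero => simp [count]
  | succ n ih =>
    have h := sweep_add_flux η c (n + 1)
    rw [add_sub_cancel_right] at h
    have h' : ((sweep η c (n + 1)).toInt : ℝ) + (flux η c (n + 1)).toInt =
        (η (n + 1)).toInt + (flux η c n).toInt := by exact_mod_cast h
    rw [count_succ, Pi.add_apply, Pi.add_apply, Nat.cast_succ]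
    linarith

lemma abs_count_sweep_le (η c : ℤ → Bool) (n : ℕ) :
    |count 0 n (sweep η c) - count 0 n η| ≤ 1 := by
  rw [count_sweep, abs_le]
  have h1 := toInt_mem_Icc (flux η c 0)
  have h2 := toInt_mem_Icc (flux η c n)
  constructor <;> linarith [h1.1, h1.2, h2.1, h2.2]

/-- The particle averages of a translation invariant measure converge in mean. -/
lemma exists_tendsto_average {ν : Measure Config} [IsProbabilityMeasure ν]
    (hs : ν.map (shift 1) = ν) : ∃ G : Config → ℝ, Measurable G ∧
      Tendsto (fun n : ℕ => eLpNorm ((n : ℝ)⁻¹ • count 0 n - G) 1 ν) atTop (𝓝 0) := by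
  have hT : MeasurePreserving (shift 1) ν ν := ⟨measurable_shift 1, hs⟩
  -- The particle averages are Birkhoff averages, under the Koopman operator of the shift, of the
  -- occupation of site `1`; the mean ergodic theorem applies in `L²`.
  set U := (Lp.compMeasurePreservingₗᵢ (p := 2) (E := ℝ) ℝ (shift 1) hT).toContinuousLinearMap
    with hU
  set f := (memLp_toInt ν 1 2).toLp with hf
  have hlim := U.tendsto_birkhoffAverage_orthogonalProjection
    (LinearIsometry.norm_toContinuousLinearMap_le _) f
  set g := ((U.eqLocus (1 : Lp ℝ 2 ν →L[ℝ] Lp ℝ 2 ν)).orthogonalProjectionOnto f : Lp ℝ 2 ν)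
  have hiter : ∀ k : ℕ, U^[k] f = (memLp_toInt ν (k + 1) 2).toLp := by
    intro k
    induction k with
    | zero => simp [hf]
    | succ k ih =>
      rw [Function.iterate_succ_apply', ih]
      change Lp.compMeasurePreserving (shift 1) hT _ = _
      rw [Lp.toLp_compMeasurePreserving]
      rfl
  have hsum : ∀ n : ℕ, ∑ k ∈ Finset.range n, U^[k] f = (memLp_count ν 0 n 2).toLp := by
    intro n
    induction n with
    | zero =>
      have : count 0 0 = 0 := by funext η; simp [count]
      simp [this]
    | succ n ih =>
      rw [Finset.sum_range_succ, ih, hiter, ← MemLp.toLp_add]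
      congr 1
      exact (count_succ n).symm
  have hbirk : ∀ n : ℕ, birkhoffAverage ℝ U _root_.id n f =
      ((memLp_count ν 0 n 2).const_smul (n : ℝ)⁻¹).toLp := by
    intro n
    rw [birkhoffAverage, birkhoffSum, MemLp.toLp_const_smul _ (memLp_count ν 0 n 2), ← hsum]
    rfl
  refine ⟨g, (Lp.stronglyMeasurable g).measurable, ?_⟩
  rw [Lp.tendsto_Lp_iff_tendsto_eLpNorm'] at hlim
  refine tendsto_of_tendsto_of_tendsto_of_le_of_le tendsto_const_nhds hlim
    (fun _ => bot_le) fun n => ?_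
  simp only [hbirk]
  refine (eLpNorm_congr_ae ((MemLp.coeFn_toLp ((memLp_count ν 0 n 2).const_smul
    (n : ℝ)⁻¹)).symm.sub EventuallyEq.rfl)).le.trans ?_
  exact eLpNorm_le_eLpNorm_of_exponent_le one_le_two
    ((Lp.aestronglyMeasurable _).sub (Lp.aestronglyMeasurable _))

/-- The limit of the particle averages is preserved by the dynamics. -/
lemma average_sweep_ae_eq {b₁ b₂ : I} (hb₂ : b₂ < 1) {ν : Measure Config} [IsProbabilityMeasure ν]
    (hν : (kernel b₁ b₂).Invariant ν) {G : Config → ℝ} (hG : Measurable G)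
    (h : Tendsto (fun n : ℕ => eLpNorm ((n : ℝ)⁻¹ • count 0 n - G) 1 ν) atTop (𝓝 0)) :
    (fun q => G (sweep q.1 (ownBits q))) =ᵐ[ν.prod (coins b₁ b₂)] fun q => G q.1 := by
  set P := ν.prod (coins b₁ b₂)
  set S : Config × (ℤ × Bool → Bool) → Config := fun q => sweep q.1 (ownBits q) with hS
  have hSm : Measurable S := measurable_sweep.comp (measurable_fst.prodMk measurable_ownBits)
  have hSp : MeasurePreserving S P ν := ⟨hSm, (prod_map_sweep b₁ b₂ hb₂ ν).trans hν⟩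
  have hFp : MeasurePreserving Prod.fst P ν := measurePreserving_fst
  set A : ℕ → Config → ℝ := fun n => (n : ℝ)⁻¹ • count 0 n with hA
  have hAm : ∀ n, Measurable (A n) := fun n => (measurable_count 0 n).const_smul _
  have hAG : ∀ n, AEStronglyMeasurable (A n - G) ν := fun n =>
    ((hAm n).sub hG).aestronglyMeasurable
  -- `G` after and before the step is compared with the averages over `n` sites, which a step moves
  -- by at most `1 / n`.
  have hbound : ∀ n : ℕ, eLpNorm (G ∘ S - G ∘ Prod.fst) 1 P ≤
      eLpNorm (A n - G) 1 ν + ENNReal.ofReal (n : ℝ)⁻¹ + eLpNorm (A n - G) 1 ν := by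
    intro n
    have e : G ∘ S - G ∘ Prod.fst =
        -((A n - G) ∘ S) + (A n ∘ S - A n ∘ Prod.fst) + (A n - G) ∘ Prod.fst := by
      funext q; simp
    have m1 : AEStronglyMeasurable (-((A n - G) ∘ S)) P :=
      (((hAm n).sub hG).comp hSm).neg.aestronglyMeasurable
    have m2 : AEStronglyMeasurable (A n ∘ S - A n ∘ Prod.fst) P :=
      (((hAm n).comp hSm).sub ((hAm n).comp measurable_fst)).aestronglyMeasurable
    have m3 : AEStronglyMeasurable ((A n - G) ∘ Prod.fst) P :=
      (((hAm n).sub hG).comp measurable_fst).aestronglyMeasurable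
    rw [e]
    refine (eLpNorm_add_le (m1.add m2) m3 le_rfl).trans ?_
    refine add_le_add ((eLpNorm_add_le m1 m2 le_rfl).trans (add_le_add ?_ ?_)) ?_
    · rw [eLpNorm_neg, eLpNorm_comp_measurePreserving (hAG n) hSp]
    · have hb : ∀ᵐ q ∂P, ‖(A n ∘ S - A n ∘ Prod.fst : _ → ℝ) q‖ ≤ (n : ℝ)⁻¹ := ae_of_all _ fun q => by
        have := abs_count_sweep_le q.1 (ownBits q) n
        simp only [hA, hS, Pi.sub_apply, Function.comp, Pi.smul_apply, smul_eq_mul, ← mul_sub,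
          norm_mul, Real.norm_eq_abs]
        rw [abs_of_nonneg (by positivity : (0 : ℝ) ≤ (n : ℝ)⁻¹)]
        exact mul_le_of_le_one_right (by positivity) this
      simpa using eLpNorm_le_of_ae_bound (p := 1) hb
    · rw [eLpNorm_comp_measurePreserving (hAG n) hFp]
  have hzero : eLpNorm (G ∘ S - G ∘ Prod.fst) 1 P = 0 := by
    have hr : Tendsto (fun n : ℕ => ENNReal.ofReal (n : ℝ)⁻¹) atTop (𝓝 0) := by
      simpa using ENNReal.tendsto_ofReal (tendsto_inv_atTop_nhds_zero_nat (𝕜 := ℝ))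
    have := (h.add hr).add h
    simp only [add_zero] at this
    exact le_antisymm (ge_of_tendsto' this hbound) bot_le
  have hm : AEStronglyMeasurable (G ∘ S - G ∘ Prod.fst) P :=
    ((hG.comp hSm).sub (hG.comp measurable_fst)).aestronglyMeasurable
  filter_upwards [(eLpNorm_eq_zero_iff hm one_ne_zero).1 hzero] with q hq
  exact sub_eq_zero.1 hq

/-- The restriction of a stationary measure to a set preserved by the dynamics is stationary. -/
lemma invariant_restrict {b₁ b₂ : I} (hb₂ : b₂ < 1) {ν : Measure Config} [IsProbabilityMeasure ν]
    (hν : (kernel b₁ b₂).Invariant ν) {B : Set Config} (hB : MeasurableSet B)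
    (h : ∀ᵐ q ∂ν.prod (coins b₁ b₂), sweep q.1 (ownBits q) ∈ B ↔ q.1 ∈ B) :
    (kernel b₁ b₂).Invariant (ν.restrict B) := by
  have hSm : Measurable fun q : Config × (ℤ × Bool → Bool) => sweep q.1 (ownBits q) :=
    measurable_sweep.comp (measurable_fst.prodMk measurable_ownBits)
  change (ν.restrict B).bind (kernel b₁ b₂) = ν.restrict B
  rw [← prod_map_sweep b₁ b₂ hb₂]
  conv_lhs => rw [← Measure.restrict_univ (μ := coins b₁ b₂)]
  rw [Measure.prod_restrict]
  ext s hs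
  rw [Measure.map_apply hSm hs, Measure.restrict_apply (hSm hs), Measure.restrict_apply hs]
  conv_rhs => rw [← (hν : ν.bind (kernel b₁ b₂) = ν)]
  rw [← prod_map_sweep b₁ b₂ hb₂, Measure.map_apply hSm (hs.inter hB)]
  refine measure_congr ?_
  filter_upwards [h] with q hq
  exact propext (and_congr_right fun _ => ⟨fun hq' => hq.2 hq'.1, fun hq' => ⟨hq.1 hq', trivial⟩⟩)

lemma invariant_smul {b₁ b₂ : I} {ν : Measure Config} (hν : (kernel b₁ b₂).Invariant ν)
    (c : ENNReal) : (kernel b₁ b₂).Invariant (c • ν) := by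
  change (c • ν).bind (kernel b₁ b₂) = c • ν
  rw [Measure.bind_smul, (hν : ν.bind (kernel b₁ b₂) = ν)]

/-- An extremal stationary distribution is trivial on sets preserved by the dynamics. -/
lemma ae_or_ae_of_extreme {b₁ b₂ : I} (hb₂ : b₂ < 1) {ν : Measure Config}
    (hν : ν ∈ Set.extremePoints NNReal (stationaryDistributions b₁ b₂)) {B : Set Config}
    (hB : MeasurableSet B)
    (h : ∀ᵐ q ∂ν.prod (coins b₁ b₂), sweep q.1 (ownBits q) ∈ B ↔ q.1 ∈ B) :
    (∀ᵐ η ∂ν, η ∈ B) ∨ ∀ᵐ η ∂ν, η ∉ B := by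
  obtain ⟨⟨hp, hinv⟩, hext⟩ := hν
  by_contra hcon
  rw [not_or] at hcon
  have h1 : ν Bᶜ ≠ 0 := fun h0 => hcon.1 (by rw [ae_iff]; exact h0)
  have h2 : ν B ≠ 0 := fun h0 => hcon.2 (by rw [ae_iff]; simpa using h0)
  have hcond : ∀ C : Set Config, MeasurableSet C → ν C ≠ 0 →
      (∀ᵐ q ∂ν.prod (coins b₁ b₂), sweep q.1 (ownBits q) ∈ C ↔ q.1 ∈ C) →
      ProbabilityTheory.cond ν C ∈ stationaryDistributions b₁ b₂ := fun C hC h0 hq =>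
    ⟨cond_isProbabilityMeasure h0, invariant_smul (invariant_restrict hb₂ hinv hC hq) _⟩
  have hB1 := hcond B hB h2 h
  have hB2 := hcond Bᶜ hB.compl h1 (by
    filter_upwards [h] with q hq using not_congr hq)
  have hsum : ν B + ν Bᶜ = 1 := prob_add_prob_compl hB
  have hseg : ν ∈ openSegment NNReal (ProbabilityTheory.cond ν B) (ProbabilityTheory.cond ν Bᶜ) := by
    refine ⟨(ν B).toNNReal, (ν Bᶜ).toNNReal, ENNReal.toNNReal_pos h2 (measure_ne_top _ _),
      ENNReal.toNNReal_pos h1 (measure_ne_top _ _), ?_, ?_⟩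
    · rw [← ENNReal.toNNReal_add (measure_ne_top _ _) (measure_ne_top _ _), hsum,
        ENNReal.toNNReal_one]
    · have key : ∀ C : Set Config, ν C ≠ 0 → (ν C).toNNReal • ProbabilityTheory.cond ν C = ν.restrict C := by
        intro C h0
        ext s
        change (ν C).toNNReal • (ν[|C] s) = _
        rw [ENNReal.smul_def, smul_eq_mul, ENNReal.coe_toNNReal (measure_ne_top _ _),
          ProbabilityTheory.cond, Measure.smul_apply, smul_eq_mul, ← mul_assoc,
          ENNReal.mul_inv_cancel h0 (measure_ne_top _ _), one_mul]
      rw [key B h2, key Bᶜ h1, Measure.restrict_add_restrict_compl hB]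
  -- Extremality identifies `ν` with its conditioning on `B`, which gives `Bᶜ` no mass.
  have heq := hext hB1 hB2 hseg
  refine h1 ?_
  rw [← heq, cond_apply hB]
  simp

/-- The particle averages of an extremal stationary distribution concentrate at a constant. -/
lemma exists_tendsto_deviation_of_extreme {b₁ b₂ : I} {m : ℝ} (hm : CoinBound b₁ b₂ m)
    (hb₂ : b₂ < 1) {ν : Measure Config}
    (hν : ν ∈ Set.extremePoints NNReal (stationaryDistributions b₁ b₂)) :
    ∃ ρ : I, Tendsto (fun n => deviation ν ρ n / n) atTop (𝓝 0) := by
  obtain ⟨hp, hinv⟩ := hν.1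
  obtain ⟨G, hG, hlim⟩ := exists_tendsto_average (hm.map_shift hinv 1)
  have hGS := average_sweep_ae_eq hb₂ hinv hG hlim
  obtain ⟨r, hr⟩ : ∃ r, G =ᵐ[ν] Function.const Config r := by
    -- The preimages of measurable sets under `G` are preserved by the dynamics, hence trivial, so
    -- `G` is almost surely constant.
    refine exists_eventuallyEq_const_of_forall_separating MeasurableSet fun U hU => ?_
    refine ae_or_ae_of_extreme hb₂ hν (B := G ⁻¹' U) (hG hU) ?_
    filter_upwards [hGS] with q hq
    simp only [Set.mem_preimage, hq]
  have hdev : Tendsto (fun n => deviation ν r n / n) atTop (𝓝 0) := by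
    have h1 := (ENNReal.tendsto_toReal ENNReal.zero_ne_top).comp hlim
    rw [ENNReal.toReal_zero] at h1
    refine h1.congr' ?_
    filter_upwards [eventually_gt_atTop 0] with n hn
    have hn' : (0 : ℝ) < n := by exact_mod_cast hn
    have hm : AEStronglyMeasurable ((n : ℝ)⁻¹ • count 0 n - G) ν :=
      (((measurable_count 0 n).const_smul _).sub hG).aestronglyMeasurable
    rw [Function.comp, eLpNorm_one_eq_lintegral_enorm, ← integral_norm_eq_lintegral_enorm hm,
      deviation, ← integral_div]
    refine integral_congr_ae ?_
    filter_upwards [hr] with η hη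
    simp only [Pi.sub_apply, Pi.smul_apply, smul_eq_mul, hη, Function.const_apply,
      Real.norm_eq_abs]
    rw [← abs_of_pos hn', ← abs_div, abs_of_pos hn']
    congr 1
    field_simp
  -- `r` is the limit of the mean densities, which lie in `[0, 1]`.
  have hmem : r ∈ Set.Icc (0 : ℝ) 1 := by
    have hle : ∀ n : ℕ, 0 < n → |(∫ η, count 0 n η ∂ν) / n - r| ≤ deviation ν r n / n := by
      intro n hn
      have hn' : (0 : ℝ) < n := by exact_mod_cast hn
      have hi := memLp_one_iff_integrable.1 (memLp_count ν 0 n 1)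
      have h1 : (∫ η, count 0 n η ∂ν) / n - r = (∫ η, (count 0 n η - n * r) ∂ν) / n := by
        rw [integral_sub hi (integrable_const _)]
        simp
        field_simp
      rw [h1, abs_div, abs_of_pos hn']
      exact div_le_div_of_nonneg_right (abs_integral_le_integral_abs) hn'.le
    have ht : Tendsto (fun n : ℕ => (∫ η, count 0 n η ∂ν) / n) atTop (𝓝 r) := by
      rw [tendsto_iff_norm_sub_tendsto_zero]
      refine tendsto_of_tendsto_of_tendsto_of_le_of_le' tendsto_const_nhds hdev
        (Eventually.of_forall fun _ => norm_nonneg _) ?_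
      filter_upwards [eventually_gt_atTop 0] with n hn using hle n hn
    refine isClosed_Icc.mem_of_tendsto ht ?_
    filter_upwards [eventually_gt_atTop 0] with n hn
    have hn' : (0 : ℝ) < n := by exact_mod_cast hn
    have hi := memLp_one_iff_integrable.1 (memLp_count ν 0 n 1)
    refine ⟨div_nonneg (integral_nonneg fun η => count_nonneg 0 n η) hn'.le, ?_⟩
    rw [div_le_one hn']
    refine (integral_mono hi (integrable_const (n : ℝ)) fun η => count_le 0 n η).trans ?_
    simp
  exact ⟨⟨r, hmem⟩, hdev⟩

/-- A stationary component of a product Bernoulli measure is that measure. -/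
lemma CoinBound.eq_productBernoulli_of_component {b₁ b₂ : I} {m : ℝ} (hm : CoinBound b₁ b₂ m)
    (hb₁ : b₁ < 1) (hb₂ : b₂ < 1) {ρ : I} {ν ν' : Measure Config} [IsProbabilityMeasure ν]
    [IsProbabilityMeasure ν'] (hν : (kernel b₁ b₂).Invariant ν) {a b : NNReal} (ha : 0 < a)
    (h : a • ν + b • ν' = productBernoulli ρ) : ν = productBernoulli ρ := by
  refine hm.eq_productBernoulli hb₁ hb₂ hν ρ ?_
  have hlim := (tendsto_deviation_productBernoulli ρ).const_mul (a : ℝ)⁻¹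
  rw [mul_zero] at hlim
  refine squeeze_zero (fun n => div_nonneg (integral_nonneg fun _ => abs_nonneg _)
    (Nat.cast_nonneg n)) (fun n => ?_) hlim
  rw [← mul_div_assoc]
  refine div_le_div_of_nonneg_right ?_ (Nat.cast_nonneg n)
  have ha' : (0 : ℝ) < a := ha
  rw [le_inv_mul_iff₀ ha']
  have i1 := integrable_abs_count_sub ν 0 n (n * ρ)
  have i2 := integrable_abs_count_sub ν' 0 n (n * ρ)
  -- The deviation is linear in the measure and nonnegative, so that of `ν` is at most `a⁻¹` times
  -- that of the mixture.
  have h1 : deviation (productBernoulli ρ) ρ n = a * deviation ν ρ n + b * deviation ν' ρ n := by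
    rw [deviation, ← h, integral_add_measure i1.smul_measure_nnreal i2.smul_measure_nnreal,
      integral_smul_nnreal_measure, integral_smul_nnreal_measure]
    rfl
  rw [h1]
  have : 0 ≤ deviation ν' ρ n := integral_nonneg fun _ => abs_nonneg _
  have : 0 ≤ (b : ℝ) * deviation ν' ρ n := mul_nonneg b.2 this
  linarith

end S6V

/-! ### Conclusion -/

theorem mainTheorem1 (b₁ b₂ : unitInterval) (hb₁ : 0 < b₁ ∧ b₁ < 1) (hb₂ : 0 < b₂ ∧ b₂ < 1) :
    Set.extremePoints NNReal (S6V.stationaryDistributions b₁ b₂) =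
        Set.range S6V.productBernoulli ∧
      ∀ ν ∈ S6V.stationaryDistributions b₁ b₂, ∀ n : ℤ, ν.map (S6V.shift n) = ν := by
  obtain ⟨m, hm⟩ := S6V.exists_coinBound hb₁ hb₂
  refine ⟨Set.Subset.antisymm ?_ ?_, ?_⟩
  · intro ν hν
    obtain ⟨ρ, hρ⟩ := S6V.exists_tendsto_deviation_of_extreme hm hb₂.2 hν
    obtain ⟨hp, hinv⟩ := hν.1
    exact ⟨ρ, (hm.eq_productBernoulli hb₁.2 hb₂.2 hinv ρ hρ).symm⟩
  · rintro _ ⟨ρ, rfl⟩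
    refine ⟨⟨inferInstance, S6V.productBernoulli_invariant hb₁.2 hb₂.2 ρ⟩, ?_⟩
    rintro ν ⟨hp, hν⟩ ν' ⟨hp', -⟩ ⟨a, b, ha, -, -, h⟩
    exact hm.eq_productBernoulli_of_component hb₁.2 hb₂.2 hν ha h
  · rintro ν ⟨hp, hν⟩ n
    exact hm.map_shift hν n
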